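/- Let $n,d$ be positive integers, $v$ an indeterminate and $\mathcal A=\mathbb Z[v,v^{-1}]$. Decorated matrices. Let $\tilde\Xi$ be the set of pairs $(A,\Delta)$ with $A=(a_{ij})\in Mat_{n\times n}(\mathbb Z)$, $a_{ij}\ge 0$ for $i\ne j$, and $\Delta=\{(i_1,j_1),\dots,(i_k,j_k)\}$ a (possibly empty) set of positions with $i_1<\dots<i_k$, $j_k<\dots<j_1$, such that $a_{ij}>0$ for every $(i,j)\in\Delta$ with $i\neq j$. For $m\ge 1$ let $\Xi_{n|n,m}\subset\tilde\Xi$ be the subset of those $(A,\Delta)$ for which all $a_{ij}\ge 0$, $\sum_{i,j}a_{ij}=m$, and $a_{ij}>0$ for all $(i,j)\in\Delta$. Let $\mathrm{ro}(A)$ and $\mathrm{co}(A)$ be the vectors of row sums and of column sums, and let ${}_pA=A+pI$. The algebras $\mathcal{MS}_{n,m}$. For a finite field $\mathbb F_q$ let $V=\mathbb F_q^m$, let $\mathscr X$ be the set of $n$-step partial flags $0=V_0\subseteq V_1\subseteq\dots\subseteq V_n=V$, and for $(A,\Delta)\in\Xi_{n|n,m}$ let $\mathcal O_{A,\Delta}\subset\mathscr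 X\times\mathscr X\times V$ be the $GL(V)$-orbit of the triples $(f,f',w)$ for which there is a basis $e_{ij,s}$ ($1\le s\le a_{ij}$) of $V$ with $V_k=\langle e_{ij,s}: i\le k\rangle$, $V'_k=\langle e_{ij,s}: j\le k\rangle$ and $w=\sum_{(i,j)\in\Delta}e_{ij,1}$. Let $e_{A,\Delta}$ be the characteristic function of $\mathcal O_{A,\Delta}$. The convolution product is $(g*h)(f,f',w)=\sum_{f''\in\mathscr X,\,\mu\in V}g(f,f'',\mu)\,h(f'',f',w-\mu)$. The coefficients of the products $e_{B,\Delta'}*e_{A,\Delta}$ in the functions $e_{C,\Delta''}$ are the values at $q$ of unique polynomials in $\mathbb Z[q]$ that do not depend on the field; $\mathcal{MS}_{n,m}$ is the free $\mathcal A$-module with basis $\{e_{A,\Delta}:(A,\Delta)\in\Xi_{n|n,m}\}$ and with these structure constants, where $q=v^2$. Put $[A]_\Delta=v^{-\delta(A,\Delta)}e_{A,\Delta}$ with $$\delta(A,\Delta)=\sum_{i\ge k,\ j<l}a_{ij}a_{kl}+\sum_{\substack{(i,j):\ i\le k,\ j\le l\\ \text{for some }(k,l)\in\Delta}}a_{ij}.$$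 The algebra $\mathcal K$. For all $(A_1,\Delta_1),(A_2,\Delta_2)\in\tilde\Xi$ with $\mathrm{co}(A_1)=\mathrm{ro}(A_2)$ there are finitely many $(Z_i,\Delta_i')\in\tilde\Xi$ and elements $G_i(v,v')\in\mathbb Q(v)[v',v'^{-1}]$ such that $[{}_pA_1]_{\Delta_1}*[{}_pA_2]_{\Delta_2}=\sum_i G_i(v,v^{-p})[{}_pZ_i]_{\Delta_i'}$ for all large integers $p$; the coefficients $G_i(v,1)$ lie in $\mathcal A$ and are uniquely determined. Let $\mathcal K$ be the free $\mathcal A$-module with basis $\{[A]_\Delta:(A,\Delta)\in\tilde\Xi\}$ and with the $\mathcal A$-bilinear product given by $[A_1]_{\Delta_1}\cdot[A_2]_{\Delta_2}=\sum_iG_i(v,1)[Z_i]_{\Delta_i'}$ if $\mathrm{co}(A_1)=\mathrm{ro}(A_2)$, and by $0$ otherwise. Proposition. These products are well defined (in the sense just described), $\mathcal{MS}_{n,d}$ and $\mathcal K$ are associative, and the $\mathcal A$-linear map $\eta:\mathcal K\to\mathcal{MS}_{n,d}$ that sends $[A]_\Delta$ to $[A]_\Delta$ if $(A,\Delta)\in\Xi_{n|n,d}$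 and to $0$ otherwise is a surjective homomorphism of $\mathcal A$-algebras, that is, it is surjective and $\eta(x\cdot y)=\eta(x)*\eta(y)$ for all $x,y\in\mathcal K$. -/

import Mathlib

open scoped LaurentPolynomial

noncomputable section

namespace Mirabolic

/-! ### Decorated matrices -/

/-- The set `Ξ̃` of pairs `(A, Δ)`: `A` is an integer `n × n` matrix with nonnegative off-diagonal
entries, `Δ = {(i₁,j₁),…,(iₖ,jₖ)}` with `i₁ < ⋯ < iₖ` and `jₖ < ⋯ < j₁`, and `a_{ij} > 0` for all
off-diagonal `(i,j) ∈ Δ` (no condition on diagonal positions). -/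
@[ext]
structure XiTilde (n : ℕ) where
  A : Matrix (Fin n) (Fin n) ℤ
  Δ : Finset (Fin n × Fin n)
  offdiag_nonneg : ∀ i j, i ≠ j → 0 ≤ A i j
  strict : ∀ x ∈ Δ, ∀ y ∈ Δ, x ≠ y → (x.1 < y.1 ∧ y.2 < x.2) ∨ (y.1 < x.1 ∧ x.2 < y.2)
  decorated_pos : ∀ i j, (i, j) ∈ Δ → i ≠ j → 0 < A i j

namespace XiTilde

variable {n : ℕ}

/-- Row sums. -/
def ro (X : XiTilde n) (i : Fin n) : ℤ := ∑ j, X.A i j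

/-- Column sums. -/
def co (X : XiTilde n) (j : Fin n) : ℤ := ∑ i, X.A i j

/-- `(A, Δ) ↦ (A + p I, Δ)`. -/
def shift (p : ℤ) (X : XiTilde n) : XiTilde n where
  A := X.A + Matrix.diagonal fun _ => p
  Δ := X.Δ
  offdiag_nonneg i j h := by
    simpa [Matrix.diagonal_apply_ne _ h] using X.offdiag_nonneg i j h
  strict := X.strict
  decorated_pos i j hm h := by
    simpa [Matrix.diagonal_apply_ne _ h] using X.decorated_pos i j hm h

/-- `{(i,j)} ≤ Δ`: there is `(k,l) ∈ Δ` with `i ≤ k` and `j ≤ l`. -/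
def Below (X : XiTilde n) (i j : Fin n) : Prop := ∃ x ∈ X.Δ, i ≤ x.1 ∧ j ≤ x.2

open Classical in
/-- `d(A,Δ) - r(A,Δ) = ∑_{i ≥ k, j < l} a_{ij} a_{kl} + ∑_{{(i,j)} ≤ Δ} a_{ij}`. -/
def dr (X : XiTilde n) : ℤ :=
  (∑ i, ∑ j, ∑ k, ∑ l, if k ≤ i ∧ j < l then X.A i j * X.A k l else 0) +
    ∑ i, ∑ j, if X.Below i j then X.A i j else 0

end XiTilde

/-- The set `Ξ_{n|n,d}` of decorated matrices: all entries are natural numbers with sum `d`, and all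
entries at positions of `Δ` are positive. -/
def Xi (n d : ℕ) : Set (XiTilde n) :=
  {X | (∀ i j, 0 ≤ X.A i j) ∧ (∀ i j, (i, j) ∈ X.Δ → 0 < X.A i j) ∧ ∑ i, ∑ j, X.A i j = (d : ℤ)}

theorem Xi_finite (n d : ℕ) : (Xi n d).Finite := by
  have hb : ∀ X ∈ Xi n d, ∀ i j, X.A i j ≤ (d : ℤ) := by
    rintro X ⟨h0, -, hs⟩ i j
    rw [← hs]
    exact (Finset.single_le_sum (fun j _ => h0 i j) (Finset.mem_univ j)).trans
      (Finset.single_le_sum (f := fun i => ∑ j, X.A i j)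
        (fun i _ => Finset.sum_nonneg fun j _ => h0 i j) (Finset.mem_univ i))
  have hf : (Set.pi Set.univ fun _ : Fin n => Set.pi Set.univ fun _ : Fin n =>
      Set.Icc (0 : ℤ) d).Finite :=
    Set.Finite.pi fun _ => Set.Finite.pi fun _ => Set.finite_Icc _ _
  refine Set.Finite.of_finite_image
    (f := fun X : XiTilde n => ((X.A : Fin n → Fin n → ℤ), X.Δ)) ?_ ?_
  · refine (hf.prod (Set.finite_univ (α := Finset (Fin n × Fin n)))).subset ?_
    rintro _ ⟨X, hX, rfl⟩
    refine ⟨?_, trivial⟩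
    intro i _ j _
    exact ⟨hX.1 i j, hb X hX i j⟩
  · intro X _ Y _ h
    simp only [Prod.mk.injEq] at h
    exact XiTilde.ext h.1 h.2

instance (n d : ℕ) : Finite (Xi n d) := (Xi_finite n d).to_subtype

instance (n d : ℕ) : Fintype (Xi n d) := Fintype.ofFinite _

/-! ### Partial flags and orbits over a finite field -/

/-- `n`-step partial flags `0 = V_0 ⊆ V_1 ⊆ ⋯ ⊆ V_n = V` in `V = F^d`. -/
structure PFlag (F : Type) [Field F] (n d : ℕ) where
  V : Fin (n + 1) → Submodule F (Fin d → F)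
  mono : Monotone V
  zero : V 0 = ⊥
  last : V (Fin.last n) = ⊤

/-- Index set of a basis of `V` with `a_{ij}` vectors in position `(i,j)`. -/
abbrev BasisIdx {n : ℕ} (X : XiTilde n) : Type := Σ i : Fin n, Σ j : Fin n, Fin (X.A i j).toNat

open Classical in
/-- `(f, f', w)` lies in the `GL(V)`-orbit `O_{A,Δ}`: in some basis `e_{ij,m}` (`1 ≤ m ≤ a_{ij}`)
of `V` one has `V_k = ⟨e_{ij,m} : i ≤ k⟩`, `V'_k = ⟨e_{ij,m} : j ≤ k⟩` and
`w = ∑_{(i,j) ∈ Δ} e_{ij,1}`. -/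
def InOrbit {F : Type} [Field F] {n d : ℕ} (X : XiTilde n)
    (f f' : PFlag F n d) (w : Fin d → F) : Prop :=
  ∃ b : Module.Basis (BasisIdx X) F (Fin d → F),
    (∀ k, f.V k = Submodule.span F (b '' {x | x.1.val < k.val})) ∧
    (∀ k, f'.V k = Submodule.span F (b '' {x | x.2.1.val < k.val})) ∧
    w = ∑ x : BasisIdx X, if (x.1, x.2.1) ∈ X.Δ ∧ x.2.2.val = 0 then b x else 0

/-- The value at `(f, f', w)` of the convolution
`(g * h)(f, f', w) = ∑_{f'', μ} g(f, f'', μ) h(f'', f', w - μ)` of the characteristic functions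
of the orbits of `X` and `Y`. -/
def convCount {F : Type} [Field F] {n d : ℕ} (X Y : XiTilde n)
    (f f' : PFlag F n d) (w : Fin d → F) : ℕ :=
  Nat.card {t : PFlag F n d × (Fin d → F) // InOrbit X f t.1 t.2 ∧ InOrbit Y t.1 f' (w - t.2)}

/-- `P ∈ ℤ[q]` is the structure polynomial: over each finite field with `q` elements, `P(q)` is the
coefficient of `e_Z` in the convolution product `e_X * e_Y`. -/
def IsStructurePoly {n d : ℕ} (X Y Z : Xi n d) (P : Polynomial ℤ) : Prop :=
  ∀ (F : Type) [Field F] [Fintype F] (f f' : PFlag F n d) (w : Fin d → F),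
    InOrbit Z.1 f f' w → P.eval (Fintype.card F : ℤ) = (convCount X.1 Y.1 f f' w : ℤ)

open Classical in
/-- The structure polynomial. -/
def structurePoly {n d : ℕ} (X Y Z : Xi n d) : Polynomial ℤ :=
  if h : ∃ P, IsStructurePoly X Y Z P then h.choose else 0

/-! ### The mirabolic quantum Schur algebra -/

/-- `𝒜 = ℤ[v, v⁻¹]`; the indeterminate `v` is `LaurentPolynomial.T 1`. -/
abbrev Aring : Type := ℤ[T;T⁻¹]

/-- `MS_{n,d}`: the invariant `𝒜`-valued functions on triples, that is, the `𝒜`-valued functions on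
the set `Ξ_{n|n,d}` of orbits. -/
def MS (n d : ℕ) : Type := Xi n d → Aring

namespace MS

variable {n d : ℕ}

instance : AddCommGroup (MS n d) := inferInstanceAs (AddCommGroup (Xi n d → Aring))

instance : Module Aring (MS n d) := inferInstanceAs (Module Aring (Xi n d → Aring))

/-- The generic convolution product, with `q = v²`. -/
instance : Mul (MS n d) where
  mul g h := fun Z => ∑ X, ∑ Y,
    g X * h Y * Polynomial.aeval (LaurentPolynomial.T 2 : Aring) (structurePoly X Y Z)

theorem mul_apply (g h : MS n d) (Z : Xi n d) : (g * h) Z = ∑ X, ∑ Y,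
    g X * h Y * Polynomial.aeval (LaurentPolynomial.T 2 : Aring) (structurePoly X Y Z) := rfl

theorem add_apply (g h : MS n d) (Z : Xi n d) : (g + h) Z = g Z + h Z := rfl

theorem zero_apply (Z : Xi n d) : (0 : MS n d) Z = 0 := rfl

theorem smul_apply (c : Aring) (g : MS n d) (Z : Xi n d) : (c • g) Z = c * g Z := rfl

instance : NonUnitalNonAssocRing (MS n d) where
  left_distrib a b c := funext fun Z => by
    simp only [add_apply, mul_apply, mul_add, add_mul, Finset.sum_add_distrib]
  right_distrib a b c := funext fun Z => by
    simp only [add_apply, mul_apply, add_mul, Finset.sum_add_distrib]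
  zero_mul a := funext fun Z => by simp [mul_apply, zero_apply]
  mul_zero a := funext fun Z => by simp [mul_apply, zero_apply]

instance : IsScalarTower Aring (MS n d) (MS n d) where
  smul_assoc c g h := funext fun Z => by
    simp only [smul_eq_mul, smul_apply, mul_apply, Finset.mul_sum, mul_assoc]

instance : SMulCommClass Aring (MS n d) (MS n d) where
  smul_comm c g h := funext fun Z => by
    simp only [smul_eq_mul, smul_apply, mul_apply, Finset.mul_sum]
    exact Finset.sum_congr rfl fun _ _ => Finset.sum_congr rfl fun _ _ => by ring

open Classical in
/-- The characteristic function `e_{A,Δ}` of the orbit of `(A, Δ)`. -/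
def e (X : Xi n d) : MS n d := Pi.single (M := fun _ : Xi n d => Aring) X 1

/-- `[A]_Δ = v^{-d(A,Δ) + r(A,Δ)} e_{A,Δ}`. -/
def br (X : Xi n d) : MS n d := (LaurentPolynomial.T (-X.1.dr) : Aring) • e X

end MS

/-! ### Stabilization and the algebra `K` -/

/-- The field `ℚ(v)`. -/
abbrev Qv : Type := RatFunc ℚ

/-- `v` as a unit of `ℚ(v)`. -/
def vUnit : Qvˣ := Units.mk0 RatFunc.X RatFunc.X_ne_zero

/-- The inclusion `ℤ[v, v⁻¹] → ℚ(v)`. -/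
def incl : Aring →+* Qv := LaurentPolynomial.eval₂ (Int.castRingHom Qv) vUnit

/-- For `G(v,v') ∈ ℚ(v)[v', v'⁻¹]`, the value `G(v, v^{-p})`. -/
def evalAt (p : ℕ) (G : Qv[T;T⁻¹]) : Qv :=
  LaurentPolynomial.eval₂ (RingHom.id Qv) (vUnit ^ (-(p : ℤ))) G

/-- The finite family `G = (G_Z(v,v'))` satisfies
`[ₚX] * [ₚY] = ∑_Z G_Z(v, v^{-p}) [ₚZ]` in `ℚ(v) ⊗ MS_{n,m}`, for all large `p`, where `m` is the
sum of the entries of `ₚX`. -/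
def IsStabilization {n : ℕ} (X Y : XiTilde n) (G : XiTilde n →₀ Qv[T;T⁻¹]) : Prop :=
  ∃ p₀ : ℕ, ∀ p : ℕ, p₀ ≤ p →
    ∃ (m : ℕ) (hX : X.shift p ∈ Xi n m) (hY : Y.shift p ∈ Xi n m)
      (hZ : ∀ Z ∈ G.support, Z.shift p ∈ Xi n m),
      ∀ W : Xi n m,
        incl ((MS.br ⟨X.shift p, hX⟩ * MS.br ⟨Y.shift p, hY⟩ : MS n m) W) =
          ∑ Z : G.support,
            evalAt p (G Z.1) * incl (MS.br ⟨Z.1.shift p, hZ Z.1 Z.2⟩ W)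

/-- `c` is the family of specializations `G_Z(v, 1) ∈ 𝒜` of a stabilization at `v' = 1`. -/
def IsStableProduct {n : ℕ} (X Y : XiTilde n) (c : XiTilde n →₀ Aring) : Prop :=
  ∃ G : XiTilde n →₀ Qv[T;T⁻¹], IsStabilization X Y G ∧ ∀ Z, incl (c Z) = evalAt 0 (G Z)

open Classical in
/-- The product `[X] · [Y]` of two basis elements of `K`, in coordinates. -/
def stableProduct {n : ℕ} (X Y : XiTilde n) : XiTilde n →₀ Aring :=
  if h : X.co = Y.ro ∧ ∃ c, IsStableProduct X Y c then h.2.choose else 0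

/-- The algebra `K`: the free `𝒜`-module with basis `[A]_Δ`, `(A, Δ) ∈ Ξ̃`. -/
def K (n : ℕ) : Type := XiTilde n →₀ Aring

namespace K

variable {n : ℕ}

instance : AddCommGroup (K n) := inferInstanceAs (AddCommGroup (XiTilde n →₀ Aring))

instance : Module Aring (K n) := inferInstanceAs (Module Aring (XiTilde n →₀ Aring))

/-- The basis element `[A]_Δ`. -/
def br (X : XiTilde n) : K n := Finsupp.single X (1 : Aring)

/-- The `𝒜`-bilinear map with `([X], [Y]) ↦ [X] · [Y]`. -/
def mulHom : K n →ₗ[Aring] K n →ₗ[Aring] K n :=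
  Finsupp.linearCombination Aring (M := K n →ₗ[Aring] K n) fun X =>
    Finsupp.linearCombination Aring (M := K n) fun Y => (stableProduct X Y : K n)

instance : Mul (K n) where
  mul x y := mulHom x y

theorem mul_def (x y : K n) : x * y = mulHom x y := rfl

theorem br_mul_br (X Y : XiTilde n) : br X * br Y = (stableProduct X Y : K n) := by
  rw [mul_def, mulHom, br, br]
  erw [Finsupp.linearCombination_single, one_smul, Finsupp.linearCombination_single, one_smul]

instance : NonUnitalNonAssocRing (K n) where
  left_distrib a b c := by simp only [mul_def, map_add]
  right_distrib a b c := by simp only [mul_def, map_add, LinearMap.add_apply]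
  zero_mul a := by simp only [mul_def, map_zero, LinearMap.zero_apply]
  mul_zero a := by simp only [mul_def, map_zero]

instance : IsScalarTower Aring (K n) (K n) where
  smul_assoc c x y := by simp only [smul_eq_mul, mul_def, map_smul, LinearMap.smul_apply]

instance : SMulCommClass Aring (K n) (K n) where
  smul_comm c x y := by simp only [smul_eq_mul, mul_def, map_smul]

end K

end Mirabolic

end

/-! The heart is a uniformity statement. For fixed `X` and `Y`, the convolution of the orbit
functions of `X.shift p` and `Y.shift p` is a combination of orbit functions of finitely many
`Z.shift p`, with coefficients `G(q, q ^ p) / D(q)`, where `G` is a Laurent polynomial and `D` is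
monic. This holds for all finite fields, all `p ≥ 0` and all dimensions `m` at once, an orbit
function being zero when its matrix is not in `Xi n m`.

An orbit is determined by the relative position of the two flags and by the lower set of positions
generated by the vector (`mem_Xi_and_inOrbit_iff`). Möbius inversion over lower sets replaces orbit
functions by the functions `Fam.phi A I`, where the vector is only required to lie in the subspace
attached to `I`. Convolution with an elementary one-dimensional move of a flag is computed by
counting vectors or functionals in one row of an adapted basis (`Adapted.up_formula`,
`Adapted.down_formula`); convolution with a diagonal `phi` counts decompositions of a vector. An
induction on the distance of `A` from the diagonal matrices expresses every `phi A I` through these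
(`Fam.good2_phi`).

A coefficient of this form that vanishes for all prime `q` and all large `p` vanishes identically
(`IsCoef.eq_zero`), so identities valid where orbits exist descend to `p = 0`. For integrality,
point counts show that `D` divides `G(q, q ^ p)` for large `p`; as a function of `p` this is an
exponential sum with unit bases, whose recurrence can be run backwards, so `D` divides `G(q, 1)` too
(`dvd_of_expSum`).

With `q = v²`, `q ^ p = v'⁻²` and the affine dependence of the normalizing exponent on `p`, this
gives the stabilization, and `v' = 1` corresponds to `p = 0`. Hence the product of `K` is the
uniform formula at `p = 0`. For `m = d` that formula is literally convolution in `MS n d`, where the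
orbit functions of elements outside `Xi n d` are zero; this makes η multiplicative
(`K.brImage_mul`). Associativity of `K` descends from convolution, and that of `MS n d` follows
because η is surjective. -/

noncomputable section

namespace Mirabolic

/-! ### Relative position of two flags and adapted bases -/

section Relative

variable {F : Type} [Field F] {n d : ℕ}

open Module Submodule

/-- The relative position of two flags: the dimensions of the bigraded pieces. -/
def pos (f f' : PFlag F n d) : Matrix (Fin n) (Fin n) ℤ := fun i j =>
  ((finrank F ↥(f.V i.succ ⊓ f'.V j.succ) : ℤ) - finrank F ↥(f.V i.castSucc ⊓ f'.V j.succ)) -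
    ((finrank F ↥(f.V i.succ ⊓ f'.V j.castSucc) : ℤ) -
      finrank F ↥(f.V i.castSucc ⊓ f'.V j.castSucc))

theorem pos_apply (f f' : PFlag F n d) (i j : Fin n) : pos f f' i j =
    ((finrank F ↥(f.V i.succ ⊓ f'.V j.succ) : ℤ) - finrank F ↥(f.V i.castSucc ⊓ f'.V j.succ)) -
    ((finrank F ↥(f.V i.succ ⊓ f'.V j.castSucc) : ℤ) -
      finrank F ↥(f.V i.castSucc ⊓ f'.V j.castSucc)) := rfl

/-- The sum of the intersections `V_i ∩ V'_j` over a set of positions. -/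
def spanBelow (f f' : PFlag F n d) (I : Set (Fin n × Fin n)) : Submodule F (Fin d → F) :=
  ⨆ x ∈ I, f.V x.1.succ ⊓ f'.V x.2.succ

/-- The part of `V_i ∩ V'_j` coming from smaller positions. -/
def lowerPart (f f' : PFlag F n d) (i j : Fin n) : Submodule F (Fin d → F) :=
  (f.V i.castSucc ⊓ f'.V j.succ) ⊔ (f.V i.succ ⊓ f'.V j.castSucc)

/-- A basis, graded by rows and columns, which is adapted to a pair of flags. -/
structure Adapted (f f' : PFlag F n d) {ι : Type} (b : Basis ι F (Fin d → F))
    (r s : ι → Fin n) : Prop where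
  left : ∀ k, f.V k = span F (b '' {x | (r x).val < k.val})
  right : ∀ k, f'.V k = span F (b '' {x | (s x).val < k.val})

theorem mem_span_basis_image {ι V : Type} [AddCommGroup V] [Module F V] (b : Basis ι F V)
    (S : Set ι) (v : V) : v ∈ span F (b '' S) ↔ ∀ x, b.repr v x ≠ 0 → x ∈ S := by
  rw [Basis.mem_span_image]
  simp [Set.subset_def]

theorem card_filter_eq_add {ι : Type} [Fintype ι] (p q : ι → Prop) [DecidablePred p]
    [DecidablePred q] (h : ∀ x, p x → q x) :
    (Finset.univ.filter q).card =
      (Finset.univ.filter p).card + (Finset.univ.filter fun x => q x ∧ ¬ p x).card := by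
  classical
  rw [← Finset.card_union_of_disjoint]
  · congr 1
    ext x
    have := h x
    simp only [Finset.mem_filter, Finset.mem_univ, true_and, Finset.mem_union]
    tauto
  · rw [Finset.disjoint_left]
    simp +contextual

namespace Adapted

variable {f f' : PFlag F n d} {ι : Type} {b : Basis ι F (Fin d → F)} {r s : ι → Fin n}

theorem swap (h : Adapted f f' b r s) : Adapted f' f b s r := ⟨h.right, h.left⟩

theorem mem_left (h : Adapted f f' b r s) (k : Fin (n + 1)) (v : Fin d → F) :
    v ∈ f.V k ↔ ∀ x, b.repr v x ≠ 0 → (r x).val < k.val := by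
  rw [h.left, mem_span_basis_image]; rfl

theorem mem_right (h : Adapted f f' b r s) (k : Fin (n + 1)) (v : Fin d → F) :
    v ∈ f'.V k ↔ ∀ x, b.repr v x ≠ 0 → (s x).val < k.val :=
  h.swap.mem_left k v

theorem basis_mem_left (h : Adapted f f' e r s) (x : ι) : e x ∈ f.V (r x).succ := by
  rw [h.mem_left]
  intro y hy
  have : y = x := by
    by_contra hne
    simp [Ne.symm hne] at hy
  subst this
  simp

theorem inf_eq (h : Adapted f f' b r s) (k l : Fin (n + 1)) :
    f.V k ⊓ f'.V l = span F (b '' {x | (r x).val < k.val ∧ (s x).val < l.val}) := by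
  ext v
  rw [mem_inf, h.mem_left, h.mem_right, mem_span_basis_image]
  simp only [Set.mem_ofPred_eq]
  exact ⟨fun H x hx => ⟨H.1 x hx, H.2 x hx⟩, fun H => ⟨fun x hx => (H x hx).1, fun x hx => (H x hx).2⟩⟩

theorem finrank_inf [Fintype ι] (h : Adapted f f' b r s) (k l : Fin (n + 1)) :
    finrank F ↥(f.V k ⊓ f'.V l) =
      (Finset.univ.filter fun x => (r x).val < k.val ∧ (s x).val < l.val).card := by
  classical
  rw [h.inf_eq, finrank_span_set_eq_card, Set.toFinset_card, Set.card_image_of_injective _ b.injective]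
  · rw [Fintype.card_subtype]
    rfl
  · exact b.linearIndependent.linearIndepOn_id.mono (Set.image_subset_range _ _)

/-- Inclusion–exclusion over four nested rectangles of positions leaves the basis vectors graded
exactly `(i, j)`. -/
theorem pos_eq [Fintype ι] (h : Adapted f f' b r s) (i j : Fin n) :
    pos f f' i j = (Finset.univ.filter fun x => r x = i ∧ s x = j).card := by
  simp only [pos_apply, h.finrank_inf, Fin.val_succ, Fin.val_castSucc]
  rw [card_filter_eq_add (fun x => (r x).val < i.val ∧ (s x).val < j.val + 1)
      (fun x => (r x).val < i.val + 1 ∧ (s x).val < j.val + 1) (fun x hx => ⟨by omega, hx.2⟩),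
    card_filter_eq_add (fun x => (r x).val < i.val ∧ (s x).val < j.val)
      (fun x => (r x).val < i.val + 1 ∧ (s x).val < j.val) (fun x hx => ⟨by omega, hx.2⟩),
    card_filter_eq_add (fun x => ((r x).val < i.val + 1 ∧ (s x).val < j.val) ∧
        ¬ ((r x).val < i.val ∧ (s x).val < j.val))
      (fun x => ((r x).val < i.val + 1 ∧ (s x).val < j.val + 1) ∧
        ¬ ((r x).val < i.val ∧ (s x).val < j.val + 1)) (fun x hx => by omega)]
  rw [Finset.filter_congr (q := fun x => r x = i ∧ s x = j)
    (p := fun x => (((r x).val < i.val + 1 ∧ (s x).val < j.val + 1) ∧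
        ¬ ((r x).val < i.val ∧ (s x).val < j.val + 1)) ∧ ¬ (((r x).val < i.val + 1 ∧ (s x).val < j.val) ∧
        ¬ ((r x).val < i.val ∧ (s x).val < j.val)))]
  · push_cast; ring
  · intro x _
    rw [Fin.ext_iff, Fin.ext_iff]
    omega

/-- In an adapted basis the subspace attached to a lower set is a coordinate subspace, so conditions
on a vector become conditions on its support. -/
theorem mem_spanBelow (h : Adapted f f' b r s) {I : Set (Fin n × Fin n)} (hI : IsLowerSet I)
    (v : Fin d → F) : v ∈ spanBelow f f' I ↔ ∀ x, b.repr v x ≠ 0 → (r x, s x) ∈ I := by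
  have : spanBelow f f' I = span F (b '' {x | (r x, s x) ∈ I}) := by
    apply le_antisymm
    · refine iSup₂_le fun y hy => ?_
      rw [h.inf_eq]
      refine span_mono (Set.image_mono fun x hx => ?_)
      simp only [Set.mem_ofPred_eq, Fin.val_succ] at hx
      exact hI (Prod.mk_le_mk.2 ⟨Fin.le_def.2 (by omega), Fin.le_def.2 (by omega)⟩ : (r x, s x) ≤ (y.1, y.2)) hy
    · rw [span_le]
      rintro _ ⟨x, hx, rfl⟩
      refine (le_iSup₂_of_le (f := fun (y : Fin n × Fin n) (_ : y ∈ I) =>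
        f.V y.1.succ ⊓ f'.V y.2.succ) _ hx le_rfl) ?_
      rw [h.inf_eq]
      exact subset_span ⟨x, by simp, rfl⟩
  rw [this, mem_span_basis_image]; rfl

end Adapted

theorem lowerPart_le (f f' : PFlag F n d) (i j : Fin n) :
    lowerPart f f' i j ≤ f.V i.succ ⊓ f'.V j.succ :=
  sup_le (inf_le_inf_right _ (f.mono (Fin.castSucc_le_succ i)))
    (inf_le_inf_left _ (f'.mono (Fin.castSucc_le_succ j)))

theorem finrank_lowerPart (f f' : PFlag F n d) (i j : Fin n) :
    (finrank F ↥(f.V i.succ ⊓ f'.V j.succ) : ℤ) = finrank F ↥(lowerPart f f' i j) + pos f f' i j := by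
  have h := finrank_sup_add_finrank_inf_eq (f.V i.castSucc ⊓ f'.V j.succ)
    (f.V i.succ ⊓ f'.V j.castSucc)
  have h2 : (f.V i.castSucc ⊓ f'.V j.succ) ⊓ (f.V i.succ ⊓ f'.V j.castSucc) =
      f.V i.castSucc ⊓ f'.V j.castSucc := by
    have h1 := f.mono (Fin.castSucc_le_succ i)
    have h2 := f'.mono (Fin.castSucc_le_succ j)
    apply le_antisymm
    · exact le_inf (inf_le_left.trans inf_le_left) (inf_le_right.trans inf_le_right)
    · exact le_inf (inf_le_inf_left _ h2) (inf_le_inf_right _ h1)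
  rw [h2] at h
  rw [pos_apply]
  unfold lowerPart
  omega

theorem pos_nonneg (f f' : PFlag F n d) (i j : Fin n) : 0 ≤ pos f f' i j := by
  have h := finrank_lowerPart f f' i j
  have := finrank_mono (lowerPart_le f f' i j)
  omega

theorem sum_succ_sub_castSucc {M : Type*} [AddCommGroup M] {n : ℕ} (g : Fin (n + 1) → M) :
    ∑ i : Fin n, (g i.succ - g i.castSucc) = g (Fin.last n) - g 0 := by
  have h1 := Fin.sum_univ_succ g
  rw [Fin.sum_univ_castSucc] at h1
  rw [Finset.sum_sub_distrib, sub_eq_sub_iff_add_eq_add, add_comm, ← h1, add_comm]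

theorem sum_pos_row (f f' : PFlag F n d) (i : Fin n) :
    ∑ j, pos f f' i j = (finrank F (f.V i.succ) : ℤ) - finrank F (f.V i.castSucc) := by
  rw [Finset.sum_congr rfl fun j _ => pos_apply f f' i j, sum_succ_sub_castSucc
    (fun j : Fin (n + 1) => (finrank F ↥(f.V i.succ ⊓ f'.V j) : ℤ) -
      finrank F ↥(f.V i.castSucc ⊓ f'.V j)), f'.last, f'.zero, inf_top_eq, inf_top_eq,
    inf_bot_eq, inf_bot_eq, finrank_bot]
  simp

theorem pos_swap (f f' : PFlag F n d) : pos f' f = (pos f f').transpose := by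
  have h : ∀ a b, finrank F ↥(f'.V a ⊓ f.V b) = finrank F ↥(f.V b ⊓ f'.V a) :=
    fun a b => by rw [inf_comm]
  ext i j
  simp only [pos_apply, Matrix.transpose_apply, h]
  ring

theorem sum_pos_col (f f' : PFlag F n d) (j : Fin n) :
    ∑ i, pos f f' i j = (finrank F (f'.V j.succ) : ℤ) - finrank F (f'.V j.castSucc) := by
  rw [← sum_pos_row f' f, pos_swap]; rfl

theorem sum_pos (f f' : PFlag F n d) : ∑ i, ∑ j, pos f f' i j = d := by
  rw [Finset.sum_congr rfl fun i _ => sum_pos_row f f' i]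
  rw [sum_succ_sub_castSucc (fun i => (finrank F (f.V i) : ℤ)), f.last, f.zero]
  simp

theorem spanBelow_swap (f f' : PFlag F n d) (I : Set (Fin n × Fin n)) :
    spanBelow f' f (Prod.swap ⁻¹' I) = spanBelow f f' I := by
  unfold spanBelow
  apply le_antisymm
  · refine iSup₂_le fun y hy => ?_
    rw [inf_comm]
    exact le_iSup₂_of_le (f := fun (y : Fin n × Fin n) (_ : y ∈ I) =>
        f.V y.1.succ ⊓ f'.V y.2.succ) y.swap hy le_rfl
  · refine iSup₂_le fun y hy => ?_
    rw [inf_comm]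
    exact le_iSup₂_of_le (f := fun (y : Fin n × Fin n) (_ : y ∈ Prod.swap ⁻¹' I) =>
        f'.V y.1.succ ⊓ f.V y.2.succ) y.swap (by simpa using hy) le_rfl

theorem spanBelow_mono (f f' : PFlag F n d) {I J : Set (Fin n × Fin n)} (h : I ⊆ J) :
    spanBelow f f' I ≤ spanBelow f f' J := biSup_mono h

/-- Extends `L` to `G` one vector at a time, starting with the prescribed `u`. The guard `a ≠ 0` is
needed because `G = L` when `a = 0`, and then `u` does lie in `L`. -/
theorem exists_lift {V : Type} [AddCommGroup V] [Module F V] [FiniteDimensional F V] (a : ℕ) :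
    ∀ (L G : Submodule F V), L ≤ G → finrank F G = finrank F L + a → ∀ u ∈ G, (a ≠ 0 → u ∉ L) →
      ∃ e : Fin a → V, (∀ s, e s ∈ G) ∧ G ≤ L ⊔ span F (Set.range e) ∧
        ∀ s, s.val = 0 → e s = u := by
  induction a with
  | zero =>
    intro L G h hf u _ _
    have : L = G := eq_of_le_of_finrank_eq h (by omega)
    exact ⟨Fin.elim0, fun s => s.elim0, by simp [this], fun s => s.elim0⟩
  | succ a ih =>
    intro L G h hf u hu hL
    have huL := hL (by omega)
    have h1 : L ⊔ span F {u} ≤ G := sup_le h (by simpa using hu)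
    have h2 : finrank F ↥(L ⊔ span F {u}) = finrank F L + 1 := by
      have := finrank_sup_add_finrank_inf_eq L (span F {u})
      have h0 : L ⊓ span F {u} = ⊥ := by
        rw [eq_bot_iff]
        rintro x ⟨hx, hx'⟩
        obtain ⟨c, rfl⟩ := mem_span_singleton.1 hx'
        by_cases hc : c = 0
        · simp [hc]
        · exact absurd ((L.smul_mem_iff hc).1 hx) huL
      rw [h0, finrank_bot, finrank_span_singleton (by rintro rfl; exact huL L.zero_mem)] at this
      omega
    obtain ⟨u', hu', hu2⟩ : ∃ u' ∈ G, (a ≠ 0 → u' ∉ L ⊔ span F {u}) := by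
      by_cases ha : a = 0
      · exact ⟨0, G.zero_mem, by simp [ha]⟩
      · by_contra! hc
        have : G ≤ L ⊔ span F {u} := fun x hx => (hc x hx).2
        have := finrank_mono this
        omega
    obtain ⟨e, he1, he2, -⟩ := ih _ _ h1 (by omega) u' hu' hu2
    refine ⟨Fin.cons u e, ?_, ?_, ?_⟩
    · intro s
      refine Fin.cases ?_ ?_ s
      · simpa using hu
      · simpa using he1
    · refine he2.trans ?_
      rw [Fin.range_cons, span_insert, sup_assoc]
    · intro s hs
      have : s = 0 := Fin.ext hs
      simp [this]

/-- Lift a basis of each graded piece of `V_i ∩ V'_j` modulo `lowerPart`. A vector `z x` outside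
`lowerPart` is allowed as the first lift, which is what later puts `w` into normal form. -/
theorem exists_adapted (f f' : PFlag F n d) (Δ : Set (Fin n × Fin n)) (z : Fin n × Fin n → Fin d → F)
    (hz : ∀ x ∈ Δ, z x ∈ f.V x.1.succ ⊓ f'.V x.2.succ ∧ z x ∉ lowerPart f f' x.1 x.2) :
    ∃ b : Basis (Σ i : Fin n, Σ j : Fin n, Fin (pos f f' i j).toNat) F (Fin d → F),
      Adapted f f' b (fun x => x.1) (fun x => x.2.1) ∧
      ∀ x, (x.1, x.2.1) ∈ Δ → x.2.2.val = 0 → b x = z (x.1, x.2.1) := by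
  have key : ∀ i j : Fin n, ∃ e : Fin (pos f f' i j).toNat → (Fin d → F),
      (∀ s, e s ∈ f.V i.succ ⊓ f'.V j.succ) ∧
      f.V i.succ ⊓ f'.V j.succ ≤ lowerPart f f' i j ⊔ span F (Set.range e) ∧
        ((i, j) ∈ Δ → ∀ s, s.val = 0 → e s = z (i, j)) := by
    intro i j
    have h1 := finrank_lowerPart f f' i j
    have h2 := pos_nonneg f f' i j
    obtain ⟨u, hu, hu', hu2⟩ : ∃ u ∈ f.V i.succ ⊓ f'.V j.succ,
        ((pos f f' i j).toNat ≠ 0 → u ∉ lowerPart f f' i j) ∧ ((i, j) ∈ Δ → u = z (i, j)) := by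
      by_cases hΔ : (i, j) ∈ Δ
      · exact ⟨z (i, j), (hz _ hΔ).1, fun _ => (hz _ hΔ).2, fun _ => rfl⟩
      · by_cases ha : (pos f f' i j).toNat = 0
        · exact ⟨0, zero_mem _, by simp [ha], fun h => absurd h hΔ⟩
        · by_contra! hc
          have : f.V i.succ ⊓ f'.V j.succ ≤ lowerPart f f' i j := by
            intro x hx
            by_contra hx'
            exact hΔ (hc x hx (fun _ => hx')).1
          have := finrank_mono this
          omega
    obtain ⟨e, he1, he2, he3⟩ := exists_lift _ _ _ (lowerPart_le f f' i j) (by omega) u hu hu'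
    exact ⟨e, he1, he2, fun h s hs => (he3 s hs).trans (hu2 h)⟩
  choose e he1 he2 he3 using key
  let E : (Σ i : Fin n, Σ j : Fin n, Fin (pos f f' i j).toNat) → Fin d → F :=
    fun x => e x.1 x.2.1 x.2.2
  -- Double induction along the flags: modulo `lowerPart`, which is covered by smaller indices, the
  -- lifts at `(i, j)` span.
  have hspan : ∀ i j : Fin (n + 1), f.V i ⊓ f'.V j ≤
      span F (E '' {x | x.1.val < i.val ∧ x.2.1.val < j.val}) := by
    intro i
    induction i using Fin.induction with
    | zero => intro j; simp [f.zero]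
    | succ i ihi =>
      intro j
      induction j using Fin.induction with
      | zero => simp [f'.zero]
      | succ j ihj =>
        refine (he2 i j).trans (sup_le (sup_le ((ihi _).trans (span_mono (Set.image_mono ?_)))
          (ihj.trans (span_mono (Set.image_mono ?_)))) ?_)
        · intro x hx
          simp only [Set.mem_ofPred_eq, Fin.val_succ, Fin.val_castSucc] at hx ⊢
          omega
        · intro x hx
          simp only [Set.mem_ofPred_eq, Fin.val_succ, Fin.val_castSucc] at hx ⊢
          omega
        · refine span_mono ?_
          rintro _ ⟨s, rfl⟩
          exact ⟨⟨i, j, s⟩, by simp, rfl⟩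
  have hE : ∀ x, E x ∈ f.V x.1.succ ⊓ f'.V x.2.1.succ := fun x => he1 _ _ _
  have htop : ⊤ ≤ span F (Set.range E) := by
    have := hspan (Fin.last n) (Fin.last n)
    rw [f.last, f'.last, top_inf_eq] at this
    exact this.trans (span_mono (Set.image_subset_range _ _))
  -- Since the entries of `pos` add up to `d`, a spanning family with this index set is a basis.
  have hcard : Fintype.card (Σ i : Fin n, Σ j : Fin n, Fin (pos f f' i j).toNat) =
      finrank F (Fin d → F) := by
    have h := sum_pos f f'
    simp only [Fintype.card_sigma, Fintype.card_fin, finrank_fin_fun]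
    zify
    rw [← h]
    exact Finset.sum_congr rfl fun i _ => Finset.sum_congr rfl fun j _ =>
      Int.toNat_of_nonneg (pos_nonneg f f' i j)
  refine ⟨basisOfTopLeSpanOfCardEqFinrank E htop hcard, ⟨?_, ?_⟩, ?_⟩
  · intro k
    rw [coe_basisOfTopLeSpanOfCardEqFinrank]
    apply le_antisymm
    · have := hspan k (Fin.last n)
      rw [f'.last, inf_top_eq] at this
      exact this.trans (span_mono (Set.image_mono fun x hx => hx.1))
    · rw [span_le]
      rintro _ ⟨x, hx, rfl⟩
      exact f.mono (Fin.le_def.2 (by simpa using hx)) (hE x).1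
  · intro k
    rw [coe_basisOfTopLeSpanOfCardEqFinrank]
    apply le_antisymm
    · have := hspan (Fin.last n) k
      rw [f.last, top_inf_eq] at this
      exact this.trans (span_mono (Set.image_mono fun x hx => hx.2))
    · rw [span_le]
      rintro _ ⟨x, hx, rfl⟩
      exact f'.mono (Fin.le_def.2 (by simpa using hx)) (hE x).2
  · intro x hx hs
    rw [coe_basisOfTopLeSpanOfCardEqFinrank]
    exact he3 _ _ hx _ hs

end Relative

/-! ### Classification of the orbits by a matrix and a lower set -/

section Orbits

variable {F : Type} [Field F] {n d : ℕ}

open Module Submodule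

/-- The smallest lower set `I` of positions such that `w` lies in `spanBelow f f' I`. -/
def vecIdeal (f f' : PFlag F n d) (w : Fin d → F) : Set (Fin n × Fin n) :=
  {y | ∀ I, IsLowerSet I → w ∈ spanBelow f f' I → y ∈ I}

theorem isLowerSet_vecIdeal (f f' : PFlag F n d) (w : Fin d → F) :
    IsLowerSet (vecIdeal f f' w) :=
  fun _ _ hab ha I hI hw => hI hab (ha I hI hw)

theorem exists_adapted_basis (f f' : PFlag F n d) :
    ∃ b : Basis (Σ i : Fin n, Σ j : Fin n, Fin (pos f f' i j).toNat) F (Fin d → F),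
      Adapted f f' b (fun x => x.1) (fun x => x.2.1) :=
  let ⟨b, hb, _⟩ := exists_adapted f f' ∅ 0 (by simp)
  ⟨b, hb⟩

/-- The positions of the support of `w` generate a lower set whose subspace contains `w`, and any
other such lower set contains these positions. -/
theorem Adapted.mem_vecIdeal {f f' : PFlag F n d} {ι : Type} {b : Basis ι F (Fin d → F)}
    {r s : ι → Fin n} (h : Adapted f f' b r s) (w : Fin d → F) (y : Fin n × Fin n) :
    y ∈ vecIdeal f f' w ↔ ∃ x, b.repr w x ≠ 0 ∧ y ≤ (r x, s x) := by
  constructor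
  · intro hy
    refine hy {y | ∃ x, b.repr w x ≠ 0 ∧ y ≤ (r x, s x)} ?_ ?_
    · rintro a c hac ⟨x, hx, hax⟩
      exact ⟨x, hx, hac.trans hax⟩
    · rw [h.mem_spanBelow]
      · exact fun x hx => ⟨x, hx, le_rfl⟩
      · rintro a c hac ⟨x, hx, hax⟩
        exact ⟨x, hx, hac.trans hax⟩
  · rintro ⟨x, hx, hyx⟩ I hI hw
    exact hI hyx ((h.mem_spanBelow hI w).1 hw x hx)

/-- This is not formal from the definition of `vecIdeal` as an intersection: the subspaces of all
lower sets are coordinate subspaces of one adapted basis, so the intersection of the admissible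
lower sets is again admissible. -/
theorem mem_spanBelow_iff (f f' : PFlag F n d) (w : Fin d → F) {I : Set (Fin n × Fin n)}
    (hI : IsLowerSet I) : w ∈ spanBelow f f' I ↔ vecIdeal f f' w ⊆ I := by
  refine ⟨fun h y hy => hy I hI h, fun h => ?_⟩
  obtain ⟨b, hb⟩ := exists_adapted_basis f f'
  rw [hb.mem_spanBelow hI]
  exact fun x hx => h ((hb.mem_vecIdeal w _).2 ⟨x, hx, le_rfl⟩)

/-- The lower set generated by `Δ`. -/
def XiTilde.ideal (X : XiTilde n) : Set (Fin n × Fin n) := {y | ∃ x ∈ X.Δ, y ≤ x}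

theorem XiTilde.isLowerSet_ideal (X : XiTilde n) : IsLowerSet X.ideal :=
  fun _ _ hab ⟨x, hx, h⟩ => ⟨x, hx, hab.trans h⟩

/-- `Δ` is an antichain, so its members are maximal in the lower set they generate. -/
theorem XiTilde.isLowerSet_ideal_diff (X : XiTilde n) {x : Fin n × Fin n} (hx : x ∈ X.Δ) :
    IsLowerSet (X.ideal \ {x}) := by
  rintro a c hca ⟨⟨z, hz, haz⟩, ha'⟩
  refine ⟨⟨z, hz, hca.trans haz⟩, ?_⟩
  rintro rfl
  have hcz : c ≤ z := hca.trans haz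
  by_cases h : c = z
  · subst h
    exact ha' (le_antisymm haz hca)
  · rcases X.strict c hx z hz h with h1 | h1
    · exact absurd hcz.2 (not_le.2 h1.2)
    · exact absurd hcz.1 (not_le.2 h1.1)

theorem card_sigma_filter (a : Fin n → Fin n → ℕ) (i j : Fin n) :
    (Finset.univ.filter fun x : Σ i : Fin n, Σ j : Fin n, Fin (a i j) =>
      x.1 = i ∧ x.2.1 = j).card = a i j := by
  rw [← Finset.card_univ (α := Fin (a i j)) |>.trans (Fintype.card_fin _)]
  symm
  refine Finset.card_bij (fun s _ => ⟨i, j, s⟩) (by simp) (by simp) ?_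
  rintro ⟨i, j, s⟩ hx
  simp only [Finset.mem_filter, Finset.mem_univ, true_and] at hx
  obtain ⟨rfl, rfl⟩ := hx
  exact ⟨s, by simp, rfl⟩

theorem le_spanBelow (f f' : PFlag F n d) {I : Set (Fin n × Fin n)} {y : Fin n × Fin n}
    (hy : y ∈ I) : f.V y.1.succ ⊓ f'.V y.2.succ ≤ spanBelow f f' I :=
  le_iSup₂_of_le (f := fun (y : Fin n × Fin n) (_ : y ∈ I) => f.V y.1.succ ⊓ f'.V y.2.succ)
    y hy le_rfl

theorem inf_castSucc_le_spanBelow (f f' : PFlag F n d) (i j : Fin n) {J : Set (Fin n × Fin n)}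
    (hJ : ∀ i' < i, (i', j) ∈ J) : f.V i.castSucc ⊓ f'.V j.succ ≤ spanBelow f f' J := by
  by_cases h : i.castSucc = 0
  · rw [h, f.zero]; simp
  · obtain ⟨k, hk⟩ := Fin.exists_succ_eq.2 h
    rw [← hk]
    refine le_spanBelow f f' (y := (k, j)) (hJ k ?_)
    have := congrArg Fin.val hk
    simp only [Fin.val_succ, Fin.val_castSucc] at this
    exact Fin.lt_def.2 (by omega)

theorem lowerPart_le_spanBelow (f f' : PFlag F n d) (i j : Fin n) {J : Set (Fin n × Fin n)}
    (hJ : ∀ y < (i, j), y ∈ J) : lowerPart f f' i j ≤ spanBelow f f' J := by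
  refine sup_le (inf_castSucc_le_spanBelow f f' i j fun i' hi' => hJ _ (Prod.mk_lt_mk_iff_left.2 hi')) ?_
  rw [inf_comm, ← spanBelow_swap]
  exact inf_castSucc_le_spanBelow f' f j i fun j' hj' => hJ (i, j') (Prod.mk_lt_mk_iff_right.2 hj')

theorem pos_vecIdeal_of_inOrbit {X : XiTilde n} (hX : X ∈ Xi n d) {f f' : PFlag F n d}
    {w : Fin d → F} (h : InOrbit X f f' w) :
    pos f f' = X.A ∧ vecIdeal f f' w = X.ideal := by
  classical
  obtain ⟨b, h1, h2, hw⟩ := h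
  have hb : Adapted f f' b (fun x => x.1) (fun x => x.2.1) := ⟨h1, h2⟩
  have hrepr : ∀ y, b.repr w y = if (y.1, y.2.1) ∈ X.Δ ∧ y.2.2.val = 0 then 1 else 0 := by
    intro y
    rw [hw, map_sum, Finsupp.finsetSum_apply, Finset.sum_eq_single y]
    · split_ifs <;> simp_all
    · intro x _ hxy
      split_ifs
      · simp [hxy]
      · simp
    · simp
  refine ⟨?_, ?_⟩
  · ext i j
    rw [hb.pos_eq, card_sigma_filter (fun i j => (X.A i j).toNat), Int.toNat_of_nonneg (hX.1 i j)]
  · ext y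
    rw [hb.mem_vecIdeal]
    constructor
    · rintro ⟨x, hx, hy⟩
      rw [hrepr] at hx
      exact ⟨_, (by simpa using hx : _ ∧ _).1, hy⟩
    · rintro ⟨⟨i, j⟩, hx, hy⟩
      have := hX.2.1 i j hx
      exact ⟨⟨i, j, ⟨0, by omega⟩⟩, by simp [hrepr, hx], hy⟩

/-- Write `w` as a sum of vectors `z x ∈ V_i ∩ V'_j`, one for each `x = (i, j)` in `Δ`. Minimality
of the lower set of `w` keeps each `z x` out of `lowerPart`, so `exists_adapted` provides an adapted
basis having the `z x` among its first vectors. -/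
theorem inOrbit_of_pos_vecIdeal {X : XiTilde n} {f f' : PFlag F n d}
    {w : Fin d → F} (hp : pos f f' = X.A) (hv : vecIdeal f f' w = X.ideal) :
    X ∈ Xi n d ∧ InOrbit X f f' w := by
  classical
  obtain ⟨z, hzm, hzw⟩ : ∃ z : Fin n × Fin n → (Fin d → F),
      (∀ x ∈ X.Δ, z x ∈ f.V x.1.succ ⊓ f'.V x.2.succ) ∧ ∑ x ∈ X.Δ, z x = w := by
    have hw : w ∈ ⨆ x ∈ X.Δ, f.V x.1.succ ⊓ f'.V x.2.succ := by
      have : w ∈ spanBelow f f' X.ideal := (mem_spanBelow_iff f f' w X.isLowerSet_ideal).2 hv.le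
      refine (iSup₂_le ?_ : spanBelow f f' X.ideal ≤ _) this
      rintro y ⟨x, hx, hyx⟩
      exact (inf_le_inf (f.mono (Fin.succ_le_succ_iff.2 hyx.1))
        (f'.mono (Fin.succ_le_succ_iff.2 hyx.2))).trans
        (le_iSup₂_of_le (f := fun (x : Fin n × Fin n) (_ : x ∈ X.Δ) =>
          f.V x.1.succ ⊓ f'.V x.2.succ) x hx le_rfl)
    obtain ⟨μ, hμ⟩ := (mem_iSup_finset_iff_exists_sum (s := X.Δ)
      (fun x => f.V x.1.succ ⊓ f'.V x.2.succ) w).1 hw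
    exact ⟨fun x => μ x, fun x _ => (μ x).2, hμ⟩
  have hzn : ∀ x ∈ X.Δ, z x ∉ lowerPart f f' x.1 x.2 := by
    intro x hx hz
    have hJ := X.isLowerSet_ideal_diff hx
    have hxI : x ∈ X.ideal := ⟨x, hx, le_rfl⟩
    -- If `z x` were in `lowerPart`, the position `x` could be dropped from the lower set of `w`.
    have : w ∈ spanBelow f f' (X.ideal \ {x}) := by
      rw [← hzw]
      refine sum_mem fun y hy => ?_
      by_cases hyx : y = x
      · rw [hyx]
        exact lowerPart_le_spanBelow f f' x.1 x.2 (J := X.ideal \ {x})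
          (fun c hc => ⟨X.isLowerSet_ideal hc.le hxI, hc.ne⟩) hz
      · have hy' : y ∈ X.ideal \ {x} := ⟨⟨y, hy, le_rfl⟩, hyx⟩
        exact le_spanBelow f f' hy' (hzm y hy)
    rw [mem_spanBelow_iff f f' w hJ, hv] at this
    exact (this hxI).2 rfl
  have hpp : ∀ i j, (i, j) ∈ X.Δ → 0 < X.A i j := by
    intro i j hij
    have h0 := pos_nonneg f f' i j
    have h1 := finrank_lowerPart f f' i j
    rw [← hp]
    by_contra hc
    have : lowerPart f f' i j = f.V i.succ ⊓ f'.V j.succ :=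
      eq_of_le_of_finrank_eq (lowerPart_le f f' i j) (by omega)
    exact hzn _ hij (this ▸ hzm _ hij)
  have hXi : X ∈ Xi n d := ⟨fun i j => hp ▸ pos_nonneg f f' i j, hpp, hp ▸ sum_pos f f'⟩
  refine ⟨hXi, ?_⟩
  -- Destructuring allows `pos f f'` to be substituted for `A`, so that the index type of the
  -- adapted basis is literally `BasisIdx`.
  obtain ⟨A, Δ, ho, hs, hd⟩ := X
  simp only at hp hzm hzw hzn hpp
  subst hp
  obtain ⟨b, hb, hbz⟩ := exists_adapted f f' (Δ : Set (Fin n × Fin n)) z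
    (fun x hx => ⟨hzm x hx, hzn x hx⟩)
  refine ⟨b, hb.left, hb.right, ?_⟩
  have hin : ∀ i j, (∑ s : Fin (pos f f' i j).toNat,
      if (i, j) ∈ Δ ∧ s.val = 0 then b ⟨i, j, s⟩ else 0) = if (i, j) ∈ Δ then z (i, j) else 0 := by
    intro i j
    by_cases hij : (i, j) ∈ Δ
    · have := hpp i j hij
      rw [Finset.sum_eq_single ⟨0, by omega⟩]
      · simpa [hij] using hbz ⟨i, j, ⟨0, by omega⟩⟩ hij rfl
      · intro s _ hs
        rw [if_neg]
        rintro ⟨-, h⟩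
        exact hs (Fin.ext h)
      · simp
    · simp [hij]
  rw [← hzw]
  refine Eq.trans ?_ (Fintype.sum_sigma _).symm
  refine Eq.trans ?_ (Finset.sum_congr rfl fun i _ => (Fintype.sum_sigma _).symm)
  refine Eq.trans ?_ (Finset.sum_congr rfl fun i _ => Finset.sum_congr rfl fun j _ => (hin i j).symm)
  rw [← Fintype.sum_prod_type' (f := fun i j => if (i, j) ∈ Δ then z (i, j) else 0)]
  simp [Finset.sum_ite_mem]

/-- A basis-free description of the orbits; distinct orbits are seen to be disjoint because both
invariants are functions of the triple. -/
theorem mem_Xi_and_inOrbit_iff (X : XiTilde n) (f f' : PFlag F n d) (w : Fin d → F) :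
    (X ∈ Xi n d ∧ InOrbit X f f' w) ↔ pos f f' = X.A ∧ vecIdeal f f' w = X.ideal :=
  ⟨fun h => pos_vecIdeal_of_inOrbit h.1 h.2, fun h => inOrbit_of_pos_vecIdeal h.1 h.2⟩

/-- Orbits are nonempty over every field, so coefficients can be read off by evaluating at a point.
-/
theorem exists_inOrbit {X : XiTilde n} (hX : X ∈ Xi n d) :
    ∃ (f f' : PFlag F n d) (w : Fin d → F), InOrbit X f f' w := by
  classical
  have hcard : Fintype.card (BasisIdx X) = Fintype.card (Fin d) := by
    simp only [Fintype.card_sigma, Fintype.card_fin]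
    zify
    rw [← hX.2.2]
    exact Finset.sum_congr rfl fun i _ => Finset.sum_congr rfl fun j _ =>
      Int.toNat_of_nonneg (hX.1 i j)
  let b : Basis (BasisIdx X) F (Fin d → F) :=
    (Pi.basisFun F (Fin d)).reindex (Fintype.equivOfCardEq hcard).symm
  refine ⟨⟨fun k => span F (b '' {x | x.1.val < k.val}), ?_, ?_, ?_⟩,
    ⟨fun k => span F (b '' {x | x.2.1.val < k.val}), ?_, ?_, ?_⟩, _, b, fun _ => rfl, fun _ => rfl, rfl⟩
  · exact fun k l hkl => span_mono (Set.image_mono fun x hx => LT.lt.trans_le (b := k.val) hx (Fin.le_def.1 hkl))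
  · simp
  · simp
  · exact fun k l hkl => span_mono (Set.image_mono fun x hx => LT.lt.trans_le (b := k.val) hx (Fin.le_def.1 hkl))
  · simp
  · simp

end Orbits

/-- The rational number `1` or `0` according to the truth of `P`. -/
def chi (P : Prop) : ℚ := open Classical in if P then 1 else 0

theorem chi_true {P : Prop} (h : P) : chi P = 1 := if_pos h

theorem chi_false {P : Prop} (h : ¬ P) : chi P = 0 := if_neg h

theorem chi_congr {P Q : Prop} (h : P ↔ Q) : chi P = chi Q := by rw [propext h]

theorem chi_and (P Q : Prop) : chi (P ∧ Q) = chi P * chi Q := by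
  by_cases hP : P <;> by_cases hQ : Q <;> simp [chi, hP, hQ]

/-! ### Elementary moves of a flag, parametrized by vectors and functionals -/

section Moves

variable {F : Type} [Field F] {n d : ℕ}

open Module Submodule

theorem PFlag.ext {f g : PFlag F n d} (h : ∀ k, f.V k = g.V k) : f = g := by
  cases f; cases g
  simp only [PFlag.mk.injEq]
  exact funext h

instance [Finite F] : Finite (PFlag F n d) :=
  Finite.of_injective (β := Fin (n + 1) → Set (Fin d → F)) (fun f k => (f.V k : Set (Fin d → F)))
    fun _ _ h => PFlag.ext fun k => SetLike.coe_injective (congrFun h k)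

instance [Finite F] : Fintype (PFlag F n d) := Fintype.ofFinite _

/-- The flag obtained by replacing the step between the neighbouring rows `a` and `b`. -/
def PFlag.setStep (f : PFlag F n d) (a b : Fin n) (hab : b.val = a.val + 1)
    (T : Submodule F (Fin d → F)) (h1 : f.V a.castSucc ≤ T) (h2 : T ≤ f.V b.succ) :
    PFlag F n d where
  V j := if j = b.castSucc then T else f.V j
  mono i j hij := by
    have hij' := Fin.le_def.1 hij
    dsimp only
    split_ifs with hi hj hj
    · exact le_rfl
    · refine h2.trans (f.mono (Fin.le_def.2 ?_))
      rw [Fin.ext_iff] at hi hj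
      simp only [Fin.val_succ, Fin.val_castSucc] at *
      omega
    · refine (f.mono (Fin.le_def.2 ?_)).trans h1
      rw [Fin.ext_iff] at hi hj
      simp only [Fin.val_castSucc] at *
      omega
    · exact f.mono hij
  zero := by
    rw [if_neg, f.zero]
    rw [Fin.ext_iff]
    simp only [Fin.val_zero, Fin.val_castSucc]
    omega
  last := by
    rw [if_neg, f.last]
    rw [Fin.ext_iff]
    simp only [Fin.val_last, Fin.val_castSucc]
    omega

theorem PFlag.setStep_self (f : PFlag F n d) (a b : Fin n) (hab : b.val = a.val + 1)
    (T : Submodule F (Fin d → F)) (h1 : f.V a.castSucc ≤ T) (h2 : T ≤ f.V b.succ) :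
    (f.setStep a b hab T h1 h2).V b.castSucc = T := if_pos rfl

/-- `g` is obtained from `f` by enlarging the step below row `b` by one dimension. -/
def AdjUp (b : Fin n) (f g : PFlag F n d) : Prop :=
  (∀ j, j ≠ b.castSucc → g.V j = f.V j) ∧ f.V b.castSucc ≤ g.V b.castSucc ∧
    finrank F (g.V b.castSucc) = finrank F (f.V b.castSucc) + 1

/-- The map `v ↦ v + φ v • z` is invertible because `1 + φ z ≠ 0`, and `b` is pulled back along it.
Both changes of adapted basis below are of this kind. -/
theorem exists_basis_repr {ι V : Type} [AddCommGroup V] [Module F V] (b : Basis ι F V)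
    (φ : V →ₗ[F] F) (z : V) (h : 1 + φ z ≠ 0) :
    ∃ b' : Basis ι F V, ∀ v x, b'.repr v x = b.repr v x + φ v * b.repr z x := by
  have h1 : ∀ v : V, (v + φ v • z) + (-(φ (v + φ v • z) / (1 + φ z))) • z = v := by
    intro v
    have : -(φ (v + φ v • z) / (1 + φ z)) = - φ v := by
      rw [map_add, map_smul, smul_eq_mul]
      field_simp
    rw [this]; module
  have h2 : ∀ v : V, (v + (-(φ v / (1 + φ z))) • z) +
      φ (v + (-(φ v / (1 + φ z))) • z) • z = v := by
    intro v
    have : φ (v + (-(φ v / (1 + φ z))) • z) = φ v / (1 + φ z) := by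
      rw [map_add, map_smul, smul_eq_mul]
      field_simp
      ring
    rw [this]; module
  let E : V ≃ₗ[F] V :=
    { toFun := fun v => v + φ v • z
      invFun := fun v => v + (-(φ v / (1 + φ z))) • z
      map_add' := fun x y => by rw [map_add]; module
      map_smul' := fun c x => by simp only [map_smul, smul_eq_mul, RingHom.id_apply]; module
      left_inv := h1
      right_inv := h2 }
  refine ⟨b.map E.symm, fun v x => ?_⟩
  simp [E]

theorem adapted_of_mem {f f' : PFlag F n d} {ι : Type} {b : Basis ι F (Fin d → F)} {r s : ι → Fin n}
    (h1 : ∀ k v, v ∈ f.V k ↔ ∀ x, b.repr v x ≠ 0 → (r x).val < k.val)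
    (h2 : ∀ k v, v ∈ f'.V k ↔ ∀ x, b.repr v x ≠ 0 → (s x).val < k.val) : Adapted f f' b r s := by
  constructor
  · intro k; ext v; rw [h1, mem_span_basis_image]; rfl
  · intro k; ext v; rw [h2, mem_span_basis_image]; rfl

theorem eq_sup_span_singleton {V : Type} [AddCommGroup V] [Module F V] [FiniteDimensional F V]
    {S T : Submodule F V} (h : S ≤ T) (hr : finrank F T = finrank F S + 1) {z : V} (hz : z ∈ T)
    (hzS : z ∉ S) : T = S ⊔ span F {z} := by
  have hle : S ⊔ span F {z} ≤ T := sup_le h (by simpa using hz)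
  have hlt : S < S ⊔ span F {z} := by
    refine lt_of_le_of_ne le_sup_left fun he => hzS ?_
    rw [he]
    exact mem_sup_right (mem_span_singleton_self z)
  have := finrank_lt_finrank_of_lt hlt
  have := finrank_mono hle
  exact (eq_of_le_of_finrank_eq hle (by omega)).symm

theorem finrank_sup_span_singleton' {V : Type} [AddCommGroup V] [Module F V] [FiniteDimensional F V]
    {S : Submodule F V} {z : V} (hzS : z ∉ S) : finrank F ↥(S ⊔ span F {z}) = finrank F S + 1 := by
  have := finrank_sup_add_finrank_inf_eq S (span F {z})
  have h0 : S ⊓ span F {z} = ⊥ := by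
    rw [eq_bot_iff]
    rintro x ⟨hx, hx'⟩
    obtain ⟨c, rfl⟩ := mem_span_singleton.1 hx'
    by_cases hc : c = 0
    · simp [hc]
    · exact absurd ((S.smul_mem_iff hc).1 hx) hzS
  rw [h0, finrank_bot, finrank_span_singleton (by rintro rfl; exact hzS S.zero_mem)] at this
  omega

variable {f f' : PFlag F n d} {ι : Type} [Fintype ι] {e : Basis ι F (Fin d → F)} {r s : ι → Fin n}
  {a b : Fin n}

theorem repr_equivFun_symm (e : Basis ι F (Fin d → F)) (u : ι → F) (x : ι) :
    e.repr (e.equivFun.symm u) x = u x := by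
  rw [← e.equivFun_apply, LinearEquiv.apply_symm_apply]

theorem Adapted.vec_notMem (h : Adapted f f' e r s) {u : ι → F} (hu : ∀ x, u x ≠ 0 → r x = b)
    (hu0 : u ≠ 0) : e.equivFun.symm u ∉ f.V b.castSucc := by
  rw [h.mem_left]
  intro H
  apply hu0
  ext x
  by_contra hx
  have := H x (by rwa [repr_equivFun_symm])
  rw [hu x hx] at this
  simp at this

theorem Adapted.exists_adjUp (h : Adapted f f' e r s) (hab : b.val = a.val + 1) {u : ι → F}
    (hu : ∀ x, u x ≠ 0 → r x = b) (hu0 : u ≠ 0) :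
    ∃ g, AdjUp b f g ∧ e.equivFun.symm u ∈ g.V b.castSucc := by
  have hle : f.V b.castSucc ⊔ span F {e.equivFun.symm u} ≤ f.V b.succ := by
    refine sup_le (f.mono (Fin.castSucc_le_succ b)) ?_
    rw [span_singleton_le_iff_mem, h.mem_left]
    intro x hx
    rw [repr_equivFun_symm] at hx
    rw [hu x hx]
    simp
  refine ⟨f.setStep a b hab (f.V b.castSucc ⊔ span F {e.equivFun.symm u}) ?_ hle, ⟨?_, ?_, ?_⟩, ?_⟩
  · exact (f.mono (Fin.le_def.2 (by simp [hab]))).trans le_sup_left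
  · intro j hj
    simp [PFlag.setStep, hj]
  · simp [PFlag.setStep]
  · rw [PFlag.setStep_self]
    exact finrank_sup_span_singleton' (h.vec_notMem hu hu0)
  · simp only [PFlag.setStep, if_true]
    exact mem_sup_right (mem_span_singleton_self _)

theorem AdjUp.eq_sup {g : PFlag F n d} (hg : AdjUp b f g) {z : Fin d → F}
    (hz : z ∈ g.V b.castSucc) (hz' : z ∉ f.V b.castSucc) :
    g.V b.castSucc = f.V b.castSucc ⊔ span F {z} :=
  eq_sup_span_singleton hg.2.1 hg.2.2 hz hz'

theorem AdjUp.unique {g g' : PFlag F n d} (hg : AdjUp b f g) (hg' : AdjUp b f g') {z : Fin d → F}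
    (hz' : z ∉ f.V b.castSucc) (hz : z ∈ g.V b.castSucc) (hz2 : z ∈ g'.V b.castSucc) : g = g' := by
  refine PFlag.ext fun k => ?_
  by_cases hk : k = b.castSucc
  · subst hk
    rw [hg.eq_sup hz hz', hg'.eq_sup hz2 hz']
  · rw [hg.1 k hk, hg'.1 k hk]

theorem AdjUp.le_succ {g : PFlag F n d} (hg : AdjUp b f g) : g.V b.castSucc ≤ f.V b.succ := by
  rw [← hg.1 b.succ Fin.castSucc_lt_succ.ne']
  exact g.mono (Fin.castSucc_le_succ b)

theorem card_image_units_smul [Fintype F] [DecidableEq F] {W : Type} [AddCommGroup W] [Module F W]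
    [DecidableEq W] {z : W}
    (hz : z ≠ 0) : ((Finset.univ.erase (0 : F)).image fun c => c • z).card + 1 = Fintype.card F := by
  rw [Finset.card_image_of_injective _ (smul_left_injective F hz),
    Finset.card_erase_add_one (Finset.mem_univ _), Finset.card_univ]

-- Row `b` is a basis of `f.V b.succ` modulo `f.V b.castSucc`, and `g` amounts to a line in this
-- quotient; its `q - 1` nonzero vectors lift uniquely to combinations of row `b`.
open Classical in
theorem Adapted.card_up [Fintype F] (h : Adapted f f' e r s) {g : PFlag F n d} (hg : AdjUp b f g) :
    (Finset.univ.filter fun u : ι → F => (∀ x, u x ≠ 0 → r x = b) ∧ u ≠ 0 ∧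
      e.equivFun.symm u ∈ g.V b.castSucc).card + 1 = Fintype.card F := by
  obtain ⟨z, hz, hzf⟩ : ∃ z ∈ g.V b.castSucc, z ∉ f.V b.castSucc := by
    by_contra! hc
    have : g.V b.castSucc ≤ f.V b.castSucc := hc
    have := finrank_mono this
    have := hg.2.2
    omega
  let u₀ : ι → F := fun x => if r x = b then e.repr z x else 0
  have hu₀ : ∀ x, u₀ x ≠ 0 → r x = b := by
    intro x hx
    by_contra hr
    simp [u₀, hr] at hx
  have hzu : z - e.equivFun.symm u₀ ∈ f.V b.castSucc := by
    rw [h.mem_left]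
    intro x hx
    rw [map_sub, Finsupp.sub_apply, repr_equivFun_symm] at hx
    have hz1 := (h.mem_left _ _).1 (hg.le_succ hz) x
    by_cases hr : r x = b
    · simp [u₀, hr] at hx
    · simp only [u₀, hr, if_false, sub_zero] at hx
      have := hz1 hx
      rw [Fin.ext_iff] at hr
      simp only [Fin.val_succ, Fin.val_castSucc] at *
      omega
  have hu₀g : e.equivFun.symm u₀ ∈ g.V b.castSucc := by
    have := sub_mem hz (hg.2.1 hzu)
    simpa using this
  have hu₀0 : u₀ ≠ 0 := by
    intro h0
    rw [h0, map_zero, sub_zero] at hzu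
    exact hzf hzu
  have hsup := hg.eq_sup hu₀g (h.vec_notMem hu₀ hu₀0)
  rw [← card_image_units_smul hu₀0]
  congr 2
  ext u
  simp only [Finset.mem_filter, Finset.mem_univ, true_and, Finset.mem_image, Finset.mem_erase,
    and_true]
  constructor
  · rintro ⟨h1, h2, h3⟩
    rw [hsup, mem_sup] at h3
    obtain ⟨y, hy, t, ht, hyt⟩ := h3
    obtain ⟨c, rfl⟩ := mem_span_singleton.1 ht
    have hc : c • u₀ = u := by
      ext x
      have h4 := congrArg (fun v => e.repr v x) hyt
      simp only [map_add, map_smul, Finsupp.add_apply, Finsupp.smul_apply, repr_equivFun_symm] at h4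
      by_cases hr : r x = b
      · have : e.repr y x = 0 := by
          by_contra hne
          have := (h.mem_left _ _).1 hy x hne
          rw [hr] at this
          simp at this
        rw [← h4, this]; simp
      · have h5 : u x = 0 := by_contra fun hne => hr (h1 x hne)
        simp [u₀, hr, h5]
    refine ⟨c, ?_, hc⟩
    rintro rfl
    exact h2 (by rw [← hc, zero_smul])
  · rintro ⟨c, hc, rfl⟩
    refine ⟨fun x hx => hu₀ x fun h0 => hx (by simp [h0]), smul_ne_zero hc hu₀0, ?_⟩
    rw [map_smul]
    exact smul_mem _ _ hu₀g

-- Double counting: each neighbouring flag comes from `q - 1` coordinate vectors. Sums over flags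
-- thereby become sums over vectors.
open Classical in
theorem Adapted.sum_up [Fintype F] (h : Adapted f f' e r s) (G : PFlag F n d → ℚ) :
    ((Fintype.card F : ℚ) - 1) * ∑ g, chi (AdjUp b f g) * G g =
      ∑ u : ι → F with (∀ x, u x ≠ 0 → r x = b) ∧ u ≠ 0,
        ∑ g with AdjUp b f g ∧ e.equivFun.symm u ∈ g.V b.castSucc, G g := by
  simp only [Finset.sum_filter (s := (Finset.univ : Finset (PFlag F n d)))]
  rw [Finset.sum_comm, Finset.mul_sum]
  refine Finset.sum_congr rfl fun g _ => ?_
  by_cases hg : AdjUp b f g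
  · simp only [hg, true_and, chi_true, one_mul]
    rw [← Finset.sum_filter, Finset.filter_filter, Finset.sum_const, nsmul_eq_mul]
    have := h.card_up hg
    rw [← this]
    simp only [and_assoc]
    push_cast
    ring
  · simp [hg, chi_false]

/-- The value of the functional with coordinates `ξ`. -/
def pair (e : Basis ι F (Fin d → F)) (ξ : ι → F) : (Fin d → F) →ₗ[F] F :=
  ∑ x, ξ x • e.coord x

theorem pair_apply (e : Basis ι F (Fin d → F)) (ξ : ι → F) (v : Fin d → F) :
    pair e ξ v = ∑ x, ξ x * e.repr v x := by
  simp [pair]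

theorem pair_basis (e : Basis ι F (Fin d → F)) (ξ : ι → F) (x : ι) : pair e ξ (e x) = ξ x := by
  classical
  rw [pair_apply, Finset.sum_eq_single x]
  · simp
  · intro y _ hy
    simp [hy.symm]
  · simp

theorem AdjUp.castSucc_le {g : PFlag F n d} (hab : b.val = a.val + 1) (hg : AdjUp b g f) :
    f.V a.castSucc ≤ g.V b.castSucc := by
  rw [hg.1 a.castSucc (by rw [Ne, Fin.ext_iff]; simp [hab])]
  exact g.mono (Fin.le_def.2 (by simp [hab]))

theorem finrank_inf_ker {V : Type} [AddCommGroup V] [Module F V] [FiniteDimensional F V]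
    {S : Submodule F V} {φ : V →ₗ[F] F} {z : V} (hz : z ∈ S) (hφ : φ z ≠ 0) :
    finrank F S = finrank F ↥(S ⊓ LinearMap.ker φ) + 1 := by
  have hz' : z ∉ S ⊓ LinearMap.ker φ := fun h => hφ h.2
  rw [← finrank_sup_span_singleton' hz']
  have key : S = S ⊓ LinearMap.ker φ ⊔ span F {z} := by
    apply le_antisymm
    · intro v hv
      rw [mem_sup]
      refine ⟨v - (φ v / φ z) • z, ⟨sub_mem hv (smul_mem _ _ hz), ?_⟩, _,
        smul_mem _ (φ v / φ z) (mem_span_singleton_self z), by simp⟩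
      change φ _ = 0
      rw [map_sub, map_smul, smul_eq_mul]
      field_simp
      simp
    · exact sup_le inf_le_left (by simpa using hz)
  rw [← key]

theorem AdjUp.eq_inf_ker {g : PFlag F n d} (hg : AdjUp b g f) {φ : (Fin d → F) →ₗ[F] F}
    {z : Fin d → F} (hz : z ∈ f.V b.castSucc) (hφ : φ z ≠ 0)
    (hker : g.V b.castSucc ≤ LinearMap.ker φ) :
    g.V b.castSucc = f.V b.castSucc ⊓ LinearMap.ker φ := by
  have h1 := finrank_inf_ker hz hφ
  have h2 := hg.2.2
  exact eq_of_le_of_finrank_eq (le_inf hg.2.1 hker) (by omega)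

theorem exists_pair_ne_zero (h : Adapted f f' e r s) (hab : b.val = a.val + 1) {ξ : ι → F}
    (hξ : ∀ x, ξ x ≠ 0 → r x = a) (hξ0 : ξ ≠ 0) : ∃ z ∈ f.V b.castSucc, pair e ξ z ≠ 0 := by
  obtain ⟨x, hx⟩ := Function.ne_iff.1 hξ0
  refine ⟨e x, f.mono ?_ (h.basis_mem_left x), by rwa [pair_basis]⟩
  rw [hξ x hx, Fin.le_def]
  simp [hab]

theorem Adapted.exists_adjDown (h : Adapted f f' e r s) (hab : b.val = a.val + 1) {ξ : ι → F}
    (hξ : ∀ x, ξ x ≠ 0 → r x = a) (hξ0 : ξ ≠ 0) :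
    ∃ g, AdjUp b g f ∧ g.V b.castSucc ≤ LinearMap.ker (pair e ξ) := by
  obtain ⟨z, hz, hzn⟩ := exists_pair_ne_zero h hab hξ hξ0
  refine ⟨f.setStep a b hab (f.V b.castSucc ⊓ LinearMap.ker (pair e ξ)) (le_inf ?_ ?_) ?_,
    ⟨?_, ?_, ?_⟩, ?_⟩
  · exact f.mono (Fin.le_def.2 (by simp [hab]))
  · intro v hv
    rw [LinearMap.mem_ker, pair_apply]
    refine Finset.sum_eq_zero fun x _ => ?_
    by_contra hne
    have h1 := hξ x (left_ne_zero_of_mul hne)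
    have := (h.mem_left _ _).1 hv x (right_ne_zero_of_mul hne)
    rw [h1] at this
    simp at this
  · exact inf_le_left.trans (f.mono (Fin.castSucc_le_succ b))
  · intro j hj
    simp [PFlag.setStep, hj]
  · simp [PFlag.setStep]
  · rw [PFlag.setStep_self]
    exact finrank_inf_ker hz hzn
  · simp [PFlag.setStep]

theorem AdjUp.unique_down {g g' : PFlag F n d} (hg : AdjUp b g f) (hg' : AdjUp b g' f)
    {φ : (Fin d → F) →ₗ[F] F} {z : Fin d → F} (hz : z ∈ f.V b.castSucc) (hφ : φ z ≠ 0)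
    (h1 : g.V b.castSucc ≤ LinearMap.ker φ) (h2 : g'.V b.castSucc ≤ LinearMap.ker φ) : g = g' := by
  refine PFlag.ext fun k => ?_
  by_cases hk : k = b.castSucc
  · subst hk
    rw [hg.eq_inf_ker hz hφ h1, hg'.eq_inf_ker hz hφ h2]
  · rw [← hg.1 k hk, ← hg'.1 k hk]

-- Dual to `Adapted.card_up`: `g` amounts to a hyperplane of `f.V b.castSucc` containing `f.V
-- a.castSucc`, and a functional with this kernel is unique up to a nonzero scalar and has unique
-- coordinates in row `a`.
open Classical in
theorem Adapted.card_down [Fintype F] (h : Adapted f f' e r s) (hab : b.val = a.val + 1)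
    {g : PFlag F n d} (hg : AdjUp b g f) :
    (Finset.univ.filter fun ξ : ι → F => (∀ x, ξ x ≠ 0 → r x = a) ∧ ξ ≠ 0 ∧
      g.V b.castSucc ≤ LinearMap.ker (pair e ξ)).card + 1 = Fintype.card F := by
  obtain ⟨z, hz, hzg⟩ : ∃ z ∈ f.V b.castSucc, z ∉ g.V b.castSucc := by
    by_contra! hc
    have : f.V b.castSucc ≤ g.V b.castSucc := hc
    have := finrank_mono this
    have := hg.2.2
    omega
  obtain ⟨φ, hφz, hφ⟩ := Submodule.exists_le_ker_of_notMem hzg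
  -- Only row `a` matters on `f.V b.castSucc`, since the earlier rows lie in `g`, where `φ`
  -- vanishes.
  let ξ₀ : ι → F := fun x => if r x = a then φ (e x) else 0
  have hξ₀ : ∀ x, ξ₀ x ≠ 0 → r x = a := by
    intro x hx
    by_contra hr
    simp [ξ₀, hr] at hx
  have hval : ∀ v ∈ f.V b.castSucc, pair e ξ₀ v = φ v := by
    intro v hv
    conv_rhs => rw [← e.sum_repr v, map_sum]
    rw [pair_apply]
    refine Finset.sum_congr rfl fun x _ => ?_
    rw [map_smul, smul_eq_mul, mul_comm]
    by_cases hr : r x = a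
    · simp [ξ₀, hr]
    · by_cases hx : e.repr v x = 0
      · simp [hx]
      · have h1 := (h.mem_left _ _).1 hv x hx
        have h2 : e x ∈ g.V b.castSucc := by
          refine hg.castSucc_le hab (f.mono ?_ (h.basis_mem_left x))
          rw [Fin.ext_iff] at hr
          simp only [Fin.val_castSucc] at h1
          rw [Fin.le_def]
          simp only [Fin.val_succ, Fin.val_castSucc]
          omega
        have h3 : φ (e x) = 0 := hφ h2
        simp [ξ₀, hr, h3]
  have hξz : pair e ξ₀ z ≠ 0 := by rwa [hval z hz]
  have hξ₀0 : ξ₀ ≠ 0 := by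
    intro h0
    rw [h0] at hξz
    simp [pair] at hξz
  have hker : g.V b.castSucc ≤ LinearMap.ker (pair e ξ₀) := by
    intro v hv
    rw [LinearMap.mem_ker, hval v (hg.2.1 hv)]
    exact hφ hv
  rw [← card_image_units_smul hξ₀0]
  congr 2
  ext ξ
  simp only [Finset.mem_filter, Finset.mem_univ, true_and, Finset.mem_image, Finset.mem_erase,
    and_true]
  constructor
  · rintro ⟨h1, h2, h3⟩
    have hc : (pair e ξ z / pair e ξ₀ z) • ξ₀ = ξ := by
      ext x
      by_cases hr : r x = a
      · have hx : e x ∈ f.V b.castSucc := by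
          refine f.mono ?_ (h.basis_mem_left x)
          rw [hr, Fin.le_def]
          simp [hab]
        rw [hg.eq_sup hz hzg, mem_sup] at hx
        obtain ⟨y, hy, t, ht, hyt⟩ := hx
        obtain ⟨c, rfl⟩ := mem_span_singleton.1 ht
        have h4 : pair e ξ y = 0 := h3 hy
        have h5 : pair e ξ₀ y = 0 := hker hy
        rw [Pi.smul_apply, ← pair_basis e ξ x, ← pair_basis e ξ₀ x, ← hyt, map_add, map_add, h4, h5,
          map_smul, map_smul]
        simp only [smul_eq_mul, zero_add]
        field_simp
      · have h5 : ξ x = 0 := by_contra fun hne => hr (h1 x hne)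
        simp [ξ₀, hr, h5]
    refine ⟨_, ?_, hc⟩
    intro h0
    rw [h0, zero_smul] at hc
    exact h2 hc.symm
  · rintro ⟨c, hc, rfl⟩
    refine ⟨fun x hx => hξ₀ x fun h0 => hx (by simp [h0]), smul_ne_zero hc hξ₀0, ?_⟩
    intro v hv
    have : pair e ξ₀ v = 0 := hker hv
    rw [pair_apply] at this
    rw [LinearMap.mem_ker, pair_apply]
    simp only [Pi.smul_apply, smul_eq_mul, mul_assoc]
    rw [← Finset.mul_sum, this, mul_zero]

open Classical in
theorem Adapted.sum_down [Fintype F] (h : Adapted f f' e r s) (hab : b.val = a.val + 1)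
    (G : PFlag F n d → ℚ) :
    ((Fintype.card F : ℚ) - 1) * ∑ g, chi (AdjUp b g f) * G g =
      ∑ ξ : ι → F with (∀ x, ξ x ≠ 0 → r x = a) ∧ ξ ≠ 0,
        ∑ g with AdjUp b g f ∧ g.V b.castSucc ≤ LinearMap.ker (pair e ξ), G g := by
  simp only [Finset.sum_filter (s := (Finset.univ : Finset (PFlag F n d)))]
  rw [Finset.sum_comm, Finset.mul_sum]
  refine Finset.sum_congr rfl fun g _ => ?_
  by_cases hg : AdjUp b g f
  · simp only [hg, true_and, chi_true, one_mul]
    rw [← Finset.sum_filter, Finset.filter_filter, Finset.sum_const, nsmul_eq_mul]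
    have := h.card_down hab hg
    rw [← this]
    simp only [and_assoc]
    push_cast
    ring
  · simp [hg, chi_false]

end Moves

/-! ### Change of an adapted basis under an elementary move -/

section Change

variable {F : Type} [Field F] {n d : ℕ}

open Module Submodule

variable {f f' g : PFlag F n d} {ι : Type} [Fintype ι] {e : Basis ι F (Fin d → F)}
  {r s : ι → Fin n} {a b : Fin n}

theorem card_update_filter [DecidableEq ι] (r s : ι → Fin n) (x₀ : ι) (c i j : Fin n) :
    ((Finset.univ.filter fun x => Function.update r x₀ c x = i ∧ s x = j).card : ℤ) =
      (Finset.univ.filter fun x => r x = i ∧ s x = j).card + Matrix.single c (s x₀) (1 : ℤ) i j -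
        Matrix.single (r x₀) (s x₀) (1 : ℤ) i j := by
  simp only [Finset.card_filter, Nat.cast_sum]
  rw [← Finset.add_sum_erase _ _ (Finset.mem_univ x₀),
    ← Finset.add_sum_erase _ (fun x => ((if r x = i ∧ s x = j then 1 else 0 : ℕ) : ℤ))
      (Finset.mem_univ x₀)]
  rw [Finset.sum_congr rfl (g := fun x => ((if r x = i ∧ s x = j then 1 else 0 : ℕ) : ℤ))]
  · simp only [Function.update_self, Matrix.single_apply]
    push_cast
    ring
  · intro x hx
    rw [Function.update_of_ne (Finset.ne_of_mem_erase hx)]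

open Classical in
/-- The change of an adapted basis when a step is enlarged by the vector with coordinates `u`. -/
theorem Adapted.exists_up (h : Adapted f f' e r s) (hab : b.val = a.val + 1) {u : ι → F}
    (hu : ∀ x, u x ≠ 0 → r x = b) {x₀ : ι} (hx₀ : u x₀ ≠ 0) (hl : ∀ x, u x ≠ 0 → s x ≤ s x₀)
    (hg : AdjUp b f g) (hug : e.equivFun.symm u ∈ g.V b.castSucc) :
    ∃ e' : Basis ι F (Fin d → F), Adapted g f' e' (Function.update r x₀ a) s ∧
      ∀ v x, e'.repr v x = if x = x₀ then e.repr v x₀ / u x₀ else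
        e.repr v x - e.repr v x₀ / u x₀ * u x := by
  have hu0 : u ≠ 0 := by rintro rfl; exact hx₀ rfl
  obtain ⟨e', hrepr⟩ : ∃ e' : Basis ι F (Fin d → F), ∀ v x, e'.repr v x =
      if x = x₀ then e.repr v x₀ / u x₀ else e.repr v x - e.repr v x₀ / u x₀ * u x := by
    have hU := repr_equivFun_symm e u
    generalize e.equivFun.symm u = U at hU
    -- This replaces the basis vector `e x₀` by the vector `U` with coordinates `u`; the quantity `1
    -- + φ z` is `(u x₀)⁻¹`.
    obtain ⟨e', he'⟩ := exists_basis_repr e ((u x₀)⁻¹ • e.coord x₀) (e x₀ - U) (by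
      simp [hU]
      field_simp
      simp)
    refine ⟨e', fun v x => ?_⟩
    rw [he']
    by_cases hx : x = x₀
    · subst hx
      simp [hU]
      field_simp
      ring
    · simp [hU, hx]
      field_simp
      ring
  have hrx₀ := hu x₀ hx₀
  refine ⟨e', adapted_of_mem ?_ ?_, hrepr⟩
  · intro k v
    by_cases hk : k = b.castSucc
    · subst hk
      constructor
      · intro hv x hx
        rw [hg.eq_sup hug (h.vec_notMem hu hu0), mem_sup] at hv
        obtain ⟨y, hy, t, ht, rfl⟩ := hv
        obtain ⟨c, rfl⟩ := mem_span_singleton.1 ht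
        have hy0 : e.repr y x₀ = 0 := by
          by_contra hne
          have := (h.mem_left _ _).1 hy x₀ hne
          rw [hrx₀] at this
          simp at this
        by_cases hxx : x = x₀
        · subst hxx
          simp [hab]
        · rw [Function.update_of_ne hxx]
          rw [hrepr, if_neg hxx] at hx
          simp only [map_add, map_smul, Finsupp.add_apply, Finsupp.smul_apply, repr_equivFun_symm,
            hy0, smul_eq_mul, zero_add] at hx
          rw [mul_div_cancel_right₀ _ hx₀, add_sub_cancel_right] at hx
          exact (h.mem_left _ _).1 hy x hx
      · intro H
        have : v = (v - (e.repr v x₀ / u x₀) • e.equivFun.symm u) +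
          (e.repr v x₀ / u x₀) • e.equivFun.symm u := by simp
        rw [this]
        refine add_mem (hg.2.1 ?_) (smul_mem _ _ hug)
        rw [h.mem_left]
        intro x hx
        simp only [map_sub, map_smul, Finsupp.sub_apply, Finsupp.smul_apply, repr_equivFun_symm,
          smul_eq_mul] at hx
        by_cases hxx : x = x₀
        · subst hxx
          exact absurd (by field_simp; simp) hx
        · have := H x (by rwa [hrepr, if_neg hxx])
          rwa [Function.update_of_ne hxx] at this
    · have hk' : k.val ≠ b.val := fun hh => hk (Fin.ext (by simpa using hh))
      rw [hg.1 k hk, h.mem_left]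
      constructor
      · intro H x hx
        rw [hrepr] at hx
        by_cases hxx : x = x₀
        · subst hxx
          rw [if_pos rfl] at hx
          have := H x (by rintro h0; simp [h0] at hx)
          rw [hrx₀] at this
          rw [Function.update_self]
          omega
        · rw [if_neg hxx] at hx
          rw [Function.update_of_ne hxx]
          by_cases hv : e.repr v x = 0
          · rw [hv, zero_sub, neg_ne_zero] at hx
            have h1 := H x₀ (by rintro h0; simp [h0] at hx)
            rw [hrx₀] at h1
            rwa [hu x (right_ne_zero_of_mul hx)]
          · exact H x hv
      · intro H x hx
        by_cases hv₀ : e.repr v x₀ = 0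
        · have hxx : x ≠ x₀ := by rintro rfl; exact hx hv₀
          have := H x (by rw [hrepr, if_neg hxx, hv₀]; simpa using hx)
          rwa [Function.update_of_ne hxx] at this
        · have h1 := H x₀ (by rw [hrepr, if_pos rfl]; exact div_ne_zero hv₀ hx₀)
          rw [Function.update_self] at h1
          by_cases hxx : x = x₀
          · subst hxx
            rw [hrx₀]; omega
          · by_cases hux : u x = 0
            · have := H x (by rw [hrepr, if_neg hxx, hux]; simpa using hx)
              rwa [Function.update_of_ne hxx] at this
            · rw [hu x hux]; omega
  -- The column filtration survives because `x₀` is in the last column of the support of `u`: the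
  -- new vector lies in every `V'_k` that contains `e x₀`.
  · intro k v
    rw [h.mem_right]
    constructor
    · intro H x hx
      rw [hrepr] at hx
      by_cases hxx : x = x₀
      · subst hxx
        rw [if_pos rfl] at hx
        exact H x (by rintro h0; simp [h0] at hx)
      · rw [if_neg hxx] at hx
        by_cases hv : e.repr v x = 0
        · rw [hv, zero_sub, neg_ne_zero] at hx
          have h1 := H x₀ (by rintro h0; simp [h0] at hx)
          exact (Fin.le_def.1 (hl x (right_ne_zero_of_mul hx))).trans_lt h1
        · exact H x hv
    · intro H x hx
      by_cases hv₀ : e.repr v x₀ = 0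
      · have hxx : x ≠ x₀ := by rintro rfl; exact hx hv₀
        exact H x (by rw [hrepr, if_neg hxx, hv₀]; simpa using hx)
      · have h1 := H x₀ (by rw [hrepr, if_pos rfl]; exact div_ne_zero hv₀ hx₀)
        by_cases hux : u x = 0
        · have hxx : x ≠ x₀ := by rintro rfl; exact hx₀ hux
          exact H x (by rw [hrepr, if_neg hxx, hux]; simpa using hx)
        · exact (Fin.le_def.1 (hl x hux)).trans_lt h1

theorem exists_mul_repr_ne_zero {ξ : ι → F} {v : Fin d → F} (h : pair e ξ v ≠ 0) :
    ∃ x, ξ x ≠ 0 ∧ e.repr v x ≠ 0 := by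
  rw [pair_apply] at h
  obtain ⟨x, _, hx⟩ := Finset.exists_ne_zero_of_sum_ne_zero h
  exact ⟨x, left_ne_zero_of_mul hx, right_ne_zero_of_mul hx⟩

theorem pair_eq_single {ξ : ι → F} {v : Fin d → F} {x₀ : ι}
    (h : ∀ x, x ≠ x₀ → ξ x ≠ 0 → e.repr v x = 0) : pair e ξ v = ξ x₀ * e.repr v x₀ := by
  rw [pair_apply]
  refine Finset.sum_eq_single x₀ (fun x _ hx => ?_) (by simp)
  by_cases hξ : ξ x = 0
  · simp [hξ]
  · simp [h x hx hξ]

open Classical in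
/-- The change of an adapted basis when a step is cut down by the functional with coordinates
`ξ`. -/
theorem Adapted.exists_down (h : Adapted f f' e r s) (hab : b.val = a.val + 1) {ξ : ι → F}
    (hξ : ∀ x, ξ x ≠ 0 → r x = a) {x₀ : ι} (hx₀ : ξ x₀ ≠ 0) (hl : ∀ x, ξ x ≠ 0 → s x₀ ≤ s x)
    (hg : AdjUp b g f) (hker : g.V b.castSucc ≤ LinearMap.ker (pair e ξ)) :
    ∃ e' : Basis ι F (Fin d → F), Adapted g f' e' (Function.update r x₀ b) s ∧
      ∀ v x, e'.repr v x = if x = x₀ then pair e ξ v else e.repr v x := by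
  have hξ0 : ξ ≠ 0 := by rintro rfl; exact hx₀ rfl
  -- This replaces the coordinate at `x₀` by the functional `pair e ξ`; the quantity `1 + φ z` is `ξ
  -- x₀`.
  obtain ⟨e', he'⟩ := exists_basis_repr e (pair e ξ - e.coord x₀) (e x₀) (by
    simpa [pair_basis] using hx₀)
  have hrepr : ∀ v x, e'.repr v x = if x = x₀ then pair e ξ v else e.repr v x := by
    intro v x
    rw [he']
    by_cases hx : x = x₀
    · subst hx
      simp
    · simp [hx]
  have hrx₀ := hξ x₀ hx₀
  obtain ⟨z, hz, hzn⟩ := exists_pair_ne_zero h hab hξ hξ0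
  refine ⟨e', adapted_of_mem ?_ ?_, hrepr⟩
  · intro k v
    by_cases hk : k = b.castSucc
    · subst hk
      rw [hg.eq_inf_ker hz hzn hker, mem_inf, h.mem_left]
      constructor
      · rintro ⟨H, H0⟩ x hx
        have hxx : x ≠ x₀ := by
          rintro rfl
          rw [hrepr, if_pos rfl] at hx
          exact hx H0
        rw [hrepr, if_neg hxx] at hx
        rw [Function.update_of_ne hxx]
        exact H x hx
      · intro H
        refine ⟨fun x hx => ?_, ?_⟩
        · by_cases hxx : x = x₀
          · subst hxx
            rw [hrx₀]
            simp [hab]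
          · have := H x (by rwa [hrepr, if_neg hxx])
            rwa [Function.update_of_ne hxx] at this
        · by_contra hne
          have := H x₀ (by rw [hrepr, if_pos rfl]; exact hne)
          rw [Function.update_self] at this
          simp at this
    · have hk' : k.val ≠ b.val := fun hh => hk (Fin.ext (by simpa using hh))
      rw [← hg.1 k hk, h.mem_left]
      constructor
      · intro H x hx
        rw [hrepr] at hx
        by_cases hxx : x = x₀
        · subst hxx
          rw [if_pos rfl] at hx
          obtain ⟨y, hy1, hy2⟩ := exists_mul_repr_ne_zero hx
          have := H y hy2
          rw [hξ y hy1] at this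
          rw [Function.update_self]
          omega
        · rw [if_neg hxx] at hx
          rw [Function.update_of_ne hxx]
          exact H x hx
      · intro H x hx
        by_cases hxx : x = x₀
        · subst hxx
          by_contra hlt
          rw [hrx₀] at hlt
          have h1 : pair e ξ v = ξ x * e.repr v x := by
            refine pair_eq_single fun y hy hξy => ?_
            by_contra hvy
            have := H y (by rwa [hrepr, if_neg hy])
            rw [Function.update_of_ne hy, hξ y hξy] at this
            exact hlt this
          have := H x (by rw [hrepr, if_pos rfl, h1]; exact mul_ne_zero hx₀ hx)
          rw [Function.update_self] at this
          omega
        · have := H x (by rwa [hrepr, if_neg hxx])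
          rwa [Function.update_of_ne hxx] at this
  -- As `x₀` is in the first column of the support of `ξ`, the functional can be nonzero on `V'_k`
  -- only if column `s x₀` belongs to `V'_k`.
  · intro k v
    rw [h.mem_right]
    constructor
    · intro H x hx
      rw [hrepr] at hx
      by_cases hxx : x = x₀
      · subst hxx
        rw [if_pos rfl] at hx
        obtain ⟨y, hy1, hy2⟩ := exists_mul_repr_ne_zero hx
        exact (Fin.le_def.1 (hl y hy1)).trans_lt (H y hy2)
      · rw [if_neg hxx] at hx
        exact H x hx
    · intro H x hx
      by_cases hxx : x = x₀
      · subst hxx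
        by_contra hlt
        have h1 : pair e ξ v = ξ x * e.repr v x := by
          refine pair_eq_single fun y hy hξy => ?_
          by_contra hvy
          have := H y (by rwa [hrepr, if_neg hy])
          exact hlt ((Fin.le_def.1 (hl y hξy)).trans_lt this)
        exact hlt (H x (by rw [hrepr, if_pos rfl, h1]; exact mul_ne_zero hx₀ hx))
      · exact H x (by rwa [hrepr, if_neg hxx])

/-! ### The effect of a move on the relative position and on the vector -/

theorem Adapted.pos_up (h : Adapted f f' e r s) (hab : b.val = a.val + 1) {u : ι → F}
    (hu : ∀ x, u x ≠ 0 → r x = b) {x₀ : ι} (hx₀ : u x₀ ≠ 0) (hl : ∀ x, u x ≠ 0 → s x ≤ s x₀)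
    (hg : AdjUp b f g) (hug : e.equivFun.symm u ∈ g.V b.castSucc) :
    pos g f' = pos f f' + Matrix.single a (s x₀) 1 - Matrix.single b (s x₀) 1 := by
  classical
  obtain ⟨e', he', -⟩ := h.exists_up hab hu hx₀ hl hg hug
  ext i j
  rw [Matrix.sub_apply, Matrix.add_apply, he'.pos_eq, h.pos_eq, card_update_filter, hu x₀ hx₀]

theorem Adapted.pos_down (h : Adapted f f' e r s) (hab : b.val = a.val + 1) {ξ : ι → F}
    (hξ : ∀ x, ξ x ≠ 0 → r x = a) {x₀ : ι} (hx₀ : ξ x₀ ≠ 0) (hl : ∀ x, ξ x ≠ 0 → s x₀ ≤ s x)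
    (hg : AdjUp b g f) (hker : g.V b.castSucc ≤ LinearMap.ker (pair e ξ)) :
    pos g f' = pos f f' + Matrix.single b (s x₀) 1 - Matrix.single a (s x₀) 1 := by
  classical
  obtain ⟨e', he', -⟩ := h.exists_down hab hξ hx₀ hl hg hker
  ext i j
  rw [Matrix.sub_apply, Matrix.add_apply, he'.pos_eq, h.pos_eq, card_update_filter, hξ x₀ hx₀]

variable {I : Set (Fin n × Fin n)} {w : Fin d → F}

/-- The move transfers one basis vector from row `b` to row `a` within column `s x₀`. As long as `I`
does not separate these two positions, its coordinate subspace is unchanged. -/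
theorem Adapted.mem_spanBelow_up (h : Adapted f f' e r s) (hab : b.val = a.val + 1) {u : ι → F}
    (hu : ∀ x, u x ≠ 0 → r x = b) {x₀ : ι} (hx₀ : u x₀ ≠ 0) (hl : ∀ x, u x ≠ 0 → s x ≤ s x₀)
    (hg : AdjUp b f g) (hug : e.equivFun.symm u ∈ g.V b.castSucc) (hI : IsLowerSet I)
    (hc : (a, s x₀) ∉ I ∨ (b, s x₀) ∈ I) :
    w ∈ spanBelow g f' I ↔ w ∈ spanBelow f f' I := by
  classical
  obtain ⟨e', he', hrepr⟩ := h.exists_up hab hu hx₀ hl hg hug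
  have hrx₀ := hu x₀ hx₀
  rw [he'.mem_spanBelow hI, h.mem_spanBelow hI]
  rcases hc with hc | hc
  · have hbn : (b, s x₀) ∉ I := fun hb => hc (hI (Prod.mk_le_mk.2
      ⟨Fin.le_def.2 (by omega), le_rfl⟩) hb)
    constructor
    · intro H x hx
      have hx0 : e.repr w x₀ = 0 := by
        by_contra hne
        have := H x₀ (by rw [hrepr, if_pos rfl]; exact div_ne_zero hne hx₀)
        rw [Function.update_self] at this
        exact hc this
      have hxx : x ≠ x₀ := by rintro rfl; exact hx hx0
      have := H x (by rw [hrepr, if_neg hxx, hx0]; simpa using hx)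
      rwa [Function.update_of_ne hxx] at this
    · intro H x hx
      have hx0 : e.repr w x₀ = 0 := by
        by_contra hne
        have := H x₀ hne
        rw [hrx₀] at this
        exact hbn this
      rw [hrepr, hx0] at hx
      have hxx : x ≠ x₀ := by rintro rfl; simp at hx
      rw [Function.update_of_ne hxx]
      exact H x (by simpa [hxx] using hx)
  · have hin : ∀ x, u x ≠ 0 → (r x, s x) ∈ I := fun x hx => by
      rw [hu x hx]
      exact hI (Prod.mk_le_mk.2 ⟨le_rfl, hl x hx⟩) hc
    constructor
    · intro H x hx
      by_cases hux : u x = 0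
      · have hxx : x ≠ x₀ := by rintro rfl; exact hx₀ hux
        have := H x (by rw [hrepr, if_neg hxx, hux]; simpa using hx)
        rwa [Function.update_of_ne hxx] at this
      · exact hin x hux
    · intro H x hx
      by_cases hxx : x = x₀
      · subst hxx
        rw [Function.update_self]
        exact hI (Prod.mk_le_mk.2 ⟨Fin.le_def.2 (by omega), le_rfl⟩) hc
      · rw [Function.update_of_ne hxx]
        by_cases hux : u x = 0
        · rw [hrepr, if_neg hxx, hux] at hx
          exact H x (by simpa using hx)
        · exact hin x hux

/-- When `I` separates the two positions, its subspace gains exactly the line through the vector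
with coordinates `u`. -/
theorem Adapted.mem_spanBelow_up' (h : Adapted f f' e r s) (hab : b.val = a.val + 1) {u : ι → F}
    (hu : ∀ x, u x ≠ 0 → r x = b) {x₀ : ι} (hx₀ : u x₀ ≠ 0) (hl : ∀ x, u x ≠ 0 → s x ≤ s x₀)
    (hg : AdjUp b f g) (hug : e.equivFun.symm u ∈ g.V b.castSucc) (hI : IsLowerSet I)
    (ha : (a, s x₀) ∈ I) (hb : (b, s x₀) ∉ I) :
    w ∈ spanBelow g f' I ↔ ∃ c : F, ∀ x, (r x, s x) ∉ I → e.repr w x = c * u x := by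
  classical
  obtain ⟨e', he', hrepr⟩ := h.exists_up hab hu hx₀ hl hg hug
  have hrx₀ := hu x₀ hx₀
  rw [he'.mem_spanBelow hI]
  constructor
  · intro H
    refine ⟨e.repr w x₀ / u x₀, fun x hx => ?_⟩
    by_cases hxx : x = x₀
    · subst hxx; field_simp
    · by_contra hne
      have := H x (by rw [hrepr, if_neg hxx]; exact sub_ne_zero.2 hne)
      rw [Function.update_of_ne hxx] at this
      exact hx this
  · rintro ⟨c, hc⟩ x hx
    by_cases hxx : x = x₀
    · subst hxx
      rwa [Function.update_self]
    · rw [Function.update_of_ne hxx]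
      by_contra hxI
      have h1 := hc x₀ (by rwa [hrx₀])
      rw [hrepr, if_neg hxx, h1, mul_div_cancel_right₀ _ hx₀, hc x hxI, sub_self] at hx
      exact hx rfl

theorem Adapted.mem_spanBelow_down (h : Adapted f f' e r s) (hab : b.val = a.val + 1) {ξ : ι → F}
    (hξ : ∀ x, ξ x ≠ 0 → r x = a) {x₀ : ι} (hx₀ : ξ x₀ ≠ 0) (hl : ∀ x, ξ x ≠ 0 → s x₀ ≤ s x)
    (hg : AdjUp b g f) (hker : g.V b.castSucc ≤ LinearMap.ker (pair e ξ)) (hI : IsLowerSet I)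
    (hc : (a, s x₀) ∉ I ∨ (b, s x₀) ∈ I) :
    w ∈ spanBelow g f' I ↔ w ∈ spanBelow f f' I := by
  classical
  obtain ⟨e', he', hrepr⟩ := h.exists_down hab hξ hx₀ hl hg hker
  have hrx₀ := hξ x₀ hx₀
  rw [he'.mem_spanBelow hI, h.mem_spanBelow hI]
  rcases hc with hc | hc
  · have hbn : (b, s x₀) ∉ I := fun hb => hc (hI (Prod.mk_le_mk.2
      ⟨Fin.le_def.2 (by omega), le_rfl⟩) hb)
    have hout : ∀ x, ξ x ≠ 0 → (r x, s x) ∉ I := fun x hx hxI => hc (by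
      rw [hξ x hx] at hxI
      exact hI (Prod.mk_le_mk.2 ⟨le_rfl, hl x hx⟩) hxI)
    constructor
    · intro H x hx
      by_cases hxx : x = x₀
      · subst hxx
        exfalso
        refine hbn ?_
        have := H x ?_
        · rwa [Function.update_self] at this
        · rw [hrepr, if_pos rfl, pair_eq_single (x₀ := x)]
          · exact mul_ne_zero hx₀ hx
          · intro y hy hξy
            by_contra hwy
            have := H y (by rwa [hrepr, if_neg hy])
            rw [Function.update_of_ne hy] at this
            exact hout y hξy this
      · have := H x (by rwa [hrepr, if_neg hxx])
        rwa [Function.update_of_ne hxx] at this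
    · intro H x hx
      rw [hrepr] at hx
      by_cases hxx : x = x₀
      · subst hxx
        rw [if_pos rfl] at hx
        obtain ⟨y, hy1, hy2⟩ := exists_mul_repr_ne_zero hx
        exact absurd (H y hy2) (hout y hy1)
      · rw [if_neg hxx] at hx
        rw [Function.update_of_ne hxx]
        exact H x hx
  · have haI : (a, s x₀) ∈ I := hI (Prod.mk_le_mk.2 ⟨Fin.le_def.2 (by omega), le_rfl⟩) hc
    constructor
    · intro H x hx
      by_cases hxx : x = x₀
      · subst hxx
        rwa [hrx₀]
      · have := H x (by rwa [hrepr, if_neg hxx])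
        rwa [Function.update_of_ne hxx] at this
    · intro H x hx
      by_cases hxx : x = x₀
      · subst hxx
        rwa [Function.update_self]
      · rw [hrepr, if_neg hxx] at hx
        rw [Function.update_of_ne hxx]
        exact H x hx

/-- When `I` separates the two positions, the coordinate at `x₀`, now given by `pair e ξ`, has left
`I` and must vanish. -/
theorem Adapted.mem_spanBelow_down' (h : Adapted f f' e r s) (hab : b.val = a.val + 1) {ξ : ι → F}
    (hξ : ∀ x, ξ x ≠ 0 → r x = a) {x₀ : ι} (hx₀ : ξ x₀ ≠ 0) (hl : ∀ x, ξ x ≠ 0 → s x₀ ≤ s x)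
    (hg : AdjUp b g f) (hker : g.V b.castSucc ≤ LinearMap.ker (pair e ξ)) (hI : IsLowerSet I)
    (ha : (a, s x₀) ∈ I) (hb : (b, s x₀) ∉ I) :
    w ∈ spanBelow g f' I ↔ w ∈ spanBelow f f' I ∧ pair e ξ w = 0 := by
  classical
  obtain ⟨e', he', hrepr⟩ := h.exists_down hab hξ hx₀ hl hg hker
  have hrx₀ := hξ x₀ hx₀
  rw [he'.mem_spanBelow hI, h.mem_spanBelow hI]
  constructor
  · intro H
    refine ⟨fun x hx => ?_, ?_⟩
    · by_cases hxx : x = x₀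
      · subst hxx
        rwa [hrx₀]
      · have := H x (by rwa [hrepr, if_neg hxx])
        rwa [Function.update_of_ne hxx] at this
    · by_contra hne
      have := H x₀ (by rwa [hrepr, if_pos rfl])
      rw [Function.update_self] at this
      exact hb this
  · rintro ⟨H, H0⟩ x hx
    have hxx : x ≠ x₀ := by
      rintro rfl
      rw [hrepr, if_pos rfl] at hx
      exact hx H0
    rw [hrepr, if_neg hxx] at hx
    rw [Function.update_of_ne hxx]
    exact H x hx

end Change

/-! ### Counting vectors and functionals supported in one row -/

section Counting

variable {F : Type} [Field F] {n d : ℕ}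

open Module Submodule Classical

/-- The sum of the entries of row `b` of `A` in the columns satisfying `P`. -/
def rowSum (A : Matrix (Fin n) (Fin n) ℤ) (b : Fin n) (P : Fin n → Prop) : ℤ :=
  ∑ y with P y, A b y

/-- The number of elements satisfying `P`. -/
def cnt {α : Type} [Fintype α] (P : α → Prop) : ℚ := ∑ u, chi (P u)

theorem cnt_congr {α : Type} [Fintype α] {P Q : α → Prop} (h : ∀ u, P u ↔ Q u) :
    cnt P = cnt Q := Finset.sum_congr rfl fun u _ => chi_congr (h u)

theorem cnt_eq_card {α : Type} [Fintype α] (P : α → Prop) : cnt P = Nat.card {u // P u} := by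
  rw [Nat.card_eq_fintype_card, Fintype.card_subtype, Finset.card_filter, cnt, Nat.cast_sum]
  refine Finset.sum_congr rfl fun u _ => ?_
  by_cases h : P u <;> simp [chi, h]

theorem cnt_eq_zero {α : Type} [Fintype α] {P : α → Prop} (h : ∀ u, ¬ P u) : cnt P = 0 :=
  Finset.sum_eq_zero fun u _ => chi_false (h u)

theorem cnt_sub {α : Type} [Fintype α] (P Q R : α → Prop) (hQ : ∀ x, Q x → P x)
    (hR : ∀ x, R x ↔ P x ∧ ¬ Q x) : cnt R = cnt P - cnt Q := by
  rw [cnt, cnt, cnt, ← Finset.sum_sub_distrib]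
  refine Finset.sum_congr rfl fun u _ => ?_
  rw [chi_congr (hR u)]
  by_cases hP : P u <;> by_cases hQ' : Q u <;> simp_all [chi]

theorem chi_exists {α : Type} [Fintype α] (P : α → Prop) (h : ∀ c c', P c → P c' → c = c') :
    chi (∃ c, P c) = ∑ c, chi (P c) := by
  by_cases hP : ∃ c, P c
  · obtain ⟨c, hc⟩ := hP
    rw [chi_true ⟨c, hc⟩, Finset.sum_eq_single c, chi_true hc]
    · exact fun c' _ hne => chi_false fun hc' => hne (h _ _ hc' hc)
    · simp
  · rw [chi_false hP]
    exact (Finset.sum_eq_zero fun c _ => chi_false fun hc => hP ⟨c, hc⟩).symm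

theorem cnt_agree {F : Type} [Fintype F] {ι : Type} [Fintype ι] (P : ι → Prop) (g : ι → F) :
    cnt (fun u : ι → F => ∀ x, P x → u x = g x) =
      (Fintype.card F : ℚ) ^ Nat.card {x // ¬ P x} := by
  rw [cnt_eq_card, ← Nat.cast_pow, Nat.card_eq_fintype_card, Nat.card_eq_fintype_card,
    ← Fintype.card_fun]
  congr 1
  refine Fintype.card_congr ⟨fun u x => u.1 x.1,
    fun v => ⟨fun x => if h : P x then g x else v ⟨x, h⟩, fun x hx => by simp [hx]⟩, ?_, ?_⟩
  · rintro ⟨u, hu⟩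
    ext x
    by_cases h : P x
    · simp [h, hu x h]
    · simp [h]
  · intro v
    ext ⟨x, hx⟩
    simp [hx]

/-- Among the vectors supported off `P`, the orthogonality condition selects one in `q`, unless `w`
vanishes off `P` and the condition is void. The factor `q` on the left avoids an exponent reduced by
one. -/
theorem cnt_pair [Fintype F] {ι : Type} [Fintype ι] (P : ι → Prop) (w : ι → F) :
    cnt (fun u : ι → F => (∀ x, P x → u x = 0) ∧ ∑ x, u x * w x = 0) *
      Fintype.card F = (Fintype.card F : ℚ) ^ Nat.card {x // ¬ P x} *
        (1 + ((Fintype.card F : ℚ) - 1) * chi (∀ x, ¬ P x → w x = 0)) := by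
  have h0 := cnt_agree P (0 : ι → F)
  by_cases hw : ∀ x, ¬ P x → w x = 0
  · rw [chi_true hw, cnt_congr (Q := fun u : ι → F => ∀ x, P x → u x = (0 : ι → F) x), h0]
    · ring
    · intro u
      refine ⟨fun h => h.1, fun h => ⟨h, Finset.sum_eq_zero fun x _ => ?_⟩⟩
      by_cases hx : P x
      · simp [h x hx]
      · simp [hw x hx]
  · rw [chi_false hw]
    push Not at hw
    obtain ⟨x₀, hx₀, hwx₀⟩ := hw
    -- All fibres of the linear form have the same size, by translation along the coordinate `x₀`.
    have h1 : ∀ t : F, cnt (fun u : ι → F => (∀ x, P x → u x = 0) ∧ ∑ x, u x * w x = t) =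
        cnt (fun u : ι → F => (∀ x, P x → u x = 0) ∧ ∑ x, u x * w x = 0) := by
      intro t
      have hs : ∑ x, (Pi.single x₀ (t / w x₀) : ι → F) x * w x = t := by
        rw [Finset.sum_eq_single x₀]
        · simp [hwx₀]
        · intro y _ hy; simp [hy]
        · simp
      have hP : ∀ x, P x → (Pi.single x₀ (t / w x₀) : ι → F) x = 0 := by
        intro x hx
        rw [Pi.single_eq_of_ne]
        rintro rfl
        exact hx₀ hx
      refine Fintype.sum_equiv (Equiv.subRight (Pi.single x₀ (t / w x₀))) _ _ fun u => ?_
      refine chi_congr (and_congr (forall₂_congr fun x hx => ?_) ?_)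
      · rw [Equiv.subRight_apply, Pi.sub_apply, hP x hx, sub_zero]
      · simp only [Equiv.subRight_apply, Pi.sub_apply, sub_mul, Finset.sum_sub_distrib, hs,
          sub_eq_zero]
    have h2 : cnt (fun u : ι → F => ∀ x, P x → u x = (0 : ι → F) x) =
        ∑ t : F, cnt (fun u : ι → F => (∀ x, P x → u x = 0) ∧ ∑ x, u x * w x = t) := by
      unfold cnt
      rw [Finset.sum_comm]
      refine Finset.sum_congr rfl fun u _ => ?_
      rw [← chi_exists _ fun c c' h h' => h.2.symm.trans h'.2]
      exact chi_congr ⟨fun h => ⟨_, h, rfl⟩, fun ⟨_, h, _⟩ => h⟩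
    rw [Finset.sum_congr rfl (fun t _ => h1 t), h0, Finset.sum_const, Finset.card_univ,
      nsmul_eq_mul] at h2
    rw [h2]
    ring

variable {f f' g : PFlag F n d} {ι : Type} [Fintype ι] {e : Basis ι F (Fin d → F)}
  {r s : ι → Fin n} {a b : Fin n}

theorem Adapted.card_row (h : Adapted f f' e r s) (b : Fin n) (P : Fin n → Prop) :
    (Nat.card {x // r x = b ∧ P (s x)} : ℤ) = rowSum (pos f f') b P := by
  rw [Nat.card_eq_fintype_card, Fintype.card_subtype,
    Finset.card_eq_sum_card_fiberwise (f := s) (t := Finset.univ.filter P)]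
  · rw [Nat.cast_sum, rowSum]
    refine Finset.sum_congr rfl fun y hy => ?_
    rw [h.pos_eq, Finset.filter_filter]
    congr 2
    ext x
    simp only [Finset.mem_filter, Finset.mem_univ, true_and] at hy ⊢
    constructor
    · rintro ⟨⟨h1, _⟩, h2⟩
      exact ⟨h1, h2⟩
    · rintro ⟨h1, h2⟩
      exact ⟨⟨h1, h2 ▸ hy⟩, h2⟩
  · intro x hx
    simpa using (by simpa using hx : _ ∧ _).2

theorem Adapted.pow_card_row [Fintype F] (h : Adapted f f' e r s) (b : Fin n) (P : Fin n → Prop) :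
    (Fintype.card F : ℚ) ^ Nat.card {x // r x = b ∧ P (s x)} =
      (Fintype.card F : ℚ) ^ rowSum (pos f f') b P := by
  rw [← h.card_row, zpow_natCast]

/-- The vectors supported in row `b` and in the columns satisfying `P`. -/
theorem Adapted.cnt_support_row [Fintype F] (h : Adapted f f' e r s) (b : Fin n)
    (P : Fin n → Prop) :
    cnt (fun u : ι → F => ∀ x, u x ≠ 0 → r x = b ∧ P (s x)) =
      (Fintype.card F : ℚ) ^ rowSum (pos f f') b P := by
  rw [← h.pow_card_row b P]
  have := cnt_agree (fun x => ¬ (r x = b ∧ P (s x))) (0 : ι → F)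
  simp only [not_not] at this
  rw [← this]
  exact cnt_congr fun u => forall_congr' fun x => not_imp_comm

/-- `u` is supported in row `b`, and `l` is the last column of its support. -/
def LastCol (r s : ι → Fin n) (b l : Fin n) (u : ι → F) : Prop :=
  (∀ x, u x ≠ 0 → r x = b ∧ s x ≤ l) ∧ ∃ x, u x ≠ 0 ∧ s x = l

/-- `u` is supported in row `b`, and `l` is the first column of its support. -/
def FirstCol (r s : ι → Fin n) (b l : Fin n) (u : ι → F) : Prop :=
  (∀ x, u x ≠ 0 → r x = b ∧ l ≤ s x) ∧ ∃ x, u x ≠ 0 ∧ s x = l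

theorem lastCol_iff {ι : Type} (r s : ι → Fin n) (b l : Fin n) (u : ι → F) : LastCol r s b l u ↔
    (∀ x, u x ≠ 0 → r x = b ∧ s x ≤ l) ∧ ¬ (∀ x, u x ≠ 0 → r x = b ∧ s x < l) := by
  refine and_congr_right fun h => ?_
  constructor
  · rintro ⟨x, hx, hl⟩ H
    exact absurd (H x hx).2 (by simp [hl])
  · intro H
    push Not at H
    obtain ⟨x, hx, hl⟩ := H
    exact ⟨x, hx, le_antisymm (h x hx).2 (hl (h x hx).1)⟩

theorem firstCol_iff {ι : Type} (r s : ι → Fin n) (b l : Fin n) (u : ι → F) : FirstCol r s b l u ↔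
    (∀ x, u x ≠ 0 → r x = b ∧ l ≤ s x) ∧ ¬ (∀ x, u x ≠ 0 → r x = b ∧ l < s x) := by
  refine and_congr_right fun h => ?_
  constructor
  · rintro ⟨x, hx, hl⟩ H
    exact absurd (H x hx).2 (by simp [hl])
  · intro H
    push Not at H
    obtain ⟨x, hx, hl⟩ := H
    exact ⟨x, hx, le_antisymm (hl (h x hx).1) (h x hx).2⟩

theorem Adapted.cnt_lastCol [Fintype F] (h : Adapted f f' e r s) (b l : Fin n) :
    cnt (fun u : ι → F => LastCol r s b l u) =
      (Fintype.card F : ℚ) ^ rowSum (pos f f') b (· ≤ l) -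
        (Fintype.card F : ℚ) ^ rowSum (pos f f') b (· < l) := by
  rw [← h.cnt_support_row, ← h.cnt_support_row]
  exact cnt_sub (fun u : ι → F => ∀ x, u x ≠ 0 → r x = b ∧ s x ≤ l)
    (fun u : ι → F => ∀ x, u x ≠ 0 → r x = b ∧ s x < l) (LastCol r s b l)
    (fun u hu x hx => ⟨(hu x hx).1, (hu x hx).2.le⟩) fun u => lastCol_iff r s b l u

theorem Adapted.cnt_firstCol [Fintype F] (h : Adapted f f' e r s) (b l : Fin n) :
    cnt (fun u : ι → F => FirstCol r s b l u) =
      (Fintype.card F : ℚ) ^ rowSum (pos f f') b (l ≤ ·) -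
        (Fintype.card F : ℚ) ^ rowSum (pos f f') b (l < ·) := by
  rw [← h.cnt_support_row, ← h.cnt_support_row]
  exact cnt_sub (fun u : ι → F => ∀ x, u x ≠ 0 → r x = b ∧ l ≤ s x)
    (fun u : ι → F => ∀ x, u x ≠ 0 → r x = b ∧ l < s x) (FirstCol r s b l)
    (fun u hu x hx => ⟨(hu x hx).1, (hu x hx).2.le⟩) fun u => firstCol_iff r s b l u

variable {I : Set (Fin n × Fin n)} {w : Fin d → F}

/-- An initial segment of row `b` may be added because the preceding row `a` already contains its
columns. -/
theorem isLowerSet_union_row (hab : b.val = a.val + 1) (hI : IsLowerSet I) (P : Fin n → Prop)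
    (hP : ∀ y y', y ≤ y' → P y' → P y) (ha : ∀ y, P y → (a, y) ∈ I) :
    IsLowerSet (I ∪ {x | x.1 = b ∧ P x.2}) := by
  rintro ⟨i, j⟩ ⟨i', j'⟩ hle hx
  rw [Prod.mk_le_mk] at hle
  rcases hx with hx | ⟨h1, h2⟩
  · exact Or.inl (hI (Prod.mk_le_mk.2 hle) hx)
  · simp only at h1 h2
    subst h1
    by_cases hi : i' = i
    · exact Or.inr ⟨hi, hP _ _ hle.2 h2⟩
    · refine Or.inl (hI (Prod.mk_le_mk.2 ⟨?_, hle.2⟩) (ha j h2))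
      have := lt_of_le_of_ne hle.1 hi
      rw [Fin.lt_def] at this
      exact Fin.le_def.2 (by omega)

theorem isLowerSet_diff_row (hab : b.val = a.val + 1) (hI : IsLowerSet I) (P : Fin n → Prop)
    (hP : ∀ y y', y ≤ y' → P y → P y') (hb : ∀ y, P y → (b, y) ∉ I) :
    IsLowerSet (I \ {x | x.1 = a ∧ P x.2}) := by
  rintro ⟨i, j⟩ ⟨i', j'⟩ hle ⟨hx, hx'⟩
  rw [Prod.mk_le_mk] at hle
  refine ⟨hI (Prod.mk_le_mk.2 hle) hx, ?_⟩
  rintro ⟨h1, h2⟩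
  simp only at h1 h2
  subst h1
  by_cases hi : i' = i
  · exact hx' ⟨hi.symm, hP _ _ hle.2 h2⟩
  · refine hb j (hP _ _ hle.2 h2) (hI (Prod.mk_le_mk.2 ⟨?_, le_rfl⟩) hx)
    have := lt_of_le_of_ne hle.1 hi
    rw [Fin.lt_def] at this
    exact Fin.le_def.2 (by omega)

/-- If `w` lies in the subspace of `I`, then `c = 0` serves every `u`. Otherwise `c ≠ 0`: there are
`q - 1` choices of `c`, outside `I` the vector `u` is forced to be `c⁻¹ w`, and its entries in row
`b` inside `I` are free. Such a `u` exists only if the part of `w` outside `I` lies in row `b` with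
last column exactly `l`, which is what the difference of two indicators expresses. -/
theorem Adapted.cnt_lastCol_vec [Fintype F] (h : Adapted f f' e r s) (hab : b.val = a.val + 1)
    {l : Fin n} (hI : IsLowerSet I) (ha : (a, l) ∈ I) (hb : (b, l) ∉ I) :
    cnt (fun u : ι → F => LastCol r s b l u ∧
      ∃ c : F, ∀ x, (r x, s x) ∉ I → e.repr w x = c * u x) =
      ((Fintype.card F : ℚ) ^ rowSum (pos f f') b (· ≤ l) -
        (Fintype.card F : ℚ) ^ rowSum (pos f f') b (· < l)) * chi (w ∈ spanBelow f f' I) +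
      ((Fintype.card F : ℚ) - 1) * (Fintype.card F : ℚ) ^ rowSum (pos f f') b (fun y => (b, y) ∈ I) *
        (chi (w ∈ spanBelow f f' (I ∪ {x | x.1 = b ∧ x.2 ≤ l})) -
          chi (w ∈ spanBelow f f' (I ∪ {x | x.1 = b ∧ x.2 < l}))) := by
  have hL1 := isLowerSet_union_row hab hI (· ≤ l) (fun y y' h1 h2 => h1.trans h2)
    (fun y hy => hI (Prod.mk_le_mk.2 ⟨le_rfl, hy⟩) ha)
  have hL2 := isLowerSet_union_row hab hI (· < l) (fun y y' h1 h2 => h1.trans_lt h2)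
    (fun y hy => hI (Prod.mk_le_mk.2 ⟨le_rfl, hy.le⟩) ha)
  have hrow : ∀ y, (b, y) ∈ I → y < l := fun y hy =>
    lt_of_not_ge fun hle => hb (hI (Prod.mk_le_mk.2 ⟨le_rfl, hle⟩) hy)
  by_cases hw : w ∈ spanBelow f f' I
  · rw [chi_true hw, chi_true (spanBelow_mono f f' Set.subset_union_left hw),
      chi_true (spanBelow_mono f f' Set.subset_union_left hw), mul_one, sub_self, mul_zero,
      add_zero, ← h.cnt_lastCol]
    rw [h.mem_spanBelow hI] at hw
    refine cnt_congr fun u => and_iff_left_of_imp fun _ => ⟨0, fun x hx => ?_⟩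
    rw [zero_mul]
    by_contra hne
    exact hx (hw x hne)
  · rw [chi_false hw, mul_zero, zero_add]
    rw [h.mem_spanBelow hI] at hw
    push Not at hw
    obtain ⟨x₁, hx₁, hx₁I⟩ := hw
    rw [chi_congr (h.mem_spanBelow hL1 w), chi_congr (h.mem_spanBelow hL2 w)]
    have hlast : ∀ u : ι → F, LastCol r s b l u → ∀ c : F,
        (∀ x, (r x, s x) ∉ I → e.repr w x = c * u x) → c ≠ 0 ∧
        (∀ x, e.repr w x ≠ 0 → (r x, s x) ∈ I ∪ {x | x.1 = b ∧ x.2 ≤ l}) ∧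
        ¬ (∀ x, e.repr w x ≠ 0 → (r x, s x) ∈ I ∪ {x | x.1 = b ∧ x.2 < l}) := by
      rintro u ⟨hu, x₂, hx₂, hx₂l⟩ c hc
      have hc0 : c ≠ 0 := by
        rintro rfl
        exact hx₁ (by rw [hc x₁ hx₁I, zero_mul])
      refine ⟨hc0, fun x hx => ?_, fun H => ?_⟩
      · by_cases hxI : (r x, s x) ∈ I
        · exact Or.inl hxI
        · rw [hc x hxI] at hx
          exact Or.inr (hu x (right_ne_zero_of_mul hx))
      · have hx₂r := (hu x₂ hx₂).1
        have hx₂I : (r x₂, s x₂) ∉ I := by rwa [hx₂r, hx₂l]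
        rcases H x₂ (by rw [hc x₂ hx₂I]; exact mul_ne_zero hc0 hx₂) with h1 | h1
        · exact hx₂I h1
        · exact absurd h1.2 (by simp [hx₂l])
    by_cases hK' : ∀ x, e.repr w x ≠ 0 → (r x, s x) ∈ I ∪ {x | x.1 = b ∧ x.2 < l}
    · have hK : ∀ x, e.repr w x ≠ 0 → (r x, s x) ∈ I ∪ {x | x.1 = b ∧ x.2 ≤ l} := by
        intro x hx
        rcases hK' x hx with h1 | h1
        · exact Or.inl h1
        · exact Or.inr ⟨h1.1, le_of_lt h1.2⟩
      rw [chi_true hK, chi_true hK', sub_self, mul_zero]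
      refine cnt_eq_zero ?_
      rintro u ⟨hu, c, hc⟩
      exact (hlast u hu c hc).2.2 hK'
    · rw [chi_false hK', sub_zero]
      by_cases hK : ∀ x, e.repr w x ≠ 0 → (r x, s x) ∈ I ∪ {x | x.1 = b ∧ x.2 ≤ l}
      · rw [chi_true hK, mul_one, ← h.pow_card_row]
        have hset : ∀ u : ι → F, (LastCol r s b l u ∧
            ∃ c : F, ∀ x, (r x, s x) ∉ I → e.repr w x = c * u x) ↔
            ∃ c : F, c ≠ 0 ∧ ∀ x, ¬ (r x = b ∧ (b, s x) ∈ I) → u x =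
                (fun x => if (r x, s x) ∈ I then 0 else c⁻¹ * e.repr w x) x := by
          intro u
          dsimp only
          constructor
          · rintro ⟨hu, c, hc⟩
            have hc0 := (hlast u hu c hc).1
            refine ⟨c, hc0, fun x hx => ?_⟩
            split_ifs with hxI
            · by_contra hne
              have hr := (hu.1 x hne).1
              exact hx ⟨hr, hr ▸ hxI⟩
            · rw [hc x hxI, inv_mul_cancel_left₀ hc0]
          · rintro ⟨c, hc0, hc⟩
            have hout : ∀ x, (r x, s x) ∉ I → u x = c⁻¹ * e.repr w x := by
              intro x hx
              rw [hc x fun h1 => hx (h1.1 ▸ h1.2), if_neg hx]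
            refine ⟨⟨fun x hx => ?_, ?_⟩, c, fun x hx => ?_⟩
            · by_cases hxI : (r x, s x) ∈ I
              · by_cases hrx : r x = b ∧ (b, s x) ∈ I
                · exact ⟨hrx.1, (hrow _ hrx.2).le⟩
                · rw [hc x hrx, if_pos hxI] at hx
                  exact absurd rfl hx
              · rw [hout x hxI] at hx
                rcases hK x (right_ne_zero_of_mul hx) with h1 | h1
                · exact absurd h1 hxI
                · exact h1
            · push Not at hK'
              obtain ⟨x, hx, hxn⟩ := hK'
              have hxI : (r x, s x) ∉ I := fun h1 => hxn (Or.inl h1)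
              have hx2 : r x = b ∧ s x ≤ l := (hK x hx).resolve_left hxI
              refine ⟨x, by rw [hout x hxI]; exact mul_ne_zero (inv_ne_zero hc0) hx, ?_⟩
              by_contra hne
              exact hxn (Or.inr ⟨hx2.1, lt_of_le_of_ne hx2.2 hne⟩)
            · rw [hout x hx, mul_inv_cancel_left₀ hc0]
        rw [cnt_congr hset]
        unfold cnt
        rw [Finset.sum_congr rfl fun u _ => chi_exists _ ?_]
        · rw [Finset.sum_comm]
          have h2 : ∀ c : F, ∑ u : ι → F, chi (c ≠ 0 ∧ ∀ x, ¬ (r x = b ∧ (b, s x) ∈ I) → u x =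
                (fun x => if (r x, s x) ∈ I then 0 else c⁻¹ * e.repr w x) x) =
              chi (c ≠ 0) * (Fintype.card F : ℚ) ^ Nat.card {x // r x = b ∧ (b, s x) ∈ I} := by
            intro c
            have h3 := cnt_agree (fun x => ¬ (r x = b ∧ (b, s x) ∈ I))
              (fun x => if (r x, s x) ∈ I then 0 else c⁻¹ * e.repr w x)
            simp only [not_not] at h3
            rw [← h3, cnt, Finset.mul_sum]
            exact Finset.sum_congr rfl fun u _ => chi_and _ _
          rw [Finset.sum_congr rfl fun c _ => h2 c, ← Finset.sum_mul]
          congr 1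
          have h4 : ∀ c : F, chi (c ≠ 0) = 1 - chi (c = 0) := by
            intro c
            by_cases hc : c = 0 <;> simp [chi, hc]
          rw [Finset.sum_congr rfl fun c _ => h4 c, Finset.sum_sub_distrib]
          simp [chi]
        -- The scalar is recovered from a nonzero coordinate `x₁` of `w` outside `I`.
        · rintro c c' ⟨hc, hu⟩ ⟨hc', hu'⟩
          have h1 := hu x₁ fun h1 => hx₁I (h1.1 ▸ h1.2)
          have h2 := hu' x₁ fun h1 => hx₁I (h1.1 ▸ h1.2)
          dsimp only at h1 h2
          rw [if_neg hx₁I] at h1 h2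
          rw [h1] at h2
          exact inv_injective (mul_right_cancel₀ hx₁ h2)
      · rw [chi_false hK, mul_zero]
        refine cnt_eq_zero ?_
        rintro u ⟨hu, c, hc⟩
        exact hK (hlast u hu c hc).2.1

/-- Apply `cnt_pair` to the functionals supported in columns `≥ l` and `> l` and subtract. That `w`
vanishes on such a part of row `a` means membership in the subspace of `I` with this part removed.
-/
theorem Adapted.cnt_firstCol_vec [Fintype F] (h : Adapted f f' e r s) (hab : b.val = a.val + 1)
    {l : Fin n} (hI : IsLowerSet I) (hb : (b, l) ∉ I) :
    cnt (fun ξ : ι → F => FirstCol r s a l ξ ∧ (w ∈ spanBelow f f' I ∧ pair e ξ w = 0)) *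
        Fintype.card F =
      ((Fintype.card F : ℚ) ^ rowSum (pos f f') a (l ≤ ·) -
        (Fintype.card F : ℚ) ^ rowSum (pos f f') a (l < ·)) * chi (w ∈ spanBelow f f' I) +
      ((Fintype.card F : ℚ) - 1) *
        ((Fintype.card F : ℚ) ^ rowSum (pos f f') a (l ≤ ·) *
            chi (w ∈ spanBelow f f' (I \ {x | x.1 = a ∧ l ≤ x.2})) -
          (Fintype.card F : ℚ) ^ rowSum (pos f f') a (l < ·) *
            chi (w ∈ spanBelow f f' (I \ {x | x.1 = a ∧ l < x.2}))) := by
  have hbI : ∀ y, l ≤ y → (b, y) ∉ I := fun y hy hyI =>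
    hb (hI (Prod.mk_le_mk.2 ⟨le_rfl, hy⟩) hyI)
  have hL1 := isLowerSet_diff_row hab hI (l ≤ ·) (fun y y' h1 h2 => h2.trans h1)
    (fun y hy => hbI y hy)
  have hL2 := isLowerSet_diff_row hab hI (l < ·) (fun y y' h1 h2 => h2.trans_le h1)
    (fun y hy => hbI y (le_of_lt hy))
  by_cases hw : w ∈ spanBelow f f' I
  · have hkey : ∀ P : Fin n → Prop, IsLowerSet (I \ {x | x.1 = a ∧ P x.2}) →
        cnt (fun ξ : ι → F => (∀ x, ξ x ≠ 0 → r x = a ∧ P (s x)) ∧ pair e ξ w = 0) *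
          Fintype.card F =
        (Fintype.card F : ℚ) ^ rowSum (pos f f') a P * (1 + ((Fintype.card F : ℚ) - 1) *
          chi (w ∈ spanBelow f f' (I \ {x | x.1 = a ∧ P x.2}))) := by
      intro P hP
      have h1 := cnt_pair (fun x => ¬ (r x = a ∧ P (s x))) (fun x => e.repr w x)
      simp only [not_not] at h1
      rw [← h.pow_card_row, chi_congr (h.mem_spanBelow hP w),
        chi_congr (Q := ∀ x, r x = a ∧ P (s x) → e.repr w x = 0), ← h1]
      · congr 1
        refine cnt_congr fun ξ => ?_
        rw [pair_apply]
        exact and_congr_left fun _ => forall_congr' fun x => not_imp_comm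
      · rw [h.mem_spanBelow hI] at hw
        constructor
        · intro H x hx
          by_contra hne
          exact (H x hne).2 hx
        · intro H x hx
          exact ⟨hw x hx, fun hx' => hx (H x hx')⟩
    rw [chi_true hw, cnt_sub (fun ξ : ι → F => (∀ x, ξ x ≠ 0 → r x = a ∧ l ≤ s x) ∧
        pair e ξ w = 0) (fun ξ : ι → F => (∀ x, ξ x ≠ 0 → r x = a ∧ l < s x) ∧
        pair e ξ w = 0), sub_mul, hkey (l ≤ ·) hL1, hkey (l < ·) hL2]
    · ring
    · exact fun ξ hξ => ⟨fun x hx => ⟨(hξ.1 x hx).1, (hξ.1 x hx).2.le⟩, hξ.2⟩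
    · intro ξ
      rw [firstCol_iff]
      tauto
  · rw [chi_false hw, chi_false fun h1 => hw (spanBelow_mono f f' Set.sdiff_subset h1),
      chi_false fun h1 => hw (spanBelow_mono f f' Set.sdiff_subset h1)]
    simp [hw, cnt, chi_false]

end Counting

/-! ### Formulas for elementary moves and for sums of vectors -/

section Formulas

variable {F : Type} [Field F] {n d : ℕ}

open Module Submodule Classical

/-- The coefficient of an enlarging move in column `l`, in terms of the values `X J` for lower
sets `J`. -/
def upVal (q : ℚ) (A : Matrix (Fin n) (Fin n) ℤ) (a b l : Fin n) (I : Set (Fin n × Fin n))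
    (X : Set (Fin n × Fin n) → ℚ) : ℚ :=
  (q ^ rowSum A b (· ≤ l) - q ^ rowSum A b (· < l)) * X I +
    if (a, l) ∈ I ∧ (b, l) ∉ I then (q - 1) * q ^ rowSum A b (fun y => (b, y) ∈ I) *
      (X (I ∪ {x | x.1 = b ∧ x.2 ≤ l}) - X (I ∪ {x | x.1 = b ∧ x.2 < l})) else 0

/-- The coefficient of a diminishing move in column `l`, in terms of the values `X J` for lower
sets `J`. -/
def downVal (q : ℚ) (A : Matrix (Fin n) (Fin n) ℤ) (a b l : Fin n) (I : Set (Fin n × Fin n))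
    (X : Set (Fin n × Fin n) → ℚ) : ℚ :=
  if (a, l) ∈ I ∧ (b, l) ∉ I then
    q⁻¹ * ((q ^ rowSum A a (l ≤ ·) - q ^ rowSum A a (l < ·)) * X I +
      (q - 1) * (q ^ rowSum A a (l ≤ ·) * X (I \ {x | x.1 = a ∧ l ≤ x.2}) -
          q ^ rowSum A a (l < ·) * X (I \ {x | x.1 = a ∧ l < x.2})))
  else (q ^ rowSum A a (l ≤ ·) - q ^ rowSum A a (l < ·)) * X I

variable {f f' : PFlag F n d} {w : Fin d → F} {a b : Fin n} {I : Set (Fin n × Fin n)}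

/-- Sort the vectors `u` that generate the neighbours by the last column `l` of their support. This
column determines the change of `pos`, and the condition on `w` depends on whether `I` separates
`(a, l)` from `(b, l)`. -/
theorem Adapted.up_formula [Fintype F] {ι : Type} [Fintype ι] {e : Basis ι F (Fin d → F)}
    {r s : ι → Fin n} (h : Adapted f f' e r s) (hab : b.val = a.val + 1) (hI : IsLowerSet I)
    (B : Matrix (Fin n) (Fin n) ℤ) :
    ((Fintype.card F : ℚ) - 1) * ∑ g, chi (AdjUp b f g) *
        (chi (pos g f' = B) * chi (w ∈ spanBelow g f' I)) =
      ∑ l, chi (pos f f' = B - Matrix.single a l 1 + Matrix.single b l 1) *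
        upVal (Fintype.card F) (B - Matrix.single a l 1 + Matrix.single b l 1) a b l I
          fun J => chi (w ∈ spanBelow f f' J) := by
  -- The condition that `w` lies in the new subspace of `I`, rewritten in terms of the old flags and
  -- `u`.
  let Y : Fin n → (ι → F) → Prop := fun l u => if (a, l) ∈ I ∧ (b, l) ∉ I then
    ∃ c : F, ∀ x, (r x, s x) ∉ I → e.repr w x = c * u x else w ∈ spanBelow f f' I
  have hT : ∀ u : ι → F, (∀ x, u x ≠ 0 → r x = b) → u ≠ 0 →
      ∑ g with AdjUp b f g ∧ e.equivFun.symm u ∈ g.V b.castSucc,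
        (chi (pos g f' = B) * chi (w ∈ spanBelow g f' I)) =
      ∑ l, chi (LastCol r s b l u ∧ Y l u) *
        chi (pos f f' = B - Matrix.single a l 1 + Matrix.single b l 1) := by
    intro u hu hu0
    obtain ⟨x₁, hx₁⟩ := Function.ne_iff.1 hu0
    obtain ⟨x₀, hx₀, hmax⟩ := Finset.exists_max_image (Finset.univ.filter fun x => u x ≠ 0) s
      ⟨x₁, by simpa using hx₁⟩
    simp only [Finset.mem_filter, Finset.mem_univ, true_and] at hx₀ hmax
    obtain ⟨g, hg, hug⟩ := h.exists_adjUp hab hu hu0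
    rw [Finset.sum_eq_single g]
    · rw [Finset.sum_eq_single (s x₀)]
      · rw [mul_comm]
        congr 1
        · have hL : LastCol r s b (s x₀) u := ⟨fun x hx => ⟨hu x hx, hmax x hx⟩, x₀, hx₀, rfl⟩
          refine chi_congr ((?_ : _ ↔ Y (s x₀) u).trans (and_iff_right hL).symm)
          by_cases hc : (a, s x₀) ∈ I ∧ (b, s x₀) ∉ I
          · simp only [Y, if_pos hc]
            exact h.mem_spanBelow_up' hab hu hx₀ hmax hg hug hI hc.1 hc.2
          · simp only [Y, if_neg hc]
            exact h.mem_spanBelow_up hab hu hx₀ hmax hg hug hI (by tauto)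
        · rw [h.pos_up hab hu hx₀ hmax hg hug]
          refine chi_congr ⟨fun hB => ?_, fun hB => ?_⟩
          · rw [← hB]; abel
          · rw [hB]; abel
      · intro l _ hl
        rw [chi_false, zero_mul]
        rintro ⟨⟨h1, x, hx, hxl⟩, -⟩
        exact hl (le_antisymm (hxl ▸ hmax x hx) (h1 x₀ hx₀).2)
      · simp
    · intro g' hg' hne
      simp only [Finset.mem_filter, Finset.mem_univ, true_and] at hg'
      exact absurd (hg'.1.unique hg (h.vec_notMem hu hu0) hg'.2 hug) hne
    · intro hg'
      simp only [Finset.mem_filter, Finset.mem_univ, true_and, not_and] at hg'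
      exact absurd hug (hg' hg)
  rw [h.sum_up]
  have h1 : ∑ u : ι → F with (∀ x, u x ≠ 0 → r x = b) ∧ u ≠ 0,
        ∑ g with AdjUp b f g ∧ e.equivFun.symm u ∈ g.V b.castSucc,
          (chi (pos g f' = B) * chi (w ∈ spanBelow g f' I)) =
      ∑ u : ι → F, ∑ l, chi (LastCol r s b l u ∧ Y l u) *
        chi (pos f f' = B - Matrix.single a l 1 + Matrix.single b l 1) := by
    rw [Finset.sum_filter]
    refine Finset.sum_congr rfl fun u _ => ?_
    split_ifs with hu
    · exact hT u hu.1 hu.2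
    · refine (Finset.sum_eq_zero fun l _ => ?_).symm
      rw [chi_false, zero_mul]
      rintro ⟨⟨h1, x, hx, hxl⟩, -⟩
      exact hu ⟨fun x hx => (h1 x hx).1, by rintro rfl; exact hx rfl⟩
  rw [h1, Finset.sum_comm]
  refine Finset.sum_congr rfl fun l _ => ?_
  rw [← Finset.sum_mul, mul_comm]
  by_cases hA : pos f f' = B - Matrix.single a l 1 + Matrix.single b l 1
  · rw [← hA, chi_true rfl, one_mul, one_mul]
    change cnt (fun u : ι → F => LastCol r s b l u ∧ Y l u) = _
    by_cases hc : (a, l) ∈ I ∧ (b, l) ∉ I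
    · simp only [Y, upVal, if_pos hc]
      exact h.cnt_lastCol_vec hab hI hc.1 hc.2
    · simp only [Y, upVal, if_neg hc, add_zero]
      rw [← h.cnt_lastCol, cnt, cnt, Finset.sum_mul]
      exact Finset.sum_congr rfl fun u _ => chi_and _ _
  · rw [chi_false hA, zero_mul, zero_mul]

/-- The same argument with functionals, sorted by the first column of their support. -/
theorem Adapted.down_formula [Fintype F] {ι : Type} [Fintype ι] {e : Basis ι F (Fin d → F)}
    {r s : ι → Fin n} (h : Adapted f f' e r s) (hab : b.val = a.val + 1) (hI : IsLowerSet I)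
    (B : Matrix (Fin n) (Fin n) ℤ) :
    ((Fintype.card F : ℚ) - 1) * ∑ g, chi (AdjUp b g f) *
        (chi (pos g f' = B) * chi (w ∈ spanBelow g f' I)) =
      ∑ l, chi (pos f f' = B - Matrix.single b l 1 + Matrix.single a l 1) *
        downVal (Fintype.card F) (B - Matrix.single b l 1 + Matrix.single a l 1) a b l I
          fun J => chi (w ∈ spanBelow f f' J) := by
  have hq : (Fintype.card F : ℚ) ≠ 0 := Nat.cast_ne_zero.2 Fintype.card_ne_zero
  let Y : Fin n → (ι → F) → Prop := fun l u => if (a, l) ∈ I ∧ (b, l) ∉ I then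
    w ∈ spanBelow f f' I ∧ pair e u w = 0 else w ∈ spanBelow f f' I
  have hT : ∀ u : ι → F, (∀ x, u x ≠ 0 → r x = a) → u ≠ 0 →
      ∑ g with AdjUp b g f ∧ g.V b.castSucc ≤ LinearMap.ker (pair e u),
        (chi (pos g f' = B) * chi (w ∈ spanBelow g f' I)) =
      ∑ l, chi (FirstCol r s a l u ∧ Y l u) *
        chi (pos f f' = B - Matrix.single b l 1 + Matrix.single a l 1) := by
    intro u hu hu0
    obtain ⟨x₁, hx₁⟩ := Function.ne_iff.1 hu0
    obtain ⟨x₀, hx₀, hmin⟩ := Finset.exists_min_image (Finset.univ.filter fun x => u x ≠ 0) s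
      ⟨x₁, by simpa using hx₁⟩
    simp only [Finset.mem_filter, Finset.mem_univ, true_and] at hx₀ hmin
    obtain ⟨g, hg, hug⟩ := h.exists_adjDown hab hu hu0
    rw [Finset.sum_eq_single g]
    · rw [Finset.sum_eq_single (s x₀)]
      · rw [mul_comm]
        congr 1
        · have hL : FirstCol r s a (s x₀) u := ⟨fun x hx => ⟨hu x hx, hmin x hx⟩, x₀, hx₀, rfl⟩
          refine chi_congr ((?_ : _ ↔ Y (s x₀) u).trans (and_iff_right hL).symm)
          by_cases hc : (a, s x₀) ∈ I ∧ (b, s x₀) ∉ I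
          · simp only [Y, if_pos hc]
            exact h.mem_spanBelow_down' hab hu hx₀ hmin hg hug hI hc.1 hc.2
          · simp only [Y, if_neg hc]
            exact h.mem_spanBelow_down hab hu hx₀ hmin hg hug hI (by tauto)
        · rw [h.pos_down hab hu hx₀ hmin hg hug]
          refine chi_congr ⟨fun hB => ?_, fun hB => ?_⟩
          · rw [← hB]; abel
          · rw [hB]; abel
      · intro l _ hl
        rw [chi_false, zero_mul]
        rintro ⟨⟨h1, x, hx, hxl⟩, -⟩
        exact hl (le_antisymm (h1 x₀ hx₀).2 (hxl ▸ hmin x hx))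
      · simp
    · intro g' hg' hne
      simp only [Finset.mem_filter, Finset.mem_univ, true_and] at hg'
      obtain ⟨z, hz, hzn⟩ := exists_pair_ne_zero h hab hu hu0
      exact absurd (hg'.1.unique_down hg hz hzn hg'.2 hug) hne
    · intro hg'
      simp only [Finset.mem_filter, Finset.mem_univ, true_and, not_and] at hg'
      exact absurd hug (hg' hg)
  rw [h.sum_down hab]
  have h1 : ∑ u : ι → F with (∀ x, u x ≠ 0 → r x = a) ∧ u ≠ 0,
        ∑ g with AdjUp b g f ∧ g.V b.castSucc ≤ LinearMap.ker (pair e u),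
          (chi (pos g f' = B) * chi (w ∈ spanBelow g f' I)) =
      ∑ u : ι → F, ∑ l, chi (FirstCol r s a l u ∧ Y l u) *
        chi (pos f f' = B - Matrix.single b l 1 + Matrix.single a l 1) := by
    rw [Finset.sum_filter]
    refine Finset.sum_congr rfl fun u _ => ?_
    split_ifs with hu
    · exact hT u hu.1 hu.2
    · refine (Finset.sum_eq_zero fun l _ => ?_).symm
      rw [chi_false, zero_mul]
      rintro ⟨⟨h1, x, hx, hxl⟩, -⟩
      exact hu ⟨fun x hx => (h1 x hx).1, by rintro rfl; exact hx rfl⟩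
  rw [h1, Finset.sum_comm]
  refine Finset.sum_congr rfl fun l _ => ?_
  rw [← Finset.sum_mul, mul_comm]
  by_cases hA : pos f f' = B - Matrix.single b l 1 + Matrix.single a l 1
  · rw [← hA, chi_true rfl, one_mul, one_mul]
    change cnt (fun u : ι → F => FirstCol r s a l u ∧ Y l u) = _
    by_cases hc : (a, l) ∈ I ∧ (b, l) ∉ I
    · simp only [Y, downVal, if_pos hc]
      rw [← h.cnt_firstCol_vec hab hI hc.2]
      field_simp
    · simp only [Y, downVal, if_neg hc]
      rw [← h.cnt_firstCol, cnt, cnt, Finset.sum_mul]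
      exact Finset.sum_congr rfl fun u _ => chi_and _ _
  · rw [chi_false hA, zero_mul, zero_mul]

/-- The number of ways to write `w` as a sum of a vector of `V_k` and a vector of `spanBelow`. -/
theorem Adapted.sum_sub_mem [Fintype F] {ι : Type} [Fintype ι] {e : Basis ι F (Fin d → F)}
    {r s : ι → Fin n} (h : Adapted f f' e r s) (k : Fin (n + 1)) (hI : IsLowerSet I) :
    ∑ μ, chi (μ ∈ f.V k) * chi (w - μ ∈ spanBelow f f' I) =
      (Fintype.card F : ℚ) ^ (∑ i with i.val < k.val, rowSum (pos f f') i (fun y => (i, y) ∈ I)) *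
        chi (w ∈ spanBelow f f' (I ∪ {x | x.1.val < k.val})) := by
  have hL : IsLowerSet (I ∪ {x : Fin n × Fin n | x.1.val < k.val}) := by
    refine hI.union fun x y hyx (hx : x.1.val < k.val) => ?_
    exact (Fin.le_def.1 hyx.1).trans_lt hx
  rw [← Equiv.sum_comp e.equivFun.symm.toEquiv]
  simp only [LinearEquiv.coe_toEquiv, ← chi_and]
  rw [chi_congr (h.mem_spanBelow hL w)]
  -- The summand is supported in rows before `k` and agrees with `w` outside `I`; its free
  -- coordinates are those inside `I` in rows before `k`.
  have hiff : ∀ u, (e.equivFun.symm u ∈ f.V k ∧ w - e.equivFun.symm u ∈ spanBelow f f' I) ↔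
      (∀ x, u x ≠ 0 → (r x).val < k.val) ∧ ∀ x, (r x, s x) ∉ I → u x = e.repr w x := by
    intro u
    rw [h.mem_left, h.mem_spanBelow hI]
    refine and_congr (forall_congr' fun x => by rw [repr_equivFun_symm]) (forall_congr' fun x => ?_)
    rw [map_sub, Finsupp.sub_apply, repr_equivFun_symm, not_imp_comm,
      sub_eq_zero, eq_comm]
  simp only [hiff]
  change cnt _ = _
  by_cases hw : ∀ x, e.repr w x ≠ 0 → (r x, s x) ∈ I ∪ {x | x.1.val < k.val}
  · rw [chi_true hw, mul_one, cnt_congr (Q := fun u => ∀ x, ¬ ((r x).val < k.val ∧ (r x, s x) ∈ I) →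
      u x = (fun x => if (r x, s x) ∈ I then 0 else e.repr w x) x), cnt_agree]
    · simp only [not_not]
      rw [← zpow_natCast]
      congr 1
      rw [Nat.card_eq_fintype_card, Fintype.card_subtype,
        Finset.card_eq_sum_card_fiberwise (f := r) (t := Finset.univ.filter fun i => i.val < k.val)]
      · rw [Nat.cast_sum]
        refine Finset.sum_congr rfl fun i hi => ?_
        rw [← h.card_row, Nat.card_eq_fintype_card, Fintype.card_subtype, Finset.filter_filter]
        congr 2
        ext x
        simp only [Finset.mem_filter, Finset.mem_univ, true_and] at hi ⊢
        constructor
        · rintro ⟨⟨h1, h2⟩, rfl⟩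
          exact ⟨rfl, h2⟩
        · rintro ⟨rfl, h2⟩
          exact ⟨⟨hi, h2⟩, rfl⟩
      · intro x hx
        simpa using (by simpa using hx : _ ∧ _).1
    · intro u
      constructor
      · rintro ⟨h1, h2⟩ x hx
        dsimp only
        split_ifs with hxI
        · by_contra hne
          exact hx ⟨h1 x hne, hxI⟩
        · exact h2 x hxI
      · intro H
        refine ⟨fun x hx => ?_, fun x hx => ?_⟩
        · by_contra hlt
          have h1 := H x fun h1 => hlt h1.1
          by_cases hxI : (r x, s x) ∈ I
          · simp only [if_pos hxI] at h1
            exact hx h1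
          · simp only [if_neg hxI] at h1
            rcases hw x (h1 ▸ hx) with h2 | h2
            · exact hxI h2
            · exact hlt h2
        · rw [H x fun h1 => hx h1.2]
          simp [hx]
  · rw [chi_false hw, mul_zero]
    refine cnt_eq_zero ?_
    rintro u ⟨h1, h2⟩
    refine hw fun x hx => ?_
    by_cases hxI : (r x, s x) ∈ I
    · exact Or.inl hxI
    · refine Or.inr (h1 x ?_)
      rwa [h2 x hxI]

end Formulas

/-! ### Coefficients depending on `q` and `q ^ p` -/

/-- `q` as a unit of `ℚ` (with value `1` if `q = 0`). -/
def qUnit (q : ℕ) : ℚˣ := if h : (q : ℚ) ≠ 0 then Units.mk0 (q : ℚ) h else 1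

theorem val_qUnit {q : ℕ} (h : 2 ≤ q) : (qUnit q : ℚ) = q := by
  have : (q : ℚ) ≠ 0 := Nat.cast_ne_zero.2 (by omega)
  simp [qUnit, this]

/-- The value of a Laurent polynomial at `q`. -/
def evq (q : ℕ) : Aring →+* ℚ := LaurentPolynomial.eval₂ (Int.castRingHom ℚ) (qUnit q)

/-- The value of `G(T, t)` at `T = q` and `t = q ^ p`. -/
def ev2 (q p : ℕ) : Aring[T;T⁻¹] →+* ℚ := LaurentPolynomial.eval₂ (evq q) (qUnit q ^ (p : ℤ))

theorem evq_T {q : ℕ} (h : 2 ≤ q) (k : ℤ) : evq q (LaurentPolynomial.T k) = (q : ℚ) ^ k := by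
  simp [evq, LaurentPolynomial.eval₂_T, val_qUnit h]

theorem evq_toLaurent {q : ℕ} (h : 2 ≤ q) (P : Polynomial ℤ) :
    evq q (Polynomial.toLaurent P) = (P.eval (q : ℤ) : ℤ) := by
  rw [evq, LaurentPolynomial.eval₂_toLaurent, val_qUnit h, ← Int.cast_natCast (R := ℚ) q,
    Polynomial.eval₂_at_intCast]
  simp

theorem ev2_C (q p : ℕ) (g : Aring) : ev2 q p (LaurentPolynomial.C g) = evq q g := by
  simp [ev2]

theorem ev2_T {q : ℕ} (h : 2 ≤ q) (p : ℕ) (k : ℤ) :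
    ev2 q p (LaurentPolynomial.T k) = (q : ℚ) ^ (k * p) := by
  simp only [ev2, LaurentPolynomial.eval₂_T, ← zpow_mul, Units.val_zpow_eq_zpow_val, val_qUnit h]
  rw [mul_comm]

/-- The functions of the form `G(q, q ^ p) / D(q)` with a monic polynomial `D`. -/
def IsCoef (c : ℕ → ℕ → ℚ) : Prop :=
  ∃ (D : Polynomial ℤ) (G : Aring[T;T⁻¹]), D.Monic ∧ ∀ q : ℕ, 2 ≤ q → D.eval (q : ℤ) ≠ 0 ∧
    ∀ p, ((D.eval (q : ℤ) : ℤ) : ℚ) * c q p = ev2 q p G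

theorem ev2_C_toLaurent {q : ℕ} (h : 2 ≤ q) (p : ℕ) (P : Polynomial ℤ) :
    ev2 q p (LaurentPolynomial.C (Polynomial.toLaurent P)) = (P.eval (q : ℤ) : ℤ) := by
  rw [ev2_C, evq_toLaurent h]

namespace IsCoef

variable {c c' : ℕ → ℕ → ℚ}

theorem congr (hc : IsCoef c) (h : ∀ q, 2 ≤ q → ∀ p, c' q p = c q p) : IsCoef c' := by
  obtain ⟨D, G, hD, H⟩ := hc
  exact ⟨D, G, hD, fun q hq => ⟨(H q hq).1, fun p => by rw [h q hq p, (H q hq).2 p]⟩⟩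

theorem add (h : IsCoef c) (h' : IsCoef c') : IsCoef fun q p => c q p + c' q p := by
  obtain ⟨D, G, hD, H⟩ := h
  obtain ⟨D', G', hD', H'⟩ := h'
  refine ⟨D * D', LaurentPolynomial.C (Polynomial.toLaurent D') * G +
    LaurentPolynomial.C (Polynomial.toLaurent D) * G', hD.mul hD', fun q hq => ⟨?_, fun p => ?_⟩⟩
  · rw [Polynomial.eval_mul]
    exact mul_ne_zero (H q hq).1 (H' q hq).1
  · rw [map_add, map_mul, map_mul, ev2_C_toLaurent hq, ev2_C_toLaurent hq, ← (H q hq).2 p,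
      ← (H' q hq).2 p, Polynomial.eval_mul]
    push_cast
    ring

theorem mul (h : IsCoef c) (h' : IsCoef c') : IsCoef fun q p => c q p * c' q p := by
  obtain ⟨D, G, hD, H⟩ := h
  obtain ⟨D', G', hD', H'⟩ := h'
  refine ⟨D * D', G * G', hD.mul hD', fun q hq => ⟨?_, fun p => ?_⟩⟩
  · rw [Polynomial.eval_mul]
    exact mul_ne_zero (H q hq).1 (H' q hq).1
  · rw [map_mul, ← (H q hq).2 p, ← (H' q hq).2 p, Polynomial.eval_mul]
    push_cast
    ring

theorem pow (α β : ℤ) : IsCoef fun q p => (q : ℚ) ^ (α + β * p) := by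
  refine ⟨1, LaurentPolynomial.C (LaurentPolynomial.T α) * LaurentPolynomial.T β,
    Polynomial.monic_one, fun q hq => ⟨by simp, fun p => ?_⟩⟩
  rw [map_mul, ev2_C, evq_T hq, ev2_T hq, ← zpow_add₀ (Nat.cast_ne_zero.2 (by omega))]
  simp

theorem const (k : ℤ) : IsCoef fun _ _ => (k : ℚ) :=
  ⟨1, LaurentPolynomial.C (LaurentPolynomial.C k), Polynomial.monic_one, fun q _ =>
    ⟨by simp, fun p => by rw [ev2_C]; simp [evq]⟩⟩

theorem neg (h : IsCoef c) : IsCoef fun q p => - c q p :=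
  ((const (-1)).mul h).congr fun q _ p => by push_cast; ring

theorem sub (h : IsCoef c) (h' : IsCoef c') : IsCoef fun q p => c q p - c' q p :=
  (h.add h'.neg).congr fun q _ p => by ring

theorem one : IsCoef fun _ _ => 1 := (const 1).congr fun _ _ _ => by simp

theorem zero : IsCoef fun _ _ => 0 := (const 0).congr fun _ _ _ => by simp

/-- Inverting leading coefficients of moves only requires such denominators. They are monic, which
later permits division with remainder over `ℤ`. -/
theorem inv_pow_sub_one {k : ℕ} (hk : k ≠ 0) : IsCoef fun q _ => ((q : ℚ) ^ k - 1)⁻¹ := by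
  refine ⟨Polynomial.X ^ k - 1, 1, ?_, fun q hq => ?_⟩
  · simpa using Polynomial.monic_X_pow_sub_C (1 : ℤ) hk
  · have h1 : (1 : ℤ) < (q : ℤ) ^ k := one_lt_pow₀ (by exact_mod_cast hq) hk
    have h2 : ((q : ℚ) ^ k - 1) ≠ 0 := by
      have : (1 : ℚ) < (q : ℚ) ^ k := by exact_mod_cast h1
      exact sub_ne_zero.2 this.ne'
    refine ⟨?_, fun p => ?_⟩
    · simp only [Polynomial.eval_sub, Polynomial.eval_pow, Polynomial.eval_X, Polynomial.eval_one]
      omega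
    · simp only [Polynomial.eval_sub, Polynomial.eval_pow, Polynomial.eval_X, Polynomial.eval_one,
        Int.cast_sub, Int.cast_pow, Int.cast_natCast, Int.cast_one, map_one]
      exact mul_inv_cancel₀ h2

theorem sum {ι : Type*} (s : Finset ι) {f : ι → ℕ → ℕ → ℚ} (h : ∀ i ∈ s, IsCoef (f i)) :
    IsCoef fun q p => ∑ i ∈ s, f i q p := by
  classical
  induction s using Finset.induction_on with
  | empty => exact zero.congr fun _ _ _ => by simp
  | insert i s hi ih =>
    refine ((h i (by simp)).add (ih fun j hj => h j (by simp [hj]))).congr fun q _ p => ?_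
    rw [Finset.sum_insert hi]

end IsCoef

/-! ### Families of functions on triples -/

/-- The parameters of a family: a finite field, a shift `p` and a dimension `m`. -/
structure Pt where
  F : Type
  [field : Field F]
  [fin : Fintype F]
  p : ℕ
  m : ℕ

attribute [instance] Pt.field Pt.fin

/-- The order of the field. -/
def Pt.q (t : Pt) : ℕ := Fintype.card t.F

theorem Pt.two_le (t : Pt) : 2 ≤ t.q := Fintype.one_lt_card

/-- Families of functions on triples of two flags and a vector. -/
abbrev Fam (n : ℕ) : Type 1 :=
  ∀ t : Pt, PFlag t.F n t.m → PFlag t.F n t.m → (Fin t.m → t.F) → ℚ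

namespace Fam

variable {n : ℕ}

/-- The convolution product. -/
def conv (g h : Fam n) : Fam n := fun t f f' w =>
  ∑ f'', ∑ μ, g t f f'' μ * h t f'' f' (w - μ)

/-- Multiplication by a function of `q` and `p`. -/
def scal (c : ℕ → ℕ → ℚ) (h : Fam n) : Fam n := fun t f f' w => c t.q t.p * h t f f' w

/-- The anti-involution exchanging the flags. -/
def swap (h : Fam n) : Fam n := fun t f f' w => h t f' f w

theorem conv_add (g h h' : Fam n) : conv g (h + h') = conv g h + conv g h' := by
  funext t f f' w
  simp only [conv, Pi.add_apply, mul_add, Finset.sum_add_distrib]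

theorem add_conv (g g' h : Fam n) : conv (g + g') h = conv g h + conv g' h := by
  funext t f f' w
  simp only [conv, Pi.add_apply, add_mul, Finset.sum_add_distrib]

theorem conv_zero (g : Fam n) : conv g 0 = 0 := by
  funext t f f' w
  simp [conv]

theorem zero_conv (g : Fam n) : conv 0 g = 0 := by
  funext t f f' w
  simp [conv]

theorem conv_scal (c : ℕ → ℕ → ℚ) (g h : Fam n) : conv g (scal c h) = scal c (conv g h) := by
  funext t f f' w
  simp only [conv, scal, Finset.mul_sum]
  exact Finset.sum_congr rfl fun _ _ => Finset.sum_congr rfl fun _ _ => by ring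

theorem scal_conv (c : ℕ → ℕ → ℚ) (g h : Fam n) : conv (scal c g) h = scal c (conv g h) := by
  funext t f f' w
  simp only [conv, scal, Finset.mul_sum]
  exact Finset.sum_congr rfl fun _ _ => Finset.sum_congr rfl fun _ _ => by ring

theorem scal_add (c : ℕ → ℕ → ℚ) (g h : Fam n) : scal c (g + h) = scal c g + scal c h := by
  funext t f f' w
  simp only [scal, Pi.add_apply, mul_add]

theorem scal_scal (c c' : ℕ → ℕ → ℚ) (h : Fam n) :
    scal c (scal c' h) = scal (fun q p => c q p * c' q p) h := by
  funext t f f' w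
  simp only [scal, mul_assoc]

theorem scal_zero (c : ℕ → ℕ → ℚ) : scal c (0 : Fam n) = 0 := by
  funext t f f' w
  simp [scal]

/-- The substitution `μ ↦ w - μ` exchanges the roles of the two factors. -/
theorem swap_conv (g h : Fam n) : swap (conv g h) = conv (swap h) (swap g) := by
  funext t f f' w
  simp only [swap, conv]
  refine Finset.sum_congr rfl fun f'' _ => ?_
  rw [← Equiv.sum_comp (Equiv.subLeft w)]
  refine Finset.sum_congr rfl fun μ _ => ?_
  simp [mul_comm]

theorem conv_assoc (g h k : Fam n) : conv (conv g h) k = conv g (conv h k) := by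
  funext t f f' w
  simp only [conv, Finset.sum_mul, Finset.mul_sum]
  rw [Finset.sum_congr rfl fun f₂ _ => Finset.sum_comm, Finset.sum_comm]
  refine Finset.sum_congr rfl fun f₁ _ => ?_
  rw [Finset.sum_congr rfl fun f₂ _ => Finset.sum_comm, Finset.sum_comm]
  refine Finset.sum_congr rfl fun μ _ => ?_
  refine Finset.sum_congr rfl fun f₂ _ => ?_
  rw [← Equiv.sum_comp (Equiv.addRight μ)]
  refine Finset.sum_congr rfl fun ν _ => ?_
  simp only [Equiv.coe_addRight, add_sub_cancel_right, mul_assoc]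
  rw [show w - (ν + μ) = w - μ - ν by abel]

/-- The family of indicator functions of the conditions on the relative position and the
vector. -/
def phi (A : Matrix (Fin n) (Fin n) ℤ) (I : Set (Fin n × Fin n)) : Fam n := fun t f f' w =>
  chi (pos f f' = A + Matrix.diagonal fun _ => (t.p : ℤ)) * chi (w ∈ spanBelow f f' I)

theorem swap_phi (A : Matrix (Fin n) (Fin n) ℤ) (I : Set (Fin n × Fin n)) :
    swap (phi A I) = phi A.transpose (Prod.swap ⁻¹' I) := by
  funext t f f' w
  simp only [swap, phi]
  rw [spanBelow_swap f' f, pos_swap f f']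
  congr 1
  refine chi_congr ⟨fun h => ?_, fun h => ?_⟩
  · rw [← Matrix.transpose_transpose (pos f f'), h, Matrix.transpose_add,
      Matrix.diagonal_transpose]
  · rw [h, Matrix.transpose_add, Matrix.transpose_transpose, Matrix.diagonal_transpose]

theorem phi_eq_zero {A : Matrix (Fin n) (Fin n) ℤ} {I : Set (Fin n × Fin n)} {i j : Fin n}
    (hij : i ≠ j) (hA : A i j < 0) : phi A I = 0 := by
  funext t f f' w
  simp only [phi]
  rw [chi_false, zero_mul]
  · rfl
  · intro h
    have := pos_nonneg f f' i j
    rw [h, Matrix.add_apply, Matrix.diagonal_apply_ne _ hij] at this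
    omega

/-- The span of the functions `phi A I` with `A ∈ S`. -/
inductive InSpan (S : Set (Matrix (Fin n) (Fin n) ℤ)) : Fam n → Prop
  | zero : InSpan S 0
  | add (g h : Fam n) : InSpan S g → InSpan S h → InSpan S (g + h)
  | basis (c : ℕ → ℕ → ℚ) (A : Matrix (Fin n) (Fin n) ℤ) (I : Set (Fin n × Fin n)) :
      IsCoef c → A ∈ S → IsLowerSet I → InSpan S (scal c (phi A I))

namespace InSpan

variable {S S' : Set (Matrix (Fin n) (Fin n) ℤ)} {g h : Fam n}

theorem mono (hS : S ⊆ S') (hg : InSpan S g) : InSpan S' g := by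
  induction hg with
  | zero => exact zero
  | add _ _ _ _ h1 h2 => exact add _ _ h1 h2
  | basis c A I hc hA hI => exact basis c A I hc (hS hA) hI

theorem scal {c : ℕ → ℕ → ℚ} (hc : IsCoef c) (hg : InSpan S g) : InSpan S (Fam.scal c g) := by
  induction hg with
  | zero => rw [scal_zero]; exact zero
  | add _ _ _ _ h1 h2 => rw [scal_add]; exact add _ _ h1 h2
  | basis c' A I hc' hA hI => rw [scal_scal]; exact basis _ A I (hc.mul hc') hA hI

theorem sub (hg : InSpan S g) (hh : InSpan S h) : InSpan S (g - h) := by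
  have : g - h = g + Fam.scal (fun _ _ => ((-1 : ℤ) : ℚ)) h := by
    funext t f f' w
    simp [Fam.scal, sub_eq_add_neg]
  rw [this]
  exact add _ _ hg (hh.scal (IsCoef.const _))

theorem sum {ι : Type*} (s : Finset ι) {f : ι → Fam n} (h : ∀ i ∈ s, InSpan S (f i)) :
    InSpan S (∑ i ∈ s, f i) := by
  classical
  induction s using Finset.induction_on with
  | empty => exact zero
  | insert i s hi ih =>
    rw [Finset.sum_insert hi]
    exact add _ _ (h i (by simp)) (ih fun j hj => h j (by simp [hj]))

theorem phi {A : Matrix (Fin n) (Fin n) ℤ} {I : Set (Fin n × Fin n)} (hA : A ∈ S)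
    (hI : IsLowerSet I) : InSpan S (phi A I) := by
  have := basis (S := S) _ A I IsCoef.one hA hI
  have h1 : Fam.scal (fun _ _ => 1) (Fam.phi A I) = Fam.phi A I := by
    funext t f f' w
    simp [Fam.scal]
  rwa [h1] at this

end InSpan

end Fam

/-! ### Elementary moves of families -/

/-- The shift contributes `p` only if the diagonal column `b` is counted. Exponents are thus affine
in `p`, which is how `q ^ p` enters the coefficients. -/
theorem rowSum_add_diagonal {n : ℕ} (A : Matrix (Fin n) (Fin n) ℤ) (p : ℤ) (b : Fin n)
    (P : Fin n → Prop) : rowSum (A + Matrix.diagonal fun _ => p) b P =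
      rowSum A b P + (open Classical in if P b then 1 else 0) * p := by
  classical
  rw [rowSum, rowSum, Finset.sum_congr rfl fun y _ => Matrix.add_apply .., Finset.sum_add_distrib]
  congr 1
  rw [Finset.sum_congr rfl fun y _ => Matrix.diagonal_apply .., Finset.sum_ite_eq]
  by_cases h : P b <;> simp [h]

theorem IsCoef.rowSum {n : ℕ} (A : Matrix (Fin n) (Fin n) ℤ) (b : Fin n) (P : Fin n → Prop) :
    IsCoef fun q p => (q : ℚ) ^ rowSum (A + Matrix.diagonal fun _ => (p : ℤ)) b P :=
  (IsCoef.pow _ _).congr fun q _ p => by rw [rowSum_add_diagonal]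

theorem IsCoef.inv_sub_one : IsCoef fun q _ => ((q : ℚ) - 1)⁻¹ :=
  (IsCoef.inv_pow_sub_one one_ne_zero).congr fun q _ p => by rw [pow_one]

theorem IsCoef.natCast : IsCoef fun q _ => (q : ℚ) :=
  (IsCoef.pow 1 0).congr fun q _ p => by simp

theorem IsCoef.inv_natCast : IsCoef fun q _ => (q : ℚ)⁻¹ :=
  (IsCoef.pow (-1) 0).congr fun q _ p => by simp

namespace Fam

variable {n : ℕ}

/-- The families preserving the span of the functions `phi A I` by convolution from the left. -/
def Good (h : Fam n) : Prop := ∀ g, InSpan Set.univ g → InSpan Set.univ (conv h g)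

/-- The families preserving the span of the functions `phi A I` by convolution from the left and
from the right. -/
def Good2 (h : Fam n) : Prop := Good h ∧ Good (swap h)

theorem Good.of_phi {h : Fam n}
    (H : ∀ B I, IsLowerSet I → InSpan Set.univ (conv h (phi B I))) : Good h := by
  intro g hg
  induction hg with
  | zero => rw [conv_zero]; exact .zero
  | add _ _ _ _ h1 h2 => rw [conv_add]; exact .add _ _ h1 h2
  | basis c A I hc hA hI => rw [conv_scal]; exact (H A I hI).scal hc

theorem Good.zero : Good (0 : Fam n) := fun g _ => by rw [zero_conv]; exact .zero

theorem Good.add {h h' : Fam n} (H : Good h) (H' : Good h') : Good (h + h') := fun g hg => by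
  rw [add_conv]; exact .add _ _ (H g hg) (H' g hg)

theorem Good.scal {h : Fam n} {c : ℕ → ℕ → ℚ} (hc : IsCoef c) (H : Good h) :
    Good (Fam.scal c h) := fun g hg => by
  rw [scal_conv]; exact (H g hg).scal hc

theorem Good.conv {h h' : Fam n} (H : Good h) (H' : Good h') : Good (conv h h') := fun g hg => by
  rw [conv_assoc]; exact H _ (H' g hg)

theorem Good2.zero : Good2 (0 : Fam n) := ⟨Good.zero, Good.zero⟩

theorem Good2.add {h h' : Fam n} (H : Good2 h) (H' : Good2 h') : Good2 (h + h') :=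
  ⟨H.1.add H'.1, H.2.add H'.2⟩

theorem Good2.scal {h : Fam n} {c : ℕ → ℕ → ℚ} (hc : IsCoef c) (H : Good2 h) :
    Good2 (Fam.scal c h) := ⟨H.1.scal hc, H.2.scal hc⟩

theorem Good2.conv {h h' : Fam n} (H : Good2 h) (H' : Good2 h') : Good2 (conv h h') :=
  ⟨H.1.conv H'.1, by rw [swap_conv]; exact H'.2.conv H.2⟩

theorem Good2.swap {h : Fam n} (H : Good2 h) : Good2 (swap h) := ⟨H.2, H.1⟩

theorem Good2.sub {h h' : Fam n} (H : Good2 h) (H' : Good2 h') : Good2 (h - h') := by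
  have : h - h' = h + Fam.scal (fun _ _ => ((-1 : ℤ) : ℚ)) h' := by
    funext t f f' w
    simp [Fam.scal, sub_eq_add_neg]
  rw [this]
  exact H.add (H'.scal (IsCoef.const _))

theorem Good2.sum {ι : Type*} (s : Finset ι) {f : ι → Fam n} (h : ∀ i ∈ s, Good2 (f i)) :
    Good2 (∑ i ∈ s, f i) := by
  classical
  induction s using Finset.induction_on with
  | empty => exact Good2.zero
  | insert i s hi ih =>
    rw [Finset.sum_insert hi]
    exact Good2.add (h i (by simp)) (ih fun j hj => h j (by simp [hj]))

theorem Good2.of_inSpan {S : Set (Matrix (Fin n) (Fin n) ℤ)} {h : Fam n}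
    (H : ∀ A ∈ S, ∀ I, IsLowerSet I → Good2 (phi A I)) (hh : InSpan S h) : Good2 h := by
  induction hh with
  | zero => exact Good2.zero
  | add _ _ _ _ h1 h2 => exact h1.add h2
  | basis c A I hc hA hI => exact (H A hA I hI).scal hc

/-- The indicator function of the pairs of flags such that the second one is obtained from the
first one by enlarging the step in front of row `b` by one dimension. -/
def upE (b : Fin n) : Fam n := fun _ f f' w => chi (w = 0) * chi (AdjUp b f f')

/-- The indicator function of the pairs of flags such that the first one is obtained from the
second one by enlarging the step in front of row `b` by one dimension. -/
def downE (b : Fin n) : Fam n := swap (upE b)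

theorem conv_point (R : ∀ t : Pt, PFlag t.F n t.m → PFlag t.F n t.m → ℚ) (h : Fam n) (t : Pt)
    (f f' : PFlag t.F n t.m) (w : Fin t.m → t.F) :
    conv (fun t f f' w => chi (w = 0) * R t f f') h t f f' w = ∑ g, R t f g * h t g f' w := by
  simp only [conv]
  refine Finset.sum_congr rfl fun g _ => ?_
  rw [Finset.sum_eq_single 0]
  · rw [chi_true rfl, one_mul, sub_zero]
  · intro μ _ hμ
    rw [chi_false hμ, zero_mul, zero_mul]
  · simp

/-- The matrix obtained from `B` by moving a unit from `(a, l)` to `(b, l)`. -/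
def moved (B : Matrix (Fin n) (Fin n) ℤ) (a b l : Fin n) : Matrix (Fin n) (Fin n) ℤ :=
  B - Matrix.single a l 1 + Matrix.single b l 1

/-- The part of `conv (upE b) (phi B I)` coming from column `l`. -/
def upTerm (B : Matrix (Fin n) (Fin n) ℤ) (I : Set (Fin n × Fin n)) (a b l : Fin n) : Fam n :=
  fun t f f' w => ((t.q : ℚ) - 1)⁻¹ *
    (chi (pos f f' = moved B a b l + Matrix.diagonal fun _ => (t.p : ℤ)) *
      upVal t.q (moved B a b l + Matrix.diagonal fun _ => (t.p : ℤ)) a b l I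
        fun J => chi (w ∈ spanBelow f f' J))

/-- The part of `conv (downE b) (phi B I)` coming from column `l`. -/
def downTerm (B : Matrix (Fin n) (Fin n) ℤ) (I : Set (Fin n × Fin n)) (a b l : Fin n) : Fam n :=
  fun t f f' w => ((t.q : ℚ) - 1)⁻¹ *
    (chi (pos f f' = moved B b a l + Matrix.diagonal fun _ => (t.p : ℤ)) *
      downVal t.q (moved B b a l + Matrix.diagonal fun _ => (t.p : ℤ)) a b l I
        fun J => chi (w ∈ spanBelow f f' J))

variable {B : Matrix (Fin n) (Fin n) ℤ} {I : Set (Fin n × Fin n)} {a b : Fin n}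

theorem sub_one_ne_zero (t : Pt) : (t.q : ℚ) - 1 ≠ 0 := by
  have := t.two_le
  have : (1 : ℚ) < t.q := by exact_mod_cast this
  exact sub_ne_zero.2 this.ne'

theorem conv_upE (hab : b.val = a.val + 1) (hI : IsLowerSet I) :
    conv (upE b) (phi B I) = ∑ l, upTerm B I a b l := by
  funext t f f' w
  have h0 : upE b = fun t f g w => chi (w = 0) * chi (AdjUp b f g) := rfl
  rw [h0, conv_point (fun t f g => chi (AdjUp b f g)), Finset.sum_apply, Finset.sum_apply,
    Finset.sum_apply, Finset.sum_apply]
  obtain ⟨e, he⟩ := exists_adapted_basis f f'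
  have := he.up_formula (w := w) hab hI (B + Matrix.diagonal fun _ => (t.p : ℤ))
  rw [← mul_right_inj' (sub_one_ne_zero t), Finset.mul_sum Finset.univ (fun l => upTerm B I a b l t f f' w)]
  refine this.trans (Finset.sum_congr rfl fun l _ => ?_)
  rw [upTerm, mul_inv_cancel_left₀ (sub_one_ne_zero t), moved, Pt.q]
  rw [show B + Matrix.diagonal (fun _ => (t.p : ℤ)) - Matrix.single a l 1 + Matrix.single b l 1 =
    B - Matrix.single a l 1 + Matrix.single b l 1 + Matrix.diagonal (fun _ => (t.p : ℤ)) by abel]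

theorem conv_downE (hab : b.val = a.val + 1) (hI : IsLowerSet I) :
    conv (downE b) (phi B I) = ∑ l, downTerm B I a b l := by
  funext t f f' w
  have h0 : downE b = fun t f g w => chi (w = 0) * chi (AdjUp b g f) := rfl
  rw [h0, conv_point (fun t f g => chi (AdjUp b g f)), Finset.sum_apply, Finset.sum_apply,
    Finset.sum_apply, Finset.sum_apply]
  obtain ⟨e, he⟩ := exists_adapted_basis f f'
  have := he.down_formula (w := w) hab hI (B + Matrix.diagonal fun _ => (t.p : ℤ))
  rw [← mul_right_inj' (sub_one_ne_zero t), Finset.mul_sum Finset.univ (fun l => downTerm B I a b l t f f' w)]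
  refine this.trans (Finset.sum_congr rfl fun l _ => ?_)
  rw [downTerm, mul_inv_cancel_left₀ (sub_one_ne_zero t), moved, Pt.q]
  rw [show B + Matrix.diagonal (fun _ => (t.p : ℤ)) - Matrix.single b l 1 + Matrix.single a l 1 =
    B - Matrix.single b l 1 + Matrix.single a l 1 + Matrix.diagonal (fun _ => (t.p : ℤ)) by abel]

theorem upTerm_eq {l : Fin n} (h : ¬ ((a, l) ∈ I ∧ (b, l) ∉ I)) : upTerm B I a b l =
    scal (fun q p => ((q : ℚ) - 1)⁻¹ *
      ((q : ℚ) ^ rowSum (moved B a b l + Matrix.diagonal fun _ => (p : ℤ)) b (· ≤ l) -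
        (q : ℚ) ^ rowSum (moved B a b l + Matrix.diagonal fun _ => (p : ℤ)) b (· < l)))
      (phi (moved B a b l) I) := by
  funext t f f' w
  simp only [upTerm, upVal, scal, phi, if_neg h]
  ring

theorem downTerm_eq {l : Fin n} (h : ¬ ((a, l) ∈ I ∧ (b, l) ∉ I)) : downTerm B I a b l =
    scal (fun q p => ((q : ℚ) - 1)⁻¹ *
      ((q : ℚ) ^ rowSum (moved B b a l + Matrix.diagonal fun _ => (p : ℤ)) a (l ≤ ·) -
        (q : ℚ) ^ rowSum (moved B b a l + Matrix.diagonal fun _ => (p : ℤ)) a (l < ·)))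
      (phi (moved B b a l) I) := by
  funext t f f' w
  simp only [downTerm, downVal, scal, phi, if_neg h]
  ring

/-- Column `l` involves the single matrix `moved B a b l`, with at most three lower sets. Keeping
track of this matrix is what makes the induction on `spread` possible. -/
theorem inSpan_upTerm (hab : b.val = a.val + 1) (hI : IsLowerSet I) (l : Fin n) :
    InSpan {moved B a b l} (upTerm B I a b l) := by
  have hm := Set.mem_singleton (moved B a b l)
  have hc : ∀ A : Matrix (Fin n) (Fin n) ℤ, IsCoef fun q p => ((q : ℚ) - 1)⁻¹ *
      ((q : ℚ) ^ rowSum (A + Matrix.diagonal fun _ => (p : ℤ)) b (· ≤ l) -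
        (q : ℚ) ^ rowSum (A + Matrix.diagonal fun _ => (p : ℤ)) b (· < l)) := fun A =>
    IsCoef.inv_sub_one.mul ((IsCoef.rowSum A b _).sub (IsCoef.rowSum A b _))
  by_cases h : (a, l) ∈ I ∧ (b, l) ∉ I
  · have ha : ∀ y, y ≤ l → (a, y) ∈ I := fun y hy => hI (Prod.mk_le_mk.2 ⟨le_rfl, hy⟩) h.1
    have h1 := isLowerSet_union_row hab hI (· ≤ l) (fun y y' h1 h2 => h1.trans h2) ha
    have h2 := isLowerSet_union_row hab hI (· < l) (fun y y' h1 h2 => h1.trans_lt h2)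
      (fun y hy => ha y hy.le)
    have e : upTerm B I a b l = scal (fun q p => ((q : ℚ) - 1)⁻¹ *
      ((q : ℚ) ^ rowSum (moved B a b l + Matrix.diagonal fun _ => (p : ℤ)) b (· ≤ l) -
        (q : ℚ) ^ rowSum (moved B a b l + Matrix.diagonal fun _ => (p : ℤ)) b (· < l)))
      (phi (moved B a b l) I) + scal (fun q p =>
        (q : ℚ) ^ rowSum (moved B a b l + Matrix.diagonal fun _ => (p : ℤ)) b (fun y => (b, y) ∈ I))
        (phi (moved B a b l) (I ∪ {x | x.1 = b ∧ x.2 ≤ l}) -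
          phi (moved B a b l) (I ∪ {x | x.1 = b ∧ x.2 < l})) := by
      funext t f f' w
      simp only [upTerm, upVal, scal, phi, if_pos h, Pi.add_apply, Pi.sub_apply]
      field_simp [sub_one_ne_zero t]
    rw [e]
    exact .add _ _ ((InSpan.phi hm hI).scal (hc _))
      (((InSpan.phi hm h1).sub (InSpan.phi hm h2)).scal (IsCoef.rowSum _ _ _))
  · rw [upTerm_eq h]
    exact (InSpan.phi hm hI).scal (hc _)

theorem inSpan_downTerm (hab : b.val = a.val + 1) (hI : IsLowerSet I) (l : Fin n) :
    InSpan {moved B b a l} (downTerm B I a b l) := by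
  have hm := Set.mem_singleton (moved B b a l)
  have hc : ∀ A : Matrix (Fin n) (Fin n) ℤ, IsCoef fun q p => ((q : ℚ) - 1)⁻¹ *
      ((q : ℚ) ^ rowSum (A + Matrix.diagonal fun _ => (p : ℤ)) a (l ≤ ·) -
        (q : ℚ) ^ rowSum (A + Matrix.diagonal fun _ => (p : ℤ)) a (l < ·)) := fun A =>
    IsCoef.inv_sub_one.mul ((IsCoef.rowSum A a _).sub (IsCoef.rowSum A a _))
  by_cases h : (a, l) ∈ I ∧ (b, l) ∉ I
  · have hb : ∀ y, l ≤ y → (b, y) ∉ I := fun y hy hyI =>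
      h.2 (hI (Prod.mk_le_mk.2 ⟨le_rfl, hy⟩) hyI)
    have h1 := isLowerSet_diff_row hab hI (l ≤ ·) (fun y y' h1 h2 => h2.trans h1) hb
    have h2 := isLowerSet_diff_row hab hI (l < ·) (fun y y' h1 h2 => h2.trans_le h1)
      (fun y hy => hb y hy.le)
    have e : downTerm B I a b l = scal (fun q _ => (q : ℚ)⁻¹) (scal (fun q p => ((q : ℚ) - 1)⁻¹ *
      ((q : ℚ) ^ rowSum (moved B b a l + Matrix.diagonal fun _ => (p : ℤ)) a (l ≤ ·) -
        (q : ℚ) ^ rowSum (moved B b a l + Matrix.diagonal fun _ => (p : ℤ)) a (l < ·)))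
      (phi (moved B b a l) I) +
        (scal (fun q p =>
          (q : ℚ) ^ rowSum (moved B b a l + Matrix.diagonal fun _ => (p : ℤ)) a (l ≤ ·))
          (phi (moved B b a l) (I \ {x | x.1 = a ∧ l ≤ x.2})) -
        scal (fun q p =>
          (q : ℚ) ^ rowSum (moved B b a l + Matrix.diagonal fun _ => (p : ℤ)) a (l < ·))
          (phi (moved B b a l) (I \ {x | x.1 = a ∧ l < x.2})))) := by
      funext t f f' w
      simp only [downTerm, downVal, scal, phi, if_pos h, Pi.add_apply, Pi.sub_apply]
      field_simp [sub_one_ne_zero t]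
    rw [e]
    exact (InSpan.add _ _ ((InSpan.phi hm hI).scal (hc _))
      (((InSpan.phi hm h1).scal (IsCoef.rowSum _ _ _)).sub
        ((InSpan.phi hm h2).scal (IsCoef.rowSum _ _ _)))).scal IsCoef.inv_natCast
  · rw [downTerm_eq h]
    exact (InSpan.phi hm hI).scal (hc _)

theorem good2_upE (hab : b.val = a.val + 1) : Good2 (upE b) :=
  ⟨Good.of_phi fun B I hI => by
    rw [conv_upE hab hI]
    exact .sum _ fun l _ => (inSpan_upTerm hab hI l).mono (Set.subset_univ _),
  Good.of_phi fun B I hI => by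
    rw [← downE, conv_downE hab hI]
    exact .sum _ fun l _ => (inSpan_downTerm hab hI l).mono (Set.subset_univ _)⟩

end Fam

/-! ### Diagonal matrices -/

section

variable {F : Type} [Field F] {n d : ℕ}

/-- With only diagonal positions occupied, the row and column gradings of an adapted basis coincide.
-/
theorem eq_of_pos_offdiag {f g : PFlag F n d} (h : ∀ i j, i ≠ j → pos f g i j = 0) : f = g := by
  obtain ⟨e, he⟩ := exists_adapted_basis f g
  have key : ∀ x : Σ i : Fin n, Σ j : Fin n, Fin (pos f g i j).toNat, x.1 = x.2.1 := by
    rintro ⟨i, j, x⟩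
    by_contra hij
    have := x.2
    have h0 := h i j hij
    omega
  refine PFlag.ext fun k => ?_
  rw [he.left, he.right]
  simp only [key]

theorem pos_self_offdiag (f : PFlag F n d) {i j : Fin n} (hij : i ≠ j) : pos f f i j = 0 := by
  wlog h : i < j generalizing i j
  · rw [pos_swap, Matrix.transpose_apply]
    exact this hij.symm (lt_of_le_of_ne (not_lt.1 h) hij.symm)
  have h1 : i.succ ≤ j.castSucc := by
    rw [Fin.le_def, Fin.val_succ, Fin.val_castSucc]; exact h
  have h2 := Fin.castSucc_le_succ i
  have h3 := Fin.castSucc_le_succ j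
  rw [pos_apply, inf_eq_left.2 (f.mono (h1.trans h3)), inf_eq_left.2 (f.mono h1),
    inf_eq_left.2 (f.mono (h2.trans (h1.trans h3))), inf_eq_left.2 (f.mono (h2.trans h1))]
  ring

theorem pos_self_diag (f : PFlag F n d) (i : Fin n) :
    pos f f i i = (Module.finrank F (f.V i.succ) : ℤ) - Module.finrank F (f.V i.castSucc) := by
  rw [← sum_pos_row f f, Finset.sum_eq_single i]
  · exact fun j _ hj => pos_self_offdiag f hj.symm
  · simp

/-- The last diagonal position in `I` gives the subspace, since `V_x ∩ V_y` is the smaller of the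
two. The index `r` depends neither on the field nor on the flag, so one formula serves all
parameters. -/
theorem exists_spanBelow_self {n : ℕ} (I : Set (Fin n × Fin n)) (hI : IsLowerSet I) :
    ∃ r : Fin (n + 1), ∀ {F : Type} [Field F] {d : ℕ} (f : PFlag F n d), spanBelow f f I = f.V r := by
  classical
  by_cases h : ∃ i, (i, i) ∈ I
  · obtain ⟨i, hi, hmax⟩ := Finset.exists_max_image (Finset.univ.filter fun i => (i, i) ∈ I) id
      (by obtain ⟨i, hi⟩ := h; exact ⟨i, by simpa using hi⟩)
    simp only [Finset.mem_filter, Finset.mem_univ, true_and, id] at hi hmax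
    refine ⟨i.succ, fun {F} _ {d} f => le_antisymm (iSup₂_le fun x hx => ?_) ?_⟩
    · rcases le_total x.1 x.2 with h' | h'
      · exact inf_le_left.trans (f.mono (Fin.succ_le_succ_iff.2
          (hmax x.1 (hI (Prod.mk_le_mk.2 ⟨le_rfl, h'⟩) hx))))
      · exact inf_le_right.trans (f.mono (Fin.succ_le_succ_iff.2
          (hmax x.2 (hI (Prod.mk_le_mk.2 ⟨h', le_rfl⟩) hx))))
    · have := le_iSup₂_of_le (f := fun (y : Fin n × Fin n) (_ : y ∈ I) =>
        f.V y.1.succ ⊓ f.V y.2.succ) (i, i) hi le_rfl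
      rwa [inf_idem] at this
  · refine ⟨0, fun {F} _ {d} f => ?_⟩
    rw [f.zero, eq_bot_iff]
    refine iSup₂_le fun x hx => ?_
    refine (h ⟨min x.1 x.2, hI (Prod.mk_le_mk.2 ⟨min_le_left _ _, min_le_right _ _⟩) hx⟩).elim

end

namespace Fam

variable {n : ℕ}

/-- A diagonal position forces the middle flag to be `f`, the condition on `μ` becomes `μ ∈ f.V r`,
and `Adapted.sum_sub_mem` counts the `μ`. Whether `f` has position `D + p` relative to itself is
decided by the row sums of `B`; the shift cancels. -/
theorem good_phi_diagonal {D : Matrix (Fin n) (Fin n) ℤ} (hD : ∀ i j, i ≠ j → D i j = 0)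
    {I : Set (Fin n × Fin n)} (hI : IsLowerSet I) : Good (phi D I) := by
  classical
  obtain ⟨r, hr⟩ := exists_spanBelow_self I hI
  have hdiag : ∀ (t : Pt) (f g : PFlag t.F n t.m),
      pos f g = D + Matrix.diagonal (fun _ => (t.p : ℤ)) → f = g := fun t f g h =>
    eq_of_pos_offdiag fun i j hij => by
      rw [h, Matrix.add_apply, hD i j hij, Matrix.diagonal_apply_ne _ hij, add_zero]
  refine Good.of_phi fun B J hJ => ?_
  have e : conv (phi D I) (phi B J) = scal (fun q p =>
      (((if ∀ i, ∑ j, B i j = D i i then 1 else 0 : ℤ)) : ℚ) *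
        (q : ℚ) ^ (∑ i with i.val < r.val,
          rowSum (B + Matrix.diagonal fun _ => (p : ℤ)) i (fun y => (i, y) ∈ J)))
      (phi B (J ∪ {x | x.1.val < r.val})) := by
    funext t f f' w
    simp only [conv, scal]
    rw [Finset.sum_eq_single f]
    rotate_left
    · intro g _ hg
      refine Finset.sum_eq_zero fun μ _ => ?_
      rw [phi, chi_false fun h => hg (hdiag t f g h).symm, zero_mul, zero_mul]
    · simp
    by_cases h : pos f f' = B + Matrix.diagonal fun _ => (t.p : ℤ)
    · obtain ⟨b, hb⟩ := exists_adapted_basis f f'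
      have h1 := hb.sum_sub_mem (w := w) r hJ
      have h2 : chi (pos f f = D + Matrix.diagonal fun _ => (t.p : ℤ)) =
          ((if ∀ i, ∑ j, B i j = D i i then 1 else 0 : ℤ) : ℚ) := by
        have hrow : ∀ i, pos f f i i = ∑ j, B i j + t.p := fun i => by
          rw [pos_self_diag, ← sum_pos_row f f', h,
            Finset.sum_congr rfl fun j _ => Matrix.add_apply .., Finset.sum_add_distrib,
            Finset.sum_congr rfl fun y _ => Matrix.diagonal_apply .., Finset.sum_ite_eq]
          simp
        by_cases h3 : ∀ i, ∑ j, B i j = D i i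
        · rw [if_pos h3, chi_true, Int.cast_one]
          ext i j
          rw [Matrix.add_apply]
          rcases eq_or_ne i j with rfl | hij
          · rw [hrow, h3, Matrix.diagonal_apply_eq]
          · rw [pos_self_offdiag f hij, hD i j hij, Matrix.diagonal_apply_ne _ hij, add_zero]
        · rw [if_neg h3, chi_false, Int.cast_zero]
          refine fun h4 => h3 fun i => ?_
          have := hrow i
          rw [h4, Matrix.add_apply, Matrix.diagonal_apply_eq] at this
          omega
      rw [h] at h1
      simp only [phi, h2, hr, chi_true h, one_mul]
      rw [mul_assoc, Pt.q, ← h1, Finset.mul_sum]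
      exact Finset.sum_congr rfl fun μ _ => by ring
    · simp only [phi, chi_false h, zero_mul, mul_zero, Finset.sum_const_zero]
  rw [e]
  refine (InSpan.phi (Set.mem_univ _) ?_).scal ((IsCoef.const _).mul ?_)
  · refine hJ.union fun x y hyx (hx : x.1.val < r.val) => ?_
    exact (Fin.le_def.1 hyx.1).trans_lt hx
  · refine (IsCoef.pow (∑ i with i.val < r.val, rowSum B i (fun y => (i, y) ∈ J))
      (∑ i with i.val < r.val, if (i, i) ∈ J then 1 else 0)).congr fun q _ p => ?_
    rw [Finset.sum_mul, ← Finset.sum_add_distrib]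
    congr 1
    refine Finset.sum_congr rfl fun i _ => ?_
    rw [rowSum_add_diagonal]

theorem good2_phi_diagonal {D : Matrix (Fin n) (Fin n) ℤ} (hD : ∀ i j, i ≠ j → D i j = 0)
    {I : Set (Fin n × Fin n)} (hI : IsLowerSet I) : Good2 (phi D I) := by
  refine ⟨good_phi_diagonal hD hI, ?_⟩
  rw [swap_phi]
  exact good_phi_diagonal (fun i j hij => hD j i hij.symm)
    fun x y hyx hx => hI (Prod.swap_le_swap.2 hyx) hx

/-! ### Reduction to the elementary moves -/

/-- A measure of the distance of a matrix from the diagonal matrices. -/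
def spread (A : Matrix (Fin n) (Fin n) ℤ) : ℤ := ∑ i, ∑ j, ((i.val : ℤ) - j.val) ^ 2 * A i j

theorem spread_transpose (A : Matrix (Fin n) (Fin n) ℤ) : spread A.transpose = spread A := by
  rw [spread, Finset.sum_comm]
  refine Finset.sum_congr rfl fun i _ => Finset.sum_congr rfl fun j _ => ?_
  rw [Matrix.transpose_apply]
  ring

theorem spread_moved (A : Matrix (Fin n) (Fin n) ℤ) (a b l : Fin n) : spread (moved A a b l) =
    spread A - ((a.val : ℤ) - l.val) ^ 2 + ((b.val : ℤ) - l.val) ^ 2 := by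
  have h : ∀ a : Fin n, ∑ i, ∑ j, ((i.val : ℤ) - j.val) ^ 2 * Matrix.single a l (1 : ℤ) i j =
      ((a.val : ℤ) - l.val) ^ 2 := fun a => by
    rw [Finset.sum_eq_single a, Finset.sum_eq_single l]
    · simp
    · intro j _ hj
      simp [hj.symm]
    · simp
    · intro i _ hi
      refine Finset.sum_eq_zero fun j _ => ?_
      simp [hi.symm]
    · simp
  rw [← h a, ← h b, spread, spread, ← Finset.sum_sub_distrib, ← Finset.sum_add_distrib]
  refine Finset.sum_congr rfl fun i _ => ?_
  rw [← Finset.sum_sub_distrib, ← Finset.sum_add_distrib]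
  refine Finset.sum_congr rfl fun j _ => ?_
  rw [moved, Matrix.add_apply, Matrix.sub_apply]
  ring

theorem moved_moved (A : Matrix (Fin n) (Fin n) ℤ) (a b l : Fin n) :
    moved (moved A b a l) a b l = A := by
  rw [moved, moved]
  abel

theorem rowSum_le_eq (A : Matrix (Fin n) (Fin n) ℤ) (b l : Fin n) :
    rowSum A b (· ≤ l) = rowSum A b (· < l) + A b l := by
  classical
  rw [rowSum, rowSum, ← Finset.sum_filter_add_sum_filter_not _ (fun y => y < l),
    Finset.filter_filter, Finset.filter_filter]
  congr 1
  · refine Finset.sum_congr ?_ fun _ _ => rfl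
    ext y
    simp only [Finset.mem_filter, Finset.mem_univ, true_and]
    exact ⟨fun h => h.2, fun h => ⟨h.le, h⟩⟩
  · rw [← Finset.sum_singleton (fun y => A b y) l]
    refine Finset.sum_congr ?_ fun _ _ => rfl
    ext y
    simp only [Finset.mem_filter, Finset.mem_univ, true_and, Finset.mem_singleton]
    exact ⟨fun h => le_antisymm h.1 (not_lt.1 h.2), fun h => ⟨h.le, h.not_lt⟩⟩

theorem rowSum_ge_eq (A : Matrix (Fin n) (Fin n) ℤ) (b l : Fin n) :
    rowSum A b (l ≤ ·) = rowSum A b (l < ·) + A b l := by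
  classical
  rw [rowSum, rowSum, ← Finset.sum_filter_add_sum_filter_not _ (fun y => l < y),
    Finset.filter_filter, Finset.filter_filter]
  congr 1
  · refine Finset.sum_congr ?_ fun _ _ => rfl
    ext y
    simp only [Finset.mem_filter, Finset.mem_univ, true_and]
    exact ⟨fun h => h.2, fun h => ⟨h.le, h⟩⟩
  · rw [← Finset.sum_singleton (fun y => A b y) l]
    refine Finset.sum_congr ?_ fun _ _ => rfl
    ext y
    simp only [Finset.mem_filter, Finset.mem_univ, true_and, Finset.mem_singleton]
    exact ⟨fun h => le_antisymm (not_lt.1 h.2) h.1, fun h => ⟨h.ge, h.not_gt⟩⟩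

/-- The leading coefficient of an elementary move is invertible. -/
theorem exists_inv_leading {x k : ℤ} (hk : 0 < k) : ∃ c : ℕ → ℕ → ℚ, IsCoef c ∧
    ∀ q p, 2 ≤ q → c q p * (((q : ℚ) - 1)⁻¹ * ((q : ℚ) ^ (x + k) - (q : ℚ) ^ x)) = 1 := by
  lift k to ℕ using hk.le
  have hk0 : k ≠ 0 := by omega
  refine ⟨fun q _ => ((q : ℚ) - 1) * (q : ℚ) ^ (-x) * ((q : ℚ) ^ k - 1)⁻¹,
    ((IsCoef.natCast.sub IsCoef.one).mul ((IsCoef.pow (-x) 0).congr fun q _ p => by simp)).mul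
      (IsCoef.inv_pow_sub_one hk0), fun q p hq => ?_⟩
  have h0 : (q : ℚ) ≠ 0 := Nat.cast_ne_zero.2 (by omega)
  have h1 : (1 : ℚ) < q := by exact_mod_cast hq
  have h2 : (1 : ℚ) < (q : ℚ) ^ k := one_lt_pow₀ h1 hk0
  have h3 : (q : ℚ) - 1 ≠ 0 := sub_ne_zero.2 h1.ne'
  have h4 : (q : ℚ) ^ k - 1 ≠ 0 := sub_ne_zero.2 h2.ne'
  have h5 : (q : ℚ) ^ x ≠ 0 := zpow_ne_zero _ h0
  simp only [zpow_add₀ h0, zpow_natCast, zpow_neg]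
  field_simp

theorem eq_scal_sub {g h : Fam n} {c c' : ℕ → ℕ → ℚ} {s : Fam n}
    (hc : ∀ q p, 2 ≤ q → c q p * c' q p = 1) (h1 : g = s + Fam.scal c' h) :
    h = Fam.scal c (g - s) := by
  funext t f f' w
  simp only [h1, Fam.scal, Pi.sub_apply, Pi.add_apply, add_sub_cancel_left]
  rw [← mul_assoc, hc _ _ t.two_le, one_mul]

/-- Let `B` be `A` with a unit moved from `(b, l)` to `(a, l)`, and solve the expansion of `conv
(upE b) (phi B I)` for the term of column `l`. Since `(b, l) ∈ I`, this term is a multiple of `phi A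
I` alone; its coefficient is invertible, as `A b l > 0` and the diagonal column `b` is not among the
columns `≤ l`. Columns after `l` give matrices of smaller spread; columns before `l` give a negative
off-diagonal entry, by the choice of `l`, hence zero. -/
theorem good2_phi_of_mem {A : Matrix (Fin n) (Fin n) ℤ} {I : Set (Fin n × Fin n)} {b l : Fin n}
    (hI : IsLowerSet I) (hlb : l < b) (hA : 0 < A b l) (hmem : (b, l) ∈ I)
    (hmin : ∀ i j, j < i → 0 < A i j → l ≤ j)
    (ih : ∀ A' : Matrix (Fin n) (Fin n) ℤ, spread A' < spread A → ∀ J, IsLowerSet J →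
      Good2 (phi A' J)) : Good2 (phi A I) := by
  have hb : 0 < b.val := (Nat.zero_le _).trans_lt hlb
  let a : Fin n := ⟨b.val - 1, by omega⟩
  have hab : b.val = a.val + 1 := by simp only [a]; omega
  have hne : a ≠ b := fun h => by rw [h] at hab; omega
  have hla : l.val ≤ a.val := by have := Fin.lt_def.1 hlb; omega
  have hconv := conv_upE (B := moved A b a l) hab hI
  rw [← Finset.sum_erase_add _ _ (Finset.mem_univ l), upTerm_eq (fun h => h.2 hmem),
    moved_moved] at hconv
  obtain ⟨c, hc, hcc⟩ := exists_inv_leading (x := rowSum A b (· < l)) hA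
  rw [eq_scal_sub (c := c) (fun q p hq => ?_) hconv]
  · refine Good2.scal hc (Good2.sub ((good2_upE hab).conv (ih _ ?_ I hI)) (Good2.sum _ fun l' hl' => ?_))
    · rw [spread_moved, hab]
      push_cast
      nlinarith
    · refine Good2.of_inSpan ?_ (inSpan_upTerm hab hI l')
      rintro _ rfl J hJ
      have hl := (Finset.mem_erase.1 hl').1
      rcases lt_or_gt_of_ne hl with h | h
      · have hla' : l'.val < a.val := (Fin.lt_def.1 h).trans_le hla
        have hla'' : a ≠ l' := fun h => by rw [h] at hla'; omega
        have h1 : A a l' ≤ 0 := not_lt.1 fun h2 => absurd (hmin a l' hla' h2) (not_le.2 h)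
        rw [phi_eq_zero hla'']
        · exact Good2.zero
        · simp only [moved, Matrix.add_apply, Matrix.sub_apply, Matrix.single_apply]
          simp [hl.symm, hne.symm]
          omega
      · refine ih _ ?_ J hJ
        rw [spread_moved, spread_moved, hab]
        push_cast
        have := Fin.lt_def.1 h
        nlinarith
  · rw [rowSum_add_diagonal, rowSum_add_diagonal, if_neg (not_le.2 hlb), if_neg hlb.not_gt,
      rowSum_le_eq, zero_mul, add_zero, add_zero]
    exact hcc q p hq

/-- The counterpart with `downE`, above the diagonal and with `l` the last occupied column. Here
`(a, l) ∉ I` ensures that `I` does not separate the two positions. -/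
theorem good2_phi_of_not_mem {A : Matrix (Fin n) (Fin n) ℤ} {I : Set (Fin n × Fin n)}
    {a l : Fin n} (hI : IsLowerSet I) (hal : a < l) (hA : 0 < A a l) (hmem : (a, l) ∉ I)
    (hmax : ∀ i j, i < j → 0 < A i j → j ≤ l)
    (ih : ∀ A' : Matrix (Fin n) (Fin n) ℤ, spread A' < spread A → ∀ J, IsLowerSet J →
      Good2 (phi A' J)) : Good2 (phi A I) := by
  have hl0 := Fin.lt_def.1 hal
  let b : Fin n := ⟨a.val + 1, by omega⟩
  have hab : b.val = a.val + 1 := rfl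
  have hne : a ≠ b := fun h => by rw [← h] at hab; omega
  have hconv := conv_downE (B := moved A a b l) hab hI
  rw [← Finset.sum_erase_add _ _ (Finset.mem_univ l), downTerm_eq (fun h => hmem h.1),
    moved_moved] at hconv
  obtain ⟨c, hc, hcc⟩ := exists_inv_leading (x := rowSum A a (l < ·)) hA
  rw [eq_scal_sub (c := c) (fun q p hq => ?_) hconv]
  · refine Good2.scal hc (Good2.sub ((good2_upE hab).swap.conv (ih _ ?_ I hI))
      (Good2.sum _ fun l' hl' => ?_))
    · rw [spread_moved, hab]
      push_cast
      nlinarith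
    · refine Good2.of_inSpan ?_ (inSpan_downTerm hab hI l')
      rintro _ rfl J hJ
      have hl := (Finset.mem_erase.1 hl').1
      rcases lt_or_gt_of_ne hl with h | h
      · refine ih _ ?_ J hJ
        rw [spread_moved, spread_moved, hab]
        push_cast
        have := Fin.lt_def.1 h
        nlinarith
      · have hlb' : b.val < l'.val := by have := Fin.lt_def.1 h; omega
        have hlb'' : b ≠ l' := fun h => by rw [h] at hlb'; omega
        have h1 : A b l' ≤ 0 := not_lt.1 fun h2 => absurd (hmax b l' hlb' h2) (not_le.2 h)
        rw [phi_eq_zero hlb'']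
        · exact Good2.zero
        · simp only [moved, Matrix.add_apply, Matrix.sub_apply, Matrix.single_apply]
          simp [hl.symm, hne]
          omega
  · rw [rowSum_add_diagonal, rowSum_add_diagonal, if_neg (not_le.2 hal), if_neg hal.not_gt,
      rowSum_ge_eq, zero_mul, add_zero, add_zero]
    exact hcc q p hq

theorem isLowerSet_swap {I : Set (Fin n × Fin n)} (hI : IsLowerSet I) :
    IsLowerSet (Prod.swap ⁻¹' I) := fun _ _ hyx hx => hI (Prod.swap_le_swap.2 hyx) hx

theorem good2_phi_transpose {A : Matrix (Fin n) (Fin n) ℤ} {I : Set (Fin n × Fin n)}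
    (h : Good2 (phi A.transpose (Prod.swap ⁻¹' I))) : Good2 (phi A I) := by
  have := h.swap
  rwa [swap_phi, Matrix.transpose_transpose, ← Set.preimage_comp, Prod.swap_swap_eq,
    Set.preimage_id] at this

/-- Among the positive entries below the diagonal take `(i₀, j₀)` in the first column and `(i₁, j₁)`
in the last row, so that `(i₀, j₀) ≤ (i₁, j₁)`. Either `(i₀, j₀) ∈ I`, and an upward move applies,
or `(i₁, j₁) ∉ I`, and a downward move applies after transposition. -/
theorem good2_phi_of_lower {A : Matrix (Fin n) (Fin n) ℤ} (hA : ∃ i j, j < i ∧ 0 < A i j)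
    (ih : ∀ A' : Matrix (Fin n) (Fin n) ℤ, spread A' < spread A → ∀ J, IsLowerSet J →
      Good2 (phi A' J)) {I : Set (Fin n × Fin n)} (hI : IsLowerSet I) : Good2 (phi A I) := by
  classical
  have hS : (Finset.univ.filter fun x : Fin n × Fin n => x.2 < x.1 ∧ 0 < A x.1 x.2).Nonempty := by
    obtain ⟨i, j, h⟩ := hA
    exact ⟨(i, j), by simpa using h⟩
  obtain ⟨⟨i₀, j₀⟩, h0, hmin⟩ := Finset.exists_min_image _ Prod.snd hS
  obtain ⟨⟨i₁, j₁⟩, h1, hmax⟩ := Finset.exists_max_image _ Prod.fst hS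
  simp only [Finset.mem_filter, Finset.mem_univ, true_and, Prod.forall] at h0 h1 hmin hmax
  by_cases hI0 : (i₀, j₀) ∈ I
  · exact good2_phi_of_mem hI h0.1 h0.2 hI0 (fun i j hij hp => hmin i j ⟨hij, hp⟩) ih
  · refine good2_phi_transpose (good2_phi_of_not_mem (a := j₁) (l := i₁) (isLowerSet_swap hI) h1.1
      h1.2 (fun h => hI0 (hI (Prod.mk_le_mk.2 ⟨hmax _ _ h0, hmin _ _ h1⟩) h))
      (fun i j hij hp => hmax j i ⟨hij, hp⟩) ?_)
    rw [spread_transpose]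
    exact ih

theorem spread_nonneg {A : Matrix (Fin n) (Fin n) ℤ} (hA : ∀ i j, i ≠ j → 0 ≤ A i j) :
    0 ≤ spread A := by
  refine Finset.sum_nonneg fun i _ => Finset.sum_nonneg fun j _ => ?_
  rcases eq_or_ne i j with rfl | hij
  · simp
  · exact mul_nonneg (sq_nonneg _) (hA i j hij)

/-- Induction on `spread A`, which is nonnegative unless some off-diagonal entry is negative and
`phi A I` is zero. If no off-diagonal entry is positive, the diagonal case applies. -/
theorem good2_phi (A : Matrix (Fin n) (Fin n) ℤ) (I : Set (Fin n × Fin n)) (hI : IsLowerSet I) :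
    Good2 (phi A I) := by
  obtain ⟨N, hN⟩ : ∃ N : ℕ, spread A < N := ⟨(spread A + 1).toNat, by omega⟩
  induction N generalizing A I with
  | zero =>
    by_cases h : ∀ i j, i ≠ j → 0 ≤ A i j
    · have := spread_nonneg h
      omega
    · push Not at h
      obtain ⟨i, j, hij, h⟩ := h
      rw [phi_eq_zero hij h]
      exact Good2.zero
  | succ N ih =>
    have ih' : ∀ A' : Matrix (Fin n) (Fin n) ℤ, spread A' < spread A → ∀ J, IsLowerSet J →
      Good2 (phi A' J) := fun A' h J hJ => ih A' J hJ (by omega)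
    by_cases h : ∀ i j, i ≠ j → 0 ≤ A i j
    · by_cases h1 : ∃ i j, j < i ∧ 0 < A i j
      · exact good2_phi_of_lower h1 ih' hI
      · by_cases h2 : ∃ i j, j < i ∧ 0 < A.transpose i j
        · refine good2_phi_transpose (good2_phi_of_lower h2 ?_ (isLowerSet_swap hI))
          rwa [spread_transpose]
        · push Not at h1 h2
          refine good2_phi_diagonal (fun i j hij => ?_) hI
          rcases lt_or_gt_of_ne hij with hlt | hlt
          · exact le_antisymm (h2 j i hlt) (h i j hij)
          · exact le_antisymm (h1 i j hlt) (h i j hij)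
    · push Not at h
      obtain ⟨i, j, hij, h⟩ := h
      rw [phi_eq_zero hij h]
      exact Good2.zero

/-- Only the left half of `Good2` is used; the right half makes the transposition step of the
induction possible. -/
theorem inSpan_conv {S S' : Set (Matrix (Fin n) (Fin n) ℤ)} {g h : Fam n} (hg : InSpan S g)
    (hh : InSpan S' h) : InSpan Set.univ (conv g h) :=
  (Good2.of_inSpan (fun A _ I hI => good2_phi A I hI) hg).1 h (hh.mono (Set.subset_univ _))

end Fam

/-! ### Characteristic functions of orbits -/

/-- Lower sets encode the decorations faithfully: `Δ` is the antichain of maximal elements. -/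
theorem XiTilde.mem_Δ_iff {n : ℕ} (X : XiTilde n) (x : Fin n × Fin n) :
    x ∈ X.Δ ↔ Maximal (· ∈ X.ideal) x := by
  constructor
  · refine fun hx => ⟨⟨x, hx, le_rfl⟩, fun y ⟨z, hz, hyz⟩ hxy => ?_⟩
    have hxz := hxy.trans hyz
    rcases eq_or_ne x z with rfl | hne
    · exact hyz
    · rcases X.strict x hx z hz hne with h | h
      · exact absurd hxz.2 (not_le.2 h.2)
      · exact absurd hxz.1 (not_le.2 h.1)
  · rintro ⟨⟨z, hz, hxz⟩, hmax⟩
    have := hmax (y := z) ⟨z, hz, le_rfl⟩ hxz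
    rwa [le_antisymm hxz this]

theorem XiTilde.ext_ideal {n : ℕ} {X Y : XiTilde n} (hA : X.A = Y.A) (hI : X.ideal = Y.ideal) :
    X = Y := by
  refine XiTilde.ext hA (Finset.ext fun x => ?_)
  rw [X.mem_Δ_iff, Y.mem_Δ_iff, hI]

theorem XiTilde.exists_of_isLowerSet {n : ℕ} (A : Matrix (Fin n) (Fin n) ℤ)
    (hA : ∀ i j, i ≠ j → 0 ≤ A i j) (J : Set (Fin n × Fin n)) (hJ : IsLowerSet J)
    (hpos : ∀ i j, Maximal (· ∈ J) (i, j) → i ≠ j → 0 < A i j) :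
    ∃ Z : XiTilde n, Z.A = A ∧ Z.ideal = J := by
  classical
  refine ⟨⟨A, Finset.univ.filter fun x => Maximal (· ∈ J) x, hA, ?_, ?_⟩, rfl, ?_⟩
  · intro x hx y hy hne
    simp only [Finset.mem_filter, Finset.mem_univ, true_and] at hx hy
    have h1 : ¬ x ≤ y := fun h => hne (le_antisymm h (hx.2 hy.1 h))
    have h2 : ¬ y ≤ x := fun h => hne (le_antisymm (hy.2 hx.1 h) h)
    rw [Prod.le_def, not_and_or, not_le, not_le] at h1 h2
    rcases h1 with h1 | h1 <;> rcases h2 with h2 | h2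
    · exact absurd h1 h2.not_gt
    · exact Or.inr ⟨h1, h2⟩
    · exact Or.inl ⟨h2, h1⟩
    · exact absurd h1 h2.not_gt
  · intro i j h hij
    exact hpos i j (by simpa using h) hij
  · ext y
    constructor
    · rintro ⟨x, hx, hyx⟩
      simp only [Finset.mem_filter, Finset.mem_univ, true_and] at hx
      exact hJ hyx hx.1
    · intro hy
      obtain ⟨m, hym, hm⟩ := (Set.toFinite J).exists_le_maximal hy
      exact ⟨m, by simpa using hm, hym⟩

/-- A maximal position of the lower set of `w` carries a basis vector that occurs in `w`. -/
theorem pos_of_maximal {F : Type} [Field F] {n d : ℕ} {f f' : PFlag F n d} {w : Fin d → F}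
    {i j : Fin n} (h : Maximal (· ∈ vecIdeal f f' w) (i, j)) : 0 < pos f f' i j := by
  obtain ⟨e, he⟩ := exists_adapted_basis f f'
  obtain ⟨x, hx, hle⟩ := (he.mem_vecIdeal w _).1 h.1
  have h1 := h.2 ((he.mem_vecIdeal w _).2 ⟨x, hx, le_rfl⟩) hle
  have h2 := le_antisymm hle h1
  rw [Prod.mk.injEq] at h2
  rw [he.pos_eq, Int.natCast_pos, Finset.card_pos]
  exact ⟨x, by simp [h2]⟩

namespace Fam

variable {n : ℕ}

/-- The family of the characteristic functions of the orbits of the shifts of `X`. -/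
def one (X : XiTilde n) : Fam n := fun t f f' w =>
  chi (X.shift t.p ∈ Xi n t.m ∧ InOrbit (X.shift t.p) f f' w)

/-- The family of the indicator functions of the conditions on the relative position and the lower
set of the vector. -/
def psi (A : Matrix (Fin n) (Fin n) ℤ) (J : Set (Fin n × Fin n)) : Fam n := fun t f f' w =>
  chi (pos f f' = A + Matrix.diagonal fun _ => (t.p : ℤ)) * chi (vecIdeal f f' w = J)

theorem one_eq_psi (X : XiTilde n) : one X = psi X.A X.ideal := by
  funext t f f' w
  rw [one, chi_congr (mem_Xi_and_inOrbit_iff _ f f' w), chi_and]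
  rfl

/-- One triple with these invariants already shows that the off-diagonal entries are admissible.
They do not depend on `p`, so the pair comes from an element of `XiTilde`. -/
theorem psi_eq_zero_or_one (A : Matrix (Fin n) (Fin n) ℤ) {J : Set (Fin n × Fin n)}
    (hJ : IsLowerSet J) : psi A J = 0 ∨ ∃ Z, psi A J = one Z := by
  by_cases h : psi A J = 0
  · exact Or.inl h
  · right
    have : ∃ (t : Pt) (f f' : PFlag t.F n t.m) (w : Fin t.m → t.F),
        pos f f' = A + Matrix.diagonal (fun _ => (t.p : ℤ)) ∧ vecIdeal f f' w = J := by
      by_contra hc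
      push Not at hc
      refine h ?_
      funext t f f' w
      rw [psi, ← chi_and]
      exact chi_false fun h => hc t f f' w h.1 h.2
    obtain ⟨t, f, f', w, hp, hv⟩ := this
    have hA : ∀ i j, i ≠ j → A i j = pos f f' i j := fun i j hij => by
      rw [hp, Matrix.add_apply, Matrix.diagonal_apply_ne _ hij, add_zero]
    obtain ⟨Z, h1, h2⟩ := XiTilde.exists_of_isLowerSet A
      (fun i j hij => by rw [hA i j hij]; exact pos_nonneg f f' i j) J hJ
      (fun i j hm hij => by rw [hA i j hij]; exact pos_of_maximal (w := w) (by rwa [hv]))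
    exact ⟨Z, by rw [one_eq_psi, h1, h2]⟩

open Classical in
theorem phi_eq_sum_psi (A : Matrix (Fin n) (Fin n) ℤ) {I : Set (Fin n × Fin n)}
    (hI : IsLowerSet I) :
    phi A I = ∑ J ∈ Finset.univ.filter (fun J => IsLowerSet J ∧ J ⊆ I), psi A J := by
  funext t f f' w
  rw [Finset.sum_apply, Finset.sum_apply, Finset.sum_apply, Finset.sum_apply]
  simp only [phi, psi]
  rw [← Finset.mul_sum, chi_congr (mem_spanBelow_iff f f' w hI)]
  congr 1
  by_cases h : vecIdeal f f' w ⊆ I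
  · rw [chi_true h, Finset.sum_eq_single_of_mem (vecIdeal f f' w)
      (by simpa using ⟨isLowerSet_vecIdeal f f' w, h⟩), chi_true rfl]
    exact fun J _ hJ => chi_false hJ.symm
  · rw [chi_false h, Finset.sum_eq_zero]
    intro J hJ
    simp only [Finset.mem_filter, Finset.mem_univ, true_and] at hJ
    exact chi_false fun h' => h (h' ▸ hJ.2)

/-- Möbius inversion of `phi_eq_sum_psi`, by induction over the lower sets contained in `I`. -/
theorem inSpan_psi (A : Matrix (Fin n) (Fin n) ℤ) (I : Set (Fin n × Fin n)) (hI : IsLowerSet I) :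
    InSpan Set.univ (psi A I) := by
  classical
  induction I using WellFoundedLT.induction with
  | ind I ih =>
    have h := phi_eq_sum_psi A hI
    rw [← Finset.sum_erase_add _ _ (show I ∈ Finset.univ.filter (fun J => IsLowerSet J ∧ J ⊆ I) by
      simpa using hI)] at h
    rw [← sub_eq_iff_eq_add'.2 h]
    refine (InSpan.phi (Set.mem_univ _) hI).sub (.sum _ fun J hJ => ?_)
    simp only [Finset.mem_erase, Finset.mem_filter, Finset.mem_univ, true_and] at hJ
    exact ih J (lt_of_le_of_ne hJ.2.2 hJ.1) hJ.2.1

theorem inSpan_one (X : XiTilde n) : InSpan Set.univ (one X) := by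
  rw [one_eq_psi]
  exact inSpan_psi _ _ X.isLowerSet_ideal

/-- The linear combinations of characteristic functions of orbits. -/
def IsComb (g : Fam n) (c : XiTilde n → ℕ → ℕ → ℚ) : Prop :=
  (∀ Z, IsCoef (c Z)) ∧ ∃ s : Finset (XiTilde n), (∀ Z ∉ s, c Z = 0) ∧
    g = ∑ Z ∈ s, scal (c Z) (one Z)

theorem IsComb.sum_eq {g : Fam n} {c : XiTilde n → ℕ → ℕ → ℚ} {s : Finset (XiTilde n)}
    (h0 : ∀ Z ∉ s, c Z = 0) (hg : g = ∑ Z ∈ s, scal (c Z) (one Z)) {s' : Finset (XiTilde n)}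
    (hs : s ⊆ s') : g = ∑ Z ∈ s', scal (c Z) (one Z) := by
  rw [hg]
  refine Finset.sum_subset hs fun Z _ hZ => ?_
  rw [h0 Z hZ]
  funext t f f' w
  simp [scal]

theorem IsComb.zero : IsComb (0 : Fam n) 0 :=
  ⟨fun _ => IsCoef.zero, ∅, by simp, by simp⟩

theorem IsComb.add {g h : Fam n} {c c' : XiTilde n → ℕ → ℕ → ℚ} (hg : IsComb g c)
    (hh : IsComb h c') : IsComb (g + h) (c + c') := by
  classical
  obtain ⟨hc, s, h0, hg⟩ := hg
  obtain ⟨hc', s', h0', hh⟩ := hh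
  refine ⟨fun Z => (hc Z).add (hc' Z), s ∪ s', fun Z hZ => ?_, ?_⟩
  · rw [Finset.notMem_union] at hZ
    rw [Pi.add_apply, h0 Z hZ.1, h0' Z hZ.2, add_zero]
  · rw [IsComb.sum_eq h0 hg Finset.subset_union_left, IsComb.sum_eq h0' hh Finset.subset_union_right,
      ← Finset.sum_add_distrib]
    refine Finset.sum_congr rfl fun Z _ => ?_
    funext t f f' w
    simp only [scal, Pi.add_apply, add_mul]

theorem IsComb.scal {g : Fam n} {c : XiTilde n → ℕ → ℕ → ℚ} {b : ℕ → ℕ → ℚ} (hb : IsCoef b)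
    (hg : IsComb g c) : IsComb (scal b g) (fun Z q p => b q p * c Z q p) := by
  obtain ⟨hc, s, h0, rfl⟩ := hg
  refine ⟨fun Z => hb.mul (hc Z), s, fun Z hZ => ?_, ?_⟩
  · funext q p
    change b q p * c Z q p = 0
    rw [h0 Z hZ, Pi.zero_apply, Pi.zero_apply, mul_zero]
  · funext t f f' w
    simp only [Fam.scal, Finset.sum_apply, Finset.mul_sum, mul_assoc]

theorem IsComb.one (X : XiTilde n) : ∃ c, IsComb (one X) c := by
  classical
  refine ⟨fun Z _ _ => if Z = X then 1 else 0, fun Z => ?_, {X}, fun Z hZ => ?_, ?_⟩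
  · by_cases h : Z = X
    · exact IsCoef.one.congr fun _ _ _ => if_pos h
    · exact IsCoef.zero.congr fun _ _ _ => if_neg h
  · rw [Finset.mem_singleton] at hZ
    funext q p
    simp [hZ]
  · funext t f f' w
    simp [Fam.scal]

theorem IsComb.finsetSum {ι : Type*} (s : Finset ι) {f : ι → Fam n}
    (h : ∀ i ∈ s, ∃ c, IsComb (f i) c) : ∃ c, IsComb (∑ i ∈ s, f i) c := by
  classical
  induction s using Finset.induction_on with
  | empty => exact ⟨0, IsComb.zero⟩
  | insert i s hi ih =>
    rw [Finset.sum_insert hi]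
    obtain ⟨c, hc⟩ := h i (by simp)
    obtain ⟨c', hc'⟩ := ih fun j hj => h j (by simp [hj])
    exact ⟨_, hc.add hc'⟩

theorem InSpan.exists_isComb {S : Set (Matrix (Fin n) (Fin n) ℤ)} {g : Fam n} (hg : InSpan S g) :
    ∃ c, IsComb g c := by
  classical
  induction hg with
  | zero => exact ⟨0, IsComb.zero⟩
  | add _ _ _ _ h1 h2 =>
    obtain ⟨c, hc⟩ := h1
    obtain ⟨c', hc'⟩ := h2
    exact ⟨_, hc.add hc'⟩
  | basis b A I hb hA hI =>
    rw [phi_eq_sum_psi A hI]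
    obtain ⟨c, hc⟩ := IsComb.finsetSum (Finset.univ.filter (fun J => IsLowerSet J ∧ J ⊆ I))
      (f := psi A) fun J hJ => by
        simp only [Finset.mem_filter, Finset.mem_univ, true_and] at hJ
        rcases psi_eq_zero_or_one A hJ.1 with h | ⟨Z, h⟩
        · exact ⟨0, h ▸ IsComb.zero⟩
        · rw [h]
          exact IsComb.one Z
    exact ⟨_, hc.scal hb⟩

theorem exists_isComb_conv (X Y : XiTilde n) : ∃ c, IsComb (conv (one X) (one Y)) c :=
  (inSpan_conv (inSpan_one X) (inSpan_one Y)).exists_isComb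

/-- The structure constants of the convolution product. -/
def coef (X Y : XiTilde n) : XiTilde n → ℕ → ℕ → ℚ := (exists_isComb_conv X Y).choose

theorem isComb_coef (X Y : XiTilde n) : IsComb (conv (one X) (one Y)) (coef X Y) :=
  (exists_isComb_conv X Y).choose_spec

theorem one_apply_of_inOrbit {Z : XiTilde n} {t : Pt} {f f' : PFlag t.F n t.m} {w : Fin t.m → t.F}
    (hZ : Z.shift t.p ∈ Xi n t.m) (h : InOrbit (Z.shift t.p) f f' w) (Z' : XiTilde n)
    [Decidable (Z' = Z)] : one Z' t f f' w = if Z' = Z then 1 else 0 := by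
  split_ifs with hZZ
  · rw [hZZ]
    exact chi_true ⟨hZ, h⟩
  · refine chi_false fun h' => hZZ ?_
    obtain ⟨h1, h2⟩ := (mem_Xi_and_inOrbit_iff _ f f' w).1 h'
    obtain ⟨h3, h4⟩ := (mem_Xi_and_inOrbit_iff _ f f' w).1 ⟨hZ, h⟩
    refine XiTilde.ext_ideal (add_right_cancel (h1.symm.trans h3)) ?_
    exact h2.symm.trans h4

theorem IsComb.apply_of_inOrbit {g : Fam n} {c : XiTilde n → ℕ → ℕ → ℚ} (hg : IsComb g c)
    {Z : XiTilde n} {t : Pt} {f f' : PFlag t.F n t.m} {w : Fin t.m → t.F}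
    (hZ : Z.shift t.p ∈ Xi n t.m) (h : InOrbit (Z.shift t.p) f f' w) :
    g t f f' w = c Z t.q t.p := by
  classical
  obtain ⟨hc, s, h0, rfl⟩ := hg
  simp only [Finset.sum_apply, Fam.scal]
  rw [Finset.sum_congr rfl fun Z' _ => by rw [one_apply_of_inOrbit hZ h Z']]
  simp only [mul_ite, mul_one, mul_zero, Finset.sum_ite_eq']
  split_ifs with hZs
  · rfl
  · rw [h0 Z hZs]
    rfl

theorem conv_one_one (X Y : XiTilde n) (t : Pt) (f f' : PFlag t.F n t.m) (w : Fin t.m → t.F)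
    (hX : X.shift t.p ∈ Xi n t.m) (hY : Y.shift t.p ∈ Xi n t.m) :
    conv (one X) (one Y) t f f' w = convCount (X.shift t.p) (Y.shift t.p) f f' w := by
  classical
  rw [convCount, ← cnt_eq_card (fun u : PFlag t.F n t.m × (Fin t.m → t.F) =>
    InOrbit (X.shift t.p) f u.1 u.2 ∧ InOrbit (Y.shift t.p) u.1 f' (w - u.2)), cnt, conv,
    Fintype.sum_prod_type]
  refine Finset.sum_congr rfl fun g _ => Finset.sum_congr rfl fun μ _ => ?_
  rw [chi_and, one, one, chi_congr (and_iff_right hX), chi_congr (and_iff_right hY)]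

end Fam

/-! ### Laurent polynomials and exponential sums -/

section ExpSum

variable {R S : Type*} [CommRing R] [CommRing S]

theorem eval₂_eq_sum (f : S →+* R) (u : Rˣ) (G : S[T;T⁻¹]) :
    LaurentPolynomial.eval₂ f u G = G.coeff.sum fun k r => f r * ((u ^ k : Rˣ) : R) := by
  induction G using LaurentPolynomial.induction_on' with
  | add p q hp hq =>
    rw [map_add, hp, hq, AddMonoidAlgebra.coeff_add, Finsupp.sum_add_index']
    · simp
    · intro k a b
      rw [map_add, add_mul]
  | C_mul_T k a =>
    rw [LaurentPolynomial.eval₂_C_mul_T, ← LaurentPolynomial.single_eq_C_mul_T,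
      AddMonoidAlgebra.coeff_single, Finsupp.sum_single_index (by rw [map_zero, zero_mul])]

/-- The operator `S(p) ↦ S(p + 1) - u ^ k₀ * S(p)` kills the term `k₀`, which permits induction on
the number of terms of an exponential sum. -/
theorem sum_insert_shift {s : Finset ℤ} {k₀ : ℤ} (hk : k₀ ∉ s) (u : Rˣ) (a : ℤ → R) (p : ℕ) :
    ∑ k ∈ s, a k * (((u ^ k : Rˣ) : R) - ((u ^ k₀ : Rˣ) : R)) * ((u ^ k : Rˣ) : R) ^ p =
      ∑ k ∈ insert k₀ s, a k * ((u ^ k : Rˣ) : R) ^ (p + 1) -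
        ((u ^ k₀ : Rˣ) : R) * ∑ k ∈ insert k₀ s, a k * ((u ^ k : Rˣ) : R) ^ p := by
  rw [Finset.sum_insert hk, Finset.sum_insert hk, mul_add, Finset.mul_sum, add_sub_add_comm,
    ← Finset.sum_sub_distrib]
  rw [show a k₀ * ((u ^ k₀ : Rˣ) : R) ^ (p + 1) -
    ((u ^ k₀ : Rˣ) : R) * (a k₀ * ((u ^ k₀ : Rˣ) : R) ^ p) = 0 by ring, zero_add]
  exact Finset.sum_congr rfl fun k _ => by ring

theorem eq_zero_of_expSum [IsDomain R] {u : Rˣ} (hu : ∀ k l : ℤ, u ^ k = u ^ l → k = l) (p₀ : ℕ)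
    (s : Finset ℤ) (a : ℤ → R)
    (h : ∀ p, p₀ ≤ p → ∑ k ∈ s, a k * ((u ^ k : Rˣ) : R) ^ p = 0) : ∀ k ∈ s, a k = 0 := by
  induction s using Finset.induction_on generalizing a with
  | empty => simp
  | insert k₀ s hk ih =>
    have h1 : ∀ k ∈ s, a k = 0 := fun k hks => by
      have := ih (fun k => a k * (((u ^ k : Rˣ) : R) - ((u ^ k₀ : Rˣ) : R))) (fun p hp => by
        rw [sum_insert_shift hk, h _ hp, h _ (hp.trans (Nat.le_succ p)), mul_zero, sub_zero]) k hks
      refine (mul_eq_zero.1 this).resolve_right fun h0 => hk ?_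
      rw [hu k₀ k (Units.ext (sub_eq_zero.1 h0)).symm]
      exact hks
    have h2 := h p₀ le_rfl
    rw [Finset.sum_insert hk, Finset.sum_eq_zero fun k hks => by rw [h1 k hks, zero_mul],
      add_zero] at h2
    have h3 := (mul_eq_zero.1 h2).resolve_right (pow_ne_zero _ (Units.ne_zero _))
    intro k hks
    rcases Finset.mem_insert.1 hks with rfl | hks
    · exact h3
    · exact h1 k hks

/-- Because `u ^ k₀` is a unit, the recurrence runs backwards: divisibility at `p + 1` gives
divisibility at `p`. This reaches `p = 0`, where the matrices need not belong to orbits and nothing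
can be counted. -/
theorem dvd_of_expSum (u : Rˣ) (D : R) (p₀ : ℕ) (s : Finset ℤ) (a : ℤ → R)
    (h : ∀ p, p₀ ≤ p → D ∣ ∑ k ∈ s, a k * ((u ^ k : Rˣ) : R) ^ p) (p : ℕ) :
    D ∣ ∑ k ∈ s, a k * ((u ^ k : Rˣ) : R) ^ p := by
  induction s using Finset.induction_on generalizing a p with
  | empty => simp
  | insert k₀ s hk ih =>
    have h1 := ih (fun k => a k * (((u ^ k : Rˣ) : R) - ((u ^ k₀ : Rˣ) : R))) fun p hp => by
      rw [sum_insert_shift hk]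
      exact dvd_sub (h _ (hp.trans (Nat.le_succ p))) ((h p hp).mul_left _)
    have key : ∀ p, D ∣ ∑ k ∈ insert k₀ s, a k * ((u ^ k : Rˣ) : R) ^ (p + 1) →
        D ∣ ∑ k ∈ insert k₀ s, a k * ((u ^ k : Rˣ) : R) ^ p := fun p hp => by
      have h2 := h1 p
      rw [sum_insert_shift hk] at h2
      exact (Units.dvd_mul_left).1 ((dvd_sub_right hp).1 h2)
    obtain hp | hp := le_total p₀ p
    · exact h p hp
    · exact Nat.decreasingInduction' (P := fun p =>
        D ∣ ∑ k ∈ insert k₀ s, a k * ((u ^ k : Rˣ) : R) ^ p) (fun k _ _ hk' => key k hk') hp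
        (h p₀ le_rfl)

theorem eval₂_pow_eq_sum (f : S →+* R) (u : Rˣ) (p : ℕ) (G : S[T;T⁻¹]) :
    LaurentPolynomial.eval₂ f (u ^ p) G =
      ∑ k ∈ G.coeff.support, f (G.coeff k) * ((u ^ k : Rˣ) : R) ^ p := by
  rw [eval₂_eq_sum, Finsupp.sum]
  refine Finset.sum_congr rfl fun k _ => ?_
  rw [← Units.val_pow_eq_pow_val, ← zpow_natCast, ← zpow_natCast, ← zpow_mul, ← zpow_mul, mul_comm k]

theorem eq_zero_of_eval₂_pow [IsDomain R] {f : S →+* R} (hf : Function.Injective f) {u : Rˣ}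
    (hu : ∀ k l : ℤ, u ^ k = u ^ l → k = l) (p₀ : ℕ) {G : S[T;T⁻¹]}
    (h : ∀ p, p₀ ≤ p → LaurentPolynomial.eval₂ f (u ^ p) G = 0) : G = 0 := by
  have := eq_zero_of_expSum hu p₀ G.coeff.support (fun k => f (G.coeff k))
    fun p hp => (eval₂_pow_eq_sum f u p G).symm.trans (h p hp)
  ext k
  by_cases hk : k ∈ G.coeff.support
  · exact (map_eq_zero_iff f hf).1 (this k hk)
  · simpa using hk

end ExpSum

/-! ### Integrality -/

/-- The remainder of `P` modulo `D` has smaller degree, so for large `q` its value is smaller than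
`D(q)` in absolute value; being divisible by `D(q)`, it is zero. -/
theorem dvd_of_eval_dvd {D P : Polynomial ℤ} (hD : D.Monic)
    (h : ∀ N : ℕ, ∃ q : ℕ, N ≤ q ∧ D.eval (q : ℤ) ∣ P.eval (q : ℤ)) : D ∣ P := by
  rw [← Polynomial.modByMonic_eq_zero_iff_dvd hD]
  set R := P %ₘ D with hR
  have hdeg : (R.map (Int.castRingHom ℝ)).degree < (D.map (Int.castRingHom ℝ)).degree := by
    rw [Polynomial.degree_map_eq_of_injective Int.cast_injective,
      Polynomial.degree_map_eq_of_injective Int.cast_injective]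
    exact Polynomial.degree_modByMonic_lt _ hD
  have hlim := Polynomial.div_tendsto_atTop_zero_of_degree_lt _ _ hdeg
  have hev := (hlim.comp tendsto_natCast_atTop_atTop).eventually
    (Metric.ball_mem_nhds (0 : ℝ) one_pos)
  obtain ⟨N₀, hN₀⟩ := Filter.eventually_atTop.1 hev
  by_contra hR0
  refine hR0 (Polynomial.eq_zero_of_infinite_isRoot R ?_)
  refine Set.Infinite.mono (s := (fun q : ℕ => (q : ℤ)) '' {q : ℕ | R.eval (q : ℤ) = 0}) ?_ ?_
  · rintro _ ⟨q, hq, rfl⟩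
    exact hq
  · refine Set.Infinite.image Nat.cast_injective.injOn (Set.infinite_of_not_bddAbove ?_)
    rintro ⟨M, hM⟩
    obtain ⟨q, hq, hdvd⟩ := h (max (M + 1) N₀)
    have hdR : D.eval (q : ℤ) ∣ R.eval (q : ℤ) := by
      have h1 : R = P - D * (P /ₘ D) := by
        rw [hR]
        exact eq_sub_of_add_eq (Polynomial.modByMonic_add_div P D)
      rw [h1, Polynomial.eval_sub, Polynomial.eval_mul]
      exact dvd_sub hdvd (dvd_mul_right _ _)
    have h0 : R.eval (q : ℤ) = 0 := by
      by_cases hDq : D.eval (q : ℤ) = 0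
      · rw [hDq] at hdR
        exact zero_dvd_iff.1 hdR
      · have h2 := hN₀ q ((le_max_right _ _).trans hq)
        have h3 : ∀ Q : Polynomial ℤ, Polynomial.eval ((q : ℕ) : ℝ) (Q.map (Int.castRingHom ℝ)) =
            ((Q.eval (q : ℤ) : ℤ) : ℝ) := fun Q => by
          rw [Polynomial.eval_map, ← Int.cast_natCast, Polynomial.eval₂_at_intCast]
          simp
        simp only [Function.comp_apply, dist_zero_right, h3, norm_div,
          Real.norm_eq_abs] at h2
        rw [div_lt_one (abs_pos.2 (Int.cast_ne_zero.2 hDq))] at h2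
        exact Int.eq_zero_of_abs_lt_dvd ((abs_dvd _ _).2 hdR) (by exact_mod_cast h2)
    have := hM h0
    have := le_max_left (M + 1) N₀
    omega

theorem exists_polynomial_eq {g : Aring} : ∃ (k : ℕ) (P : Polynomial ℤ),
    Polynomial.toLaurent P = g * LaurentPolynomial.T k ∧
    ∀ q : ℕ, 2 ≤ q → ((P.eval (q : ℤ) : ℤ) : ℚ) = evq q g * (q : ℚ) ^ k := by
  obtain ⟨k, P, hP⟩ := LaurentPolynomial.exists_T_pow g
  refine ⟨k, P, hP, fun q hq => ?_⟩
  rw [← evq_toLaurent hq, hP, map_mul, evq_T hq, zpow_natCast]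

theorem aring_eq_zero {g : Aring} (h : ∀ N : ℕ, ∃ q, N ≤ q ∧ evq q g = 0) : g = 0 := by
  obtain ⟨k, P, hP, hq⟩ := exists_polynomial_eq (g := g)
  have hP0 : P = 0 := by
    refine Polynomial.eq_zero_of_infinite_isRoot P ?_
    refine Set.Infinite.mono (s := (fun q : ℕ => (q : ℤ)) '' {q : ℕ | P.eval (q : ℤ) = 0}) ?_ ?_
    · rintro _ ⟨q, hq, rfl⟩
      exact hq
    · refine Set.Infinite.image Nat.cast_injective.injOn (Set.infinite_of_not_bddAbove ?_)
      rintro ⟨M, hM⟩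
      obtain ⟨q, hqM, hq0⟩ := h (M + 2)
      have h1 := hq q (by omega)
      rw [hq0, zero_mul, Int.cast_eq_zero] at h1
      have := hM h1
      omega
  rw [hP0, map_zero] at hP
  exact ((LaurentPolynomial.isUnit_T (R := ℤ) k).mul_left_eq_zero).1 hP.symm

theorem aring_ext {g g' : Aring} (h : ∀ N : ℕ, ∃ q, N ≤ q ∧ evq q g = evq q g') : g = g' := by
  refine sub_eq_zero.1 (aring_eq_zero fun N => ?_)
  obtain ⟨q, hq, he⟩ := h N
  exact ⟨q, hq, by rw [map_sub, he, sub_self]⟩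

theorem aring_dvd {D : Polynomial ℤ} (hD : D.Monic) {g : Aring}
    (h : ∀ N : ℕ, ∃ q, N ≤ q ∧ ∃ z : ℤ, ((D.eval (q : ℤ) : ℤ) : ℚ) * z = evq q g) :
    Polynomial.toLaurent D ∣ g := by
  obtain ⟨k, P, hP, hq⟩ := exists_polynomial_eq (g := g)
  have : D ∣ P := dvd_of_eval_dvd hD fun N => by
    obtain ⟨q, hqN, z, hz⟩ := h (N + 2)
    refine ⟨q, by omega, z * (q : ℤ) ^ k, ?_⟩
    have h1 := hq q (by omega)
    rw [← hz] at h1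
    have : ((P.eval (q : ℤ) : ℤ) : ℚ) = ((D.eval (q : ℤ) * (z * (q : ℤ) ^ k) : ℤ) : ℚ) := by
      rw [h1]
      push_cast
      ring
    exact_mod_cast this
  exact ((LaurentPolynomial.isUnit_T (R := ℤ) k).dvd_mul_right).1 (hP ▸ map_dvd _ this)

/-- `T` as a unit. -/
def tUnit : Aringˣ where
  val := LaurentPolynomial.T 1
  inv := LaurentPolynomial.T (-1)
  val_inv := by rw [← LaurentPolynomial.T_add]; simp
  inv_val := by rw [← LaurentPolynomial.T_add]; simp

theorem val_tUnit_zpow (k : ℤ) : ((tUnit ^ k : Aringˣ) : Aring) = LaurentPolynomial.T k := by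
  have hn : ∀ k : ℕ, ((tUnit ^ k : Aringˣ) : Aring) = LaurentPolynomial.T k := fun k => by
    rw [Units.val_pow_eq_pow_val]
    exact (LaurentPolynomial.T_pow 1 k).trans (by rw [mul_one])
  obtain ⟨k, rfl | rfl⟩ := k.eq_nat_or_neg
  · rw [zpow_natCast, hn]
  · rw [zpow_neg, zpow_natCast]
    refine Units.inv_eq_of_mul_eq_one_right ?_
    rw [hn, ← LaurentPolynomial.T_add]
    simp

theorem tUnit_zpow_injective (k l : ℤ) (h : tUnit ^ k = tUnit ^ l) : k = l := by
  have := congrArg (fun u : Aringˣ => LaurentPolynomial.degree (u : Aring)) h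
  simp only [val_tUnit_zpow, LaurentPolynomial.degree_T] at this
  exact_mod_cast this

/-- The value of `G(T, t)` at `t = T ^ p`. -/
def evP (p : ℕ) : Aring[T;T⁻¹] →+* Aring :=
  LaurentPolynomial.eval₂ (RingHom.id Aring) (tUnit ^ p)

theorem evq_evP {q : ℕ} (hq : 2 ≤ q) (p : ℕ) (G : Aring[T;T⁻¹]) :
    evq q (evP p G) = ev2 q p G := by
  have h0 : (q : ℚ) ≠ 0 := Nat.cast_ne_zero.2 (by omega)
  rw [evP, eval₂_pow_eq_sum, ev2, zpow_natCast, eval₂_pow_eq_sum, map_sum]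
  refine Finset.sum_congr rfl fun k _ => ?_
  rw [map_mul, map_pow, val_tUnit_zpow, evq_T hq, Units.val_zpow_eq_zpow_val, val_qUnit hq]
  rfl

theorem evP_eq_zero {G : Aring[T;T⁻¹]} (p₀ : ℕ)
    (h : ∀ p, p₀ ≤ p → ∀ N : ℕ, ∃ q, N ≤ q ∧ ev2 q p G = 0) : G = 0 := by
  refine eq_zero_of_eval₂_pow (f := RingHom.id Aring) Function.injective_id tUnit_zpow_injective p₀ fun p hp => ?_
  refine aring_eq_zero fun N => ?_
  obtain ⟨q, hq, h0⟩ := h p hp (N + 2)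
  exact ⟨q, by omega, (evq_evP (by omega) p G).trans h0⟩

/-- For each large `p` a Laurent polynomial with infinitely many zeros vanishes; then an exponential
sum in `p` that vanishes for large `p` is zero. Every passage from large `p` to `p = 0` of an
identity between coefficients uses this. -/
theorem IsCoef.eq_zero {c : ℕ → ℕ → ℚ} (hc : IsCoef c) (p₀ : ℕ)
    (h : ∀ p, p₀ ≤ p → ∀ q : ℕ, q.Prime → c q p = 0) {q : ℕ} (hq : 2 ≤ q) (p : ℕ) :
    c q p = 0 := by
  obtain ⟨D, G, hD, H⟩ := hc
  have hG : G = 0 := evP_eq_zero p₀ fun p hp N => by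
    obtain ⟨q, hq, hpr⟩ := Nat.exists_infinite_primes N
    exact ⟨q, hq, by rw [← (H q hpr.two_le).2, h p hp q hpr, mul_zero]⟩
  have := (H q hq).2 p
  rw [hG, map_zero] at this
  exact (mul_eq_zero.1 this).resolve_left (Int.cast_ne_zero.2 (H q hq).1)

/-! ### Shifts -/

namespace XiTilde

variable {n : ℕ}

/-- The sum of the entries. -/
def total (X : XiTilde n) : ℤ := ∑ i, ∑ j, X.A i j

theorem shift_A_apply (p : ℤ) (X : XiTilde n) (i j : Fin n) :
    (X.shift p).A i j = X.A i j + if i = j then p else 0 := by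
  refine (Matrix.add_apply _ _ i j).trans ?_
  rw [Matrix.diagonal_apply]

theorem shift_zero (X : XiTilde n) : X.shift 0 = X := by
  refine XiTilde.ext ?_ rfl
  ext i j
  rw [shift_A_apply, ite_self, add_zero]

theorem shift_neg_shift (p : ℤ) (X : XiTilde n) : (X.shift (-p)).shift p = X := by
  refine XiTilde.ext ?_ rfl
  ext i j
  rw [shift_A_apply, shift_A_apply]
  split_ifs <;> ring

theorem shift_injective (p : ℤ) {X Y : XiTilde n} (h : X.shift p = Y.shift p) : X = Y := by
  refine XiTilde.ext ?_ (congrArg XiTilde.Δ h : (X.shift p).Δ = (Y.shift p).Δ)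
  exact add_right_cancel (congrArg XiTilde.A h)

theorem total_shift (p : ℤ) (X : XiTilde n) : (X.shift p).total = X.total + n * p := by
  simp only [total, shift_A_apply, Finset.sum_add_distrib, Finset.sum_ite_eq, Finset.mem_univ,
    if_true, Finset.sum_const, Finset.card_univ, Fintype.card_fin, nsmul_eq_mul]

theorem total_eq_of_mem {X : XiTilde n} {p : ℤ} {m : ℕ} (h : X.shift p ∈ Xi n m) :
    X.total + n * p = m := by
  rw [← total_shift]
  exact h.2.2

theorem exists_shift_mem_bound (X : XiTilde n) : ∃ p₀ : ℕ, ∀ p : ℕ, p₀ ≤ p →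
    X.shift p ∈ Xi n (X.total + n * p).toNat := by
  -- Beyond this bound every diagonal entry is positive, which takes care of decorated diagonal
  -- positions as well.
  refine ⟨∑ i, (1 - X.A i i).toNat, fun p hp => ?_⟩
  have hd : ∀ i, 0 < X.A i i + p := fun i => by
    have := (Finset.single_le_sum (f := fun i => (1 - X.A i i).toNat) (fun _ _ => Nat.zero_le _)
      (Finset.mem_univ i)).trans hp
    have h1 : (1 - X.A i i).toNat ≤ p := this
    omega
  have h0 : ∀ i j, 0 ≤ (X.shift p).A i j := fun i j => by
    rw [shift_A_apply]
    split_ifs with hij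
    · subst hij
      exact (hd i).le
    · rw [add_zero]
      exact X.offdiag_nonneg i j hij
  refine ⟨h0, fun i j hij => ?_, ?_⟩
  · rw [shift_A_apply]
    split_ifs with h
    · subst h
      exact hd i
    · rw [add_zero]
      exact X.decorated_pos i j hij h
  · have h1 : 0 ≤ (X.shift p).total :=
      Finset.sum_nonneg fun i _ => Finset.sum_nonneg fun j _ => h0 i j
    rw [← total_shift, Int.toNat_of_nonneg h1]
    rfl

theorem total_eq_of_co_eq_ro {X Y : XiTilde n} (h : X.co = Y.ro) : X.total = Y.total := by
  have h1 : X.total = ∑ j, X.co j := Finset.sum_comm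
  rw [h1, h]
  rfl

end XiTilde

/-! ### Properties of the structure constants -/

namespace Fam

variable {n : ℕ} {X Y Z : XiTilde n}

theorem exists_point {q p m : ℕ} (hq : q.Prime) (hZ : Z.shift p ∈ Xi n m) :
    ∃ t : Pt, t.q = q ∧ t.p = p ∧ t.m = m ∧ Z.shift t.p ∈ Xi n t.m ∧
      ∃ (f f' : PFlag t.F n t.m) (w : Fin t.m → t.F), InOrbit (Z.shift t.p) f f' w := by
  have := Fact.mk hq
  exact ⟨⟨ZMod q, p, m⟩, ZMod.card q, rfl, rfl, hZ, exists_inOrbit hZ⟩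

theorem isCoef_coef (X Y Z : XiTilde n) : IsCoef (coef X Y Z) := (isComb_coef X Y).1 Z

theorem coef_eq_convCount {t : Pt} {f f' : PFlag t.F n t.m} {w : Fin t.m → t.F}
    (hX : X.shift t.p ∈ Xi n t.m) (hY : Y.shift t.p ∈ Xi n t.m) (hZ : Z.shift t.p ∈ Xi n t.m)
    (h : InOrbit (Z.shift t.p) f f' w) :
    coef X Y Z t.q t.p = convCount (X.shift t.p) (Y.shift t.p) f f' w := by
  rw [← (isComb_coef X Y).apply_of_inOrbit hZ h, conv_one_one X Y t f f' w hX hY]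

theorem exists_coef_eq_natCast {q p m : ℕ} (hq : q.Prime) (hX : X.shift p ∈ Xi n m)
    (hY : Y.shift p ∈ Xi n m) (hZ : Z.shift p ∈ Xi n m) : ∃ z : ℕ, coef X Y Z q p = z := by
  obtain ⟨t, rfl, rfl, rfl, hZ', f, f', w, h⟩ := exists_point hq hZ
  exact ⟨_, coef_eq_convCount hX hY hZ h⟩

/-- One factor is the zero function at these parameters, whereas the orbit of `Z` has a point. With
`p = 0` and `m = d` this is the reason why η may send the basis elements outside `Xi n d` to zero.
-/
theorem coef_eq_zero_of_not_mem {q p m : ℕ} (hq : q.Prime)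
    (hXY : X.shift p ∉ Xi n m ∨ Y.shift p ∉ Xi n m) (hZ : Z.shift p ∈ Xi n m) :
    coef X Y Z q p = 0 := by
  obtain ⟨t, rfl, rfl, rfl, hZ', f, f', w, h⟩ := exists_point hq hZ
  rw [← (isComb_coef X Y).apply_of_inOrbit hZ h, conv]
  refine Finset.sum_eq_zero fun g _ => Finset.sum_eq_zero fun μ _ => ?_
  rcases hXY with hX | hY
  · rw [one, chi_false fun h => hX h.1, zero_mul]
  · rw [mul_comm, one, chi_false fun h => hY h.1, zero_mul]

/-- For large `p` the orbit of `Z` lives in a dimension where one of the factors has no orbit;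
`IsCoef.eq_zero` extends the vanishing to all `p`. -/
theorem coef_eq_zero_of_total_ne (h : X.total ≠ Z.total ∨ Y.total ≠ Z.total) {q : ℕ} (hq : 2 ≤ q)
    (p : ℕ) : coef X Y Z q p = 0 := by
  obtain ⟨p₀, hp₀⟩ := Z.exists_shift_mem_bound
  refine (isCoef_coef X Y Z).eq_zero p₀ (fun p hp q hq => ?_) hq p
  have hm := XiTilde.total_eq_of_mem (hp₀ p hp)
  refine coef_eq_zero_of_not_mem hq ?_ (hp₀ p hp)
  refine h.imp (fun h h' => h ?_) (fun h h' => h ?_)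
  · have := XiTilde.total_eq_of_mem h'
    omega
  · have := XiTilde.total_eq_of_mem h'
    omega

theorem co_eq_ro_of_inOrbit {F : Type} [Field F] {p : ℤ} {m : ℕ} {f g f' : PFlag F n m}
    {w w' : Fin m → F} (hX : X.shift p ∈ Xi n m) (hY : Y.shift p ∈ Xi n m)
    (h : InOrbit (X.shift p) f g w) (h' : InOrbit (Y.shift p) g f' w') : X.co = Y.ro := by
  have h1 := ((mem_Xi_and_inOrbit_iff _ _ _ _).1 ⟨hX, h⟩).1
  have h2 := ((mem_Xi_and_inOrbit_iff _ _ _ _).1 ⟨hY, h'⟩).1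
  funext j
  have h3 := (sum_pos_col f g j).trans (sum_pos_row g f' j).symm
  rw [h1, h2] at h3
  simpa [XiTilde.shift_A_apply, Finset.sum_add_distrib, XiTilde.co, XiTilde.ro] using h3

theorem coef_eq_zero_of_co_ne (h : X.co ≠ Y.ro) {q : ℕ} (hq : 2 ≤ q) (p : ℕ) :
    coef X Y Z q p = 0 := by
  obtain ⟨p₀, hp₀⟩ := Z.exists_shift_mem_bound
  refine (isCoef_coef X Y Z).eq_zero p₀ (fun p hp q hq => ?_) hq p
  obtain ⟨t, rfl, rfl, ht, hZ', f, f', w, ho⟩ := exists_point hq (hp₀ p hp)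
  rw [← (isComb_coef X Y).apply_of_inOrbit hZ' ho, conv]
  refine Finset.sum_eq_zero fun g _ => Finset.sum_eq_zero fun μ _ => ?_
  rw [one, one, ← chi_and]
  exact chi_false fun h' => h (co_eq_ro_of_inOrbit h'.1.1 h'.2.1 h'.1.2 h'.2.2)

/-- The denominator of a structure constant. -/
def den (X Y Z : XiTilde n) : Polynomial ℤ := (isCoef_coef X Y Z).choose

/-- The numerator of a structure constant. -/
def num (X Y Z : XiTilde n) : Aring[T;T⁻¹] := (isCoef_coef X Y Z).choose_spec.choose

theorem monic_den (X Y Z : XiTilde n) : (den X Y Z).Monic :=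
  (isCoef_coef X Y Z).choose_spec.choose_spec.1

theorem eval_den_ne_zero (X Y Z : XiTilde n) {q : ℕ} (hq : 2 ≤ q) :
    (((den X Y Z).eval (q : ℤ) : ℤ) : ℚ) ≠ 0 :=
  Int.cast_ne_zero.2 ((isCoef_coef X Y Z).choose_spec.choose_spec.2 q hq).1

theorem den_mul_coef (X Y Z : XiTilde n) {q : ℕ} (hq : 2 ≤ q) (p : ℕ) :
    (((den X Y Z).eval (q : ℤ) : ℤ) : ℚ) * coef X Y Z q p = evq q (evP p (num X Y Z)) := by
  rw [evq_evP hq]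
  exact ((isCoef_coef X Y Z).choose_spec.choose_spec.2 q hq).2 p

theorem num_eq_zero (h : ∀ q p, 2 ≤ q → coef X Y Z q p = 0) : num X Y Z = 0 :=
  evP_eq_zero 0 fun p _ N => ⟨N + 2, by omega, by
    rw [← evq_evP (by omega), ← den_mul_coef X Y Z (by omega), h _ _ (by omega), mul_zero]⟩

theorem den_dvd_evP {p m : ℕ} (hX : X.shift p ∈ Xi n m) (hY : Y.shift p ∈ Xi n m)
    (hZ : Z.shift p ∈ Xi n m) : Polynomial.toLaurent (den X Y Z) ∣ evP p (num X Y Z) :=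
  aring_dvd (monic_den X Y Z) fun N => by
    obtain ⟨q, hqN, hq⟩ := Nat.exists_infinite_primes N
    obtain ⟨z, hz⟩ := exists_coef_eq_natCast hq hX hY hZ
    exact ⟨q, hqN, z, by rw [← den_mul_coef X Y Z hq.two_le, hz, Int.cast_natCast]⟩

/-- For large `p` the coefficient counts points, so the denominator divides the numerator;
`dvd_of_expSum` carries this down to `p = 0`. If the totals differ, there is no common dimension to
count in, but the coefficient is zero. -/
theorem exists_evq_eq_coef (X Y Z : XiTilde n) :
    ∃ s : Aring, ∀ q, 2 ≤ q → evq q s = coef X Y Z q 0 := by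
  by_cases h : X.total ≠ Z.total ∨ Y.total ≠ Z.total
  · exact ⟨0, fun q hq => by rw [map_zero, coef_eq_zero_of_total_ne h hq]⟩
  · push Not at h
    obtain ⟨pX, hX⟩ := X.exists_shift_mem_bound
    obtain ⟨pY, hY⟩ := Y.exists_shift_mem_bound
    obtain ⟨pZ, hZ⟩ := Z.exists_shift_mem_bound
    rw [h.1] at hX
    rw [h.2] at hY
    have hdvd := dvd_of_expSum tUnit (Polynomial.toLaurent (den X Y Z)) (pX + pY + pZ)
      (num X Y Z).coeff.support (fun k => RingHom.id Aring ((num X Y Z).coeff k)) (fun p hp => by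
        rw [← eval₂_pow_eq_sum]
        exact den_dvd_evP (hX p (by omega)) (hY p (by omega)) (hZ p (by omega))) 0
    rw [← eval₂_pow_eq_sum] at hdvd
    obtain ⟨s, hs⟩ := hdvd
    refine ⟨s, fun q hq => ?_⟩
    have h1 := den_mul_coef X Y Z hq 0
    rw [evP, hs, map_mul, evq_toLaurent hq] at h1
    exact (mul_left_cancel₀ (eval_den_ne_zero X Y Z hq) h1).symm

/-- The structure constants at `p = 0`, as Laurent polynomials in `q`. -/
def sCoef (X Y Z : XiTilde n) : Aring := (exists_evq_eq_coef X Y Z).choose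

theorem evq_sCoef (X Y Z : XiTilde n) {q : ℕ} (hq : 2 ≤ q) :
    evq q (sCoef X Y Z) = coef X Y Z q 0 := (exists_evq_eq_coef X Y Z).choose_spec q hq

theorem den_mul_sCoef (X Y Z : XiTilde n) :
    Polynomial.toLaurent (den X Y Z) * sCoef X Y Z = evP 0 (num X Y Z) :=
  aring_ext fun N => ⟨N + 2, by omega, by
    rw [map_mul, evq_toLaurent (by omega), evq_sCoef _ _ _ (by omega),
      den_mul_coef X Y Z (by omega)]⟩

theorem sCoef_eq_zero {N : ℕ} (h : ∀ q, N ≤ q → q.Prime → coef X Y Z q 0 = 0) :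
    sCoef X Y Z = 0 :=
  aring_eq_zero fun M => by
    obtain ⟨q, hqN, hq⟩ := Nat.exists_infinite_primes (M + N)
    exact ⟨q, by omega, by rw [evq_sCoef _ _ _ hq.two_le, h q (by omega) hq]⟩

theorem exists_finset_coef (X Y : XiTilde n) : ∃ s : Finset (XiTilde n),
    (∀ Z ∉ s, coef X Y Z = 0) ∧ conv (one X) (one Y) = ∑ Z ∈ s, scal (coef X Y Z) (one Z) :=
  (isComb_coef X Y).2

/-- The set of the orbits that occur in a product. -/
def supp (X Y : XiTilde n) : Finset (XiTilde n) := (exists_finset_coef X Y).choose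

theorem coef_eq_zero_of_notMem_supp (hZ : Z ∉ supp X Y) : coef X Y Z = 0 :=
  (exists_finset_coef X Y).choose_spec.1 Z hZ

theorem conv_one_one_eq_sum (X Y : XiTilde n) :
    conv (one X) (one Y) = ∑ Z ∈ supp X Y, scal (coef X Y Z) (one Z) :=
  (exists_finset_coef X Y).choose_spec.2

theorem sCoef_eq_zero_of_notMem_supp (hZ : Z ∉ supp X Y) : sCoef X Y Z = 0 :=
  sCoef_eq_zero (N := 0) fun q _ _ => by rw [coef_eq_zero_of_notMem_supp hZ]; rfl

theorem sum_conv {ι : Type*} (s : Finset ι) (g : ι → Fam n) (h : Fam n) :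
    conv (∑ i ∈ s, g i) h = ∑ i ∈ s, conv (g i) h := by
  classical
  induction s using Finset.induction_on with
  | empty => simp [zero_conv]
  | insert i s hi ih => rw [Finset.sum_insert hi, Finset.sum_insert hi, add_conv, ih]

theorem conv_sum {ι : Type*} (s : Finset ι) (g : ι → Fam n) (h : Fam n) :
    conv h (∑ i ∈ s, g i) = ∑ i ∈ s, conv h (g i) := by
  classical
  induction s using Finset.induction_on with
  | empty => simp [conv_zero]
  | insert i s hi ih => rw [Finset.sum_insert hi, Finset.sum_insert hi, conv_add, ih]

/-- Associativity of convolution, evaluated at a point of the orbit of `U` for prime `q` and large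
`p`, and then extended by `IsCoef.eq_zero`. -/
theorem sum_coef_mul_coef (X Y W U : XiTilde n) {q : ℕ} (hq : 2 ≤ q) (p : ℕ) :
    ∑ Z ∈ supp X Y, coef X Y Z q p * coef Z W U q p =
      ∑ Z ∈ supp Y W, coef Y W Z q p * coef X Z U q p := by
  obtain ⟨p₀, hp₀⟩ := U.exists_shift_mem_bound
  rw [← sub_eq_zero]
  refine IsCoef.eq_zero (c := fun q p => ∑ Z ∈ supp X Y, coef X Y Z q p * coef Z W U q p -
      ∑ Z ∈ supp Y W, coef Y W Z q p * coef X Z U q p)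
    ((IsCoef.sum _ fun Z _ => (isCoef_coef _ _ _).mul (isCoef_coef _ _ _)).sub
      (IsCoef.sum _ fun Z _ => (isCoef_coef _ _ _).mul (isCoef_coef _ _ _))) p₀
    (fun p hp q hq => ?_) hq p
  obtain ⟨t, rfl, rfl, ht, hU, f, f', w, ho⟩ := exists_point hq (hp₀ p hp)
  have h := congrFun (congrFun (congrFun (congrFun (conv_assoc (one X) (one Y) (one W)) t) f) f') w
  rw [conv_one_one_eq_sum X Y, conv_one_one_eq_sum Y W, sum_conv, conv_sum] at h
  simp only [scal_conv, conv_scal, Finset.sum_apply, scal,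
    (isComb_coef _ _).apply_of_inOrbit hU ho] at h
  exact sub_eq_zero.2 h

theorem sum_sCoef_mul_sCoef (X Y W U : XiTilde n) :
    ∑ Z ∈ supp X Y, sCoef X Y Z * sCoef Z W U = ∑ Z ∈ supp Y W, sCoef Y W Z * sCoef X Z U :=
  aring_ext fun N => ⟨N + 2, by omega, by
    rw [map_sum, map_sum]
    simp only [map_mul, evq_sCoef _ _ _ (show 2 ≤ N + 2 by omega)]
    exact sum_coef_mul_coef X Y W U (by omega) 0⟩

end Fam

/-! ### Structure polynomials -/

section StructurePoly

open Fam

variable {n m p : ℕ} {X Y Z : XiTilde n}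

/-- Counts over the prime fields already determine the polynomial, and the uniform formula
conversely gives the count over every finite field. -/
theorem isStructurePoly_iff (hX : X.shift p ∈ Xi n m) (hY : Y.shift p ∈ Xi n m)
    (hZ : Z.shift p ∈ Xi n m) (P : Polynomial ℤ) :
    IsStructurePoly ⟨X.shift p, hX⟩ ⟨Y.shift p, hY⟩ ⟨Z.shift p, hZ⟩ P ↔
      Polynomial.toLaurent (den X Y Z) * Polynomial.toLaurent P = evP p (num X Y Z) := by
  constructor
  · refine fun hP => aring_ext fun N => ?_
    obtain ⟨q, hqN, hq⟩ := Nat.exists_infinite_primes N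
    refine ⟨q, hqN, ?_⟩
    have hq2 := hq.two_le
    obtain ⟨t, rfl, rfl, rfl, hZ', f, f', w, ho⟩ := exists_point hq hZ
    rw [map_mul, evq_toLaurent hq2, evq_toLaurent hq2, ← den_mul_coef X Y Z hq2,
      coef_eq_convCount hX hY hZ ho]
    congr 1
    exact_mod_cast hP t.F f f' w ho
  · intro hP F _ _ f f' w ho
    let t : Pt := ⟨F, p, m⟩
    have h1 := congrArg (evq t.q) hP
    rw [map_mul, evq_toLaurent t.two_le, evq_toLaurent t.two_le, ← den_mul_coef X Y Z t.two_le]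
      at h1
    have h2 := mul_left_cancel₀ (eval_den_ne_zero X Y Z t.two_le) h1
    rw [show coef X Y Z t.q p = _ from coef_eq_convCount (t := t) hX hY hZ ho] at h2
    exact_mod_cast h2

theorem existsUnique_structurePoly_shift (hX : X.shift p ∈ Xi n m) (hY : Y.shift p ∈ Xi n m)
    (hZ : Z.shift p ∈ Xi n m) :
    ∃! P, IsStructurePoly ⟨X.shift p, hX⟩ ⟨Y.shift p, hY⟩ ⟨Z.shift p, hZ⟩ P := by
  simp only [isStructurePoly_iff]
  obtain ⟨k, P, hP, hev⟩ := exists_polynomial_eq (g := evP p (num X Y Z))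
  -- The factor `X ^ k` accounts for the power of `T` that cleared negative exponents; including it
  -- in the divisor makes the quotient a true polynomial.
  have hdvd : Polynomial.X ^ k * den X Y Z ∣ P := by
    refine dvd_of_eval_dvd ((Polynomial.monic_X_pow k).mul (monic_den X Y Z)) fun N => ?_
    obtain ⟨q, hqN, hq⟩ := Nat.exists_infinite_primes N
    obtain ⟨z, hz⟩ := exists_coef_eq_natCast hq hX hY hZ
    refine ⟨q, hqN, z, ?_⟩
    have h1 := hev q hq.two_le
    rw [← den_mul_coef X Y Z hq.two_le, hz] at h1
    rw [Polynomial.eval_mul, Polynomial.eval_pow, Polynomial.eval_X, ← Int.cast_inj (α := ℚ), h1]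
    push_cast
    ring
  obtain ⟨S, rfl⟩ := hdvd
  have h0 : Polynomial.toLaurent (den X Y Z) ≠ 0 :=
    Polynomial.toLaurent_ne_zero.2 (monic_den X Y Z).ne_zero
  have hS : Polynomial.toLaurent (den X Y Z) * Polynomial.toLaurent S = evP p (num X Y Z) := by
    rw [mul_assoc, map_mul, Polynomial.toLaurent_X_pow, mul_comm] at hP
    rw [← map_mul]
    exact (LaurentPolynomial.isUnit_T (R := ℤ) k).mul_right_cancel hP
  exact ⟨S, hS, fun S' hS' => Polynomial.toLaurent_injective
    (mul_left_cancel₀ h0 (hS'.trans hS.symm))⟩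

theorem existsUnique_structurePoly (X Y Z : Xi n m) : ∃! P, IsStructurePoly X Y Z P := by
  obtain ⟨X, hX⟩ := X
  obtain ⟨Y, hY⟩ := Y
  obtain ⟨Z, hZ⟩ := Z
  have h : ∀ X : XiTilde n, X.shift ((0 : ℕ) : ℤ) = X := XiTilde.shift_zero
  have := existsUnique_structurePoly_shift (X := X) (Y := Y) (Z := Z) (p := 0) (m := m)
    (by rwa [h]) (by rwa [h]) (by rwa [h])
  simpa only [h] using this

theorem isStructurePoly_structurePoly (X Y Z : Xi n m) :
    IsStructurePoly X Y Z (structurePoly X Y Z) := by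
  have h := (existsUnique_structurePoly X Y Z).exists
  rw [structurePoly, dif_pos h]
  exact h.choose_spec

theorem den_mul_structurePoly (hX : X.shift p ∈ Xi n m) (hY : Y.shift p ∈ Xi n m)
    (hZ : Z.shift p ∈ Xi n m) : Polynomial.toLaurent (den X Y Z) * Polynomial.toLaurent
      (structurePoly ⟨X.shift p, hX⟩ ⟨Y.shift p, hY⟩ ⟨Z.shift p, hZ⟩) = evP p (num X Y Z) :=
  (isStructurePoly_iff hX hY hZ _).1 (isStructurePoly_structurePoly _ _ _)

/-- The link between the two algebras: the structure constants of `MS n m` are those from which the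
product of `K` is built. -/
theorem toLaurent_structurePoly (hX : X ∈ Xi n m) (hY : Y ∈ Xi n m) (hZ : Z ∈ Xi n m) :
    Polynomial.toLaurent (structurePoly ⟨X, hX⟩ ⟨Y, hY⟩ ⟨Z, hZ⟩) = sCoef X Y Z := by
  have h : ∀ X : XiTilde n, X.shift ((0 : ℕ) : ℤ) = X := XiTilde.shift_zero
  have h1 := den_mul_structurePoly (X := X) (Y := Y) (Z := Z) (p := 0) (m := m)
    (by rwa [h]) (by rwa [h]) (by rwa [h])
  simp only [h] at h1
  rw [← den_mul_sCoef] at h1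
  exact mul_left_cancel₀ (Polynomial.toLaurent_ne_zero.2 (monic_den X Y Z).ne_zero) h1

end StructurePoly

/-! ### The exponents -/

namespace XiTilde

variable {n : ℕ}

open Classical in
/-- The slope of `p ↦ (X.shift p).dr`. -/
def drSlope (X : XiTilde n) : ℤ :=
  (∑ i, ∑ j, ∑ k, ∑ l, if k ≤ i ∧ j < l then
    (if i = j then X.A k l else 0) + (if k = l then X.A i j else 0) else 0) +
    ∑ i, ∑ j, if X.Below i j then (if i = j then 1 else 0) else 0

/-- A term quadratic in `p` would need two diagonal positions with `k ≤ i` and `j < l`, which is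
impossible. Hence the normalization contributes only monomials in `v` and `v'`. -/
theorem dr_shift (p : ℤ) (X : XiTilde n) : (X.shift p).dr = X.dr + p * X.drSlope := by
  classical
  rw [dr, dr, drSlope, mul_add, add_add_add_comm]
  congr 1
  · simp only [Finset.mul_sum, ← Finset.sum_add_distrib]
    refine Finset.sum_congr rfl fun i _ => Finset.sum_congr rfl fun j _ =>
      Finset.sum_congr rfl fun k _ => Finset.sum_congr rfl fun l _ => ?_
    by_cases h : k ≤ i ∧ j < l
    · rw [if_pos h, if_pos h, if_pos h, shift_A_apply, shift_A_apply]
      by_cases h1 : i = j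
      · have h2 : k ≠ l := fun h2 => absurd h.1 (not_le.2 (h1 ▸ h2 ▸ h.2))
        rw [if_pos h1, if_pos h1, if_neg h2, if_neg h2]
        ring
      · rw [if_neg h1, if_neg h1]
        split_ifs <;> ring
    · rw [if_neg h, if_neg h, if_neg h]
      ring
  · simp only [Finset.mul_sum, ← Finset.sum_add_distrib]
    refine Finset.sum_congr rfl fun i _ => Finset.sum_congr rfl fun j _ => ?_
    have hB : (X.shift p).Below i j ↔ X.Below i j := Iff.rfl
    by_cases h : X.Below i j
    · rw [if_pos h, if_pos h, if_pos (hB.2 h), shift_A_apply]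
      split_ifs <;> ring
    · rw [if_neg h, if_neg h, if_neg (hB.not.2 h)]
      ring

end XiTilde

/-! ### The field `ℚ(v)` -/

theorem eval₂_vUnit_pow_injective {k : ℕ} (hk : 0 < k) :
    Function.Injective (LaurentPolynomial.eval₂ (Int.castRingHom Qv) (vUnit ^ k)) := by
  have hcomp : ∀ P : Polynomial ℤ, Polynomial.eval₂ (Int.castRingHom Qv) ((vUnit ^ k : Qvˣ) : Qv) P =
      algebraMap (Polynomial ℚ) Qv (Polynomial.expand ℚ k (P.map (Int.castRingHom ℚ))) := by
    intro P
    have : Polynomial.eval₂RingHom (Int.castRingHom Qv) ((vUnit ^ k : Qvˣ) : Qv) =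
        (algebraMap (Polynomial ℚ) Qv).comp (((Polynomial.expand ℚ k : _ →ₐ[ℚ] _) :
          Polynomial ℚ →+* Polynomial ℚ).comp (Polynomial.mapRingHom (Int.castRingHom ℚ))) := by
      refine Polynomial.ringHom_ext' (RingHom.ext_int _ _) ?_
      simp [vUnit, RatFunc.algebraMap_X]
    exact congrArg (fun f => f P) this
  rw [injective_iff_map_eq_zero]
  intro g hg
  obtain ⟨j, P, hP⟩ := LaurentPolynomial.exists_T_pow g
  have h1 := congrArg (LaurentPolynomial.eval₂ (Int.castRingHom Qv) (vUnit ^ k)) hP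
  rw [map_mul, hg, zero_mul, LaurentPolynomial.eval₂_toLaurent, hcomp,
    map_eq_zero_iff _ (RatFunc.algebraMap_injective ℚ), Polynomial.expand_eq_zero hk,
    Polynomial.map_eq_zero_iff Int.cast_injective] at h1
  rw [h1, map_zero] at hP
  exact ((LaurentPolynomial.isUnit_T (R := ℤ) j).mul_left_eq_zero).1 hP.symm

theorem incl_injective : Function.Injective incl := by
  have := eval₂_vUnit_pow_injective one_pos
  rwa [pow_one] at this

theorem incl_T (k : ℤ) : incl (LaurentPolynomial.T k) = ((vUnit ^ k : Qvˣ) : Qv) :=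
  LaurentPolynomial.eval₂_T _ _ _

theorem vUnit_zpow_injective (k l : ℤ) (h : vUnit ^ k = vUnit ^ l) : k = l := by
  refine tUnit_zpow_injective k l (Units.ext ?_)
  rw [val_tUnit_zpow, val_tUnit_zpow]
  exact incl_injective (by rw [incl_T, incl_T, h])

/-- The substitution `T ↦ v²` with values in `ℚ(v)`. -/
def inclSq : Aring →+* Qv := LaurentPolynomial.eval₂ (Int.castRingHom Qv) (vUnit ^ 2)

theorem inclSq_injective : Function.Injective inclSq := eval₂_vUnit_pow_injective two_pos

/-- The substitution `T ↦ v²`. -/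
def sq : Aring →+* Aring := LaurentPolynomial.eval₂ (Int.castRingHom Aring) (tUnit ^ 2)

theorem incl_sq (g : Aring) : incl (sq g) = inclSq g := by
  rw [sq, inclSq, eval₂_eq_sum, eval₂_eq_sum, Finsupp.sum, Finsupp.sum, map_sum]
  refine Finset.sum_congr rfl fun k _ => ?_
  rw [map_mul, ← zpow_natCast, ← zpow_natCast, ← zpow_mul, ← zpow_mul, val_tUnit_zpow, incl_T]
  simp

theorem sq_toLaurent (P : Polynomial ℤ) : sq (Polynomial.toLaurent P) =
    Polynomial.aeval (LaurentPolynomial.T 2 : Aring) P := by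
  rw [sq, LaurentPolynomial.eval₂_toLaurent, ← zpow_natCast, val_tUnit_zpow, Polynomial.aeval_def]
  exact congrArg (fun f => Polynomial.eval₂ f (LaurentPolynomial.T 2 : Aring) P)
    (RingHom.ext_int _ _)

/-- `T(-2)` as a unit. -/
def tStretch : (Qv[T;T⁻¹])ˣ where
  val := LaurentPolynomial.T (-2)
  inv := LaurentPolynomial.T 2
  val_inv := by rw [← LaurentPolynomial.T_add]; simp
  inv_val := by rw [← LaurentPolynomial.T_add]; simp

/-- The substitution `T ↦ v²`, `t ↦ v'⁻²`. -/
def stretch : Aring[T;T⁻¹] →+* Qv[T;T⁻¹] :=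
  LaurentPolynomial.eval₂ (LaurentPolynomial.C.comp inclSq) tStretch

theorem evalAt_eq (p : ℕ) (G : Qv[T;T⁻¹]) : evalAt p G =
    LaurentPolynomial.eval₂ (RingHom.id Qv) ((vUnit⁻¹) ^ p) G := by
  rw [evalAt, zpow_neg, zpow_natCast, inv_pow]

/-- At `v' = v ^ (-p)` one has `v'⁻² = v ^ (2 * p) = q ^ p`. -/
theorem evalAt_stretch (p : ℕ) (G : Aring[T;T⁻¹]) : evalAt p (stretch G) = inclSq (evP p G) := by
  rw [evalAt, stretch, evP, eval₂_pow_eq_sum, eval₂_eq_sum _ tStretch, Finsupp.sum, map_sum, map_sum]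
  refine Finset.sum_congr rfl fun k _ => ?_
  have h1 : Units.map (LaurentPolynomial.eval₂ (RingHom.id Qv) (vUnit ^ (-(p : ℤ)))).toMonoidHom
      tStretch = vUnit ^ (2 * p : ℤ) := by
    refine Units.ext ?_
    change LaurentPolynomial.eval₂ (RingHom.id Qv) (vUnit ^ (-(p : ℤ))) (LaurentPolynomial.T (-2)) = _
    rw [LaurentPolynomial.eval₂_T, ← zpow_mul]
    congr 2
    ring
  have h2 : LaurentPolynomial.eval₂ (RingHom.id Qv) (vUnit ^ (-(p : ℤ)))
      ((tStretch ^ k : (Qv[T;T⁻¹])ˣ) : Qv[T;T⁻¹]) = ((vUnit ^ (2 * p * k) : Qvˣ) : Qv) := by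
    rw [zpow_mul, ← h1, ← map_zpow]
    rfl
  have h3 : inclSq (LaurentPolynomial.T k) = ((vUnit ^ (2 * k) : Qvˣ) : Qv) := by
    rw [inclSq, LaurentPolynomial.eval₂_T, ← zpow_natCast, ← zpow_mul]
    rfl
  rw [map_mul, map_mul, map_pow, h2, val_tUnit_zpow, h3, RingHom.comp_apply,
    LaurentPolynomial.eval₂_C, ← Units.val_pow_eq_pow_val, ← zpow_natCast (vUnit ^ (2 * k)),
    ← zpow_mul, mul_right_comm]
  rfl

theorem evalAt_mul (p : ℕ) (G H : Qv[T;T⁻¹]) : evalAt p (G * H) = evalAt p G * evalAt p H :=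
  map_mul _ G H

theorem eq_zero_of_evalAt (p₀ : ℕ) {G : Qv[T;T⁻¹]} (h : ∀ p, p₀ ≤ p → evalAt p G = 0) :
    G = 0 := by
  refine eq_zero_of_eval₂_pow (f := RingHom.id Qv) Function.injective_id (u := vUnit⁻¹)
    (fun k l h => ?_) p₀ fun p hp => (evalAt_eq p G).symm.trans (h p hp)
  rw [inv_zpow', inv_zpow'] at h
  exact neg_injective (vUnit_zpow_injective _ _ h)

/-! ### Products of basis elements of the Schur algebra -/

namespace MS

variable {n m : ℕ}

theorem e_apply (X Z : Xi n m) : e X Z = open Classical in if Z = X then 1 else 0 := by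
  classical
  rw [e]
  exact Pi.single_apply _ _ _

theorem br_apply_self (X : Xi n m) : br X X = LaurentPolynomial.T (-X.1.dr) := by
  rw [br, smul_apply, e_apply, if_pos rfl, mul_one]

theorem br_apply_of_ne {X Z : Xi n m} (h : Z ≠ X) : br X Z = 0 := by
  rw [br, smul_apply, e_apply, if_neg h, mul_zero]

theorem br_mul_br_apply (X Y Z : Xi n m) : (br X * br Y) Z =
    LaurentPolynomial.T (-X.1.dr - Y.1.dr) * sq (Polynomial.toLaurent (structurePoly X Y Z)) := by
  classical
  rw [mul_apply, Finset.sum_eq_single X, Finset.sum_eq_single Y, br_apply_self, br_apply_self,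
    ← LaurentPolynomial.T_add, sq_toLaurent, sub_eq_add_neg]
  · intro Y' _ h
    rw [br_apply_of_ne h, mul_zero, zero_mul]
  · simp
  · intro X' _ h
    refine Finset.sum_eq_zero fun Y' _ => ?_
    rw [br_apply_of_ne h, zero_mul, zero_mul]
  · simp

end MS

/-! ### Stabilization -/

section Stabilization

open Fam

variable {n : ℕ} (X Y : XiTilde n)

/-- The constant term of the exponent. -/
def expo (Z : XiTilde n) : ℤ := Z.dr - X.dr - Y.dr

/-- The slope of the exponent. -/
def expoSlope (Z : XiTilde n) : ℤ := Z.drSlope - X.drSlope - Y.drSlope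

/-- The coefficients of the stabilization of a product. -/
def stabCoef (Z : XiTilde n) : Qv[T;T⁻¹] :=
  LaurentPolynomial.C (((vUnit ^ expo X Y Z : Qvˣ) : Qv) *
    (inclSq (Polynomial.toLaurent (den X Y Z)))⁻¹) *
    LaurentPolynomial.T (-expoSlope X Y Z) * stretch (num X Y Z)

theorem inclSq_den_ne_zero (Z : XiTilde n) : inclSq (Polynomial.toLaurent (den X Y Z)) ≠ 0 :=
  (map_ne_zero_iff _ inclSq_injective).2 (Polynomial.toLaurent_ne_zero.2 (monic_den X Y Z).ne_zero)

/-- Used twice: with `s` a structure polynomial for large `p`, and with `s = sCoef X Y Z` for `p =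
0`, which is the specialization `v' = 1`. -/
theorem evalAt_stabCoef {Z : XiTilde n} {p : ℕ} {s : Aring}
    (hs : Polynomial.toLaurent (den X Y Z) * s = evP p (num X Y Z)) :
    evalAt p (stabCoef X Y Z) =
      ((vUnit ^ (expo X Y Z + p * expoSlope X Y Z) : Qvˣ) : Qv) * inclSq s := by
  rw [stabCoef, evalAt_mul, evalAt_stretch, ← hs, map_mul inclSq, evalAt,
    LaurentPolynomial.eval₂_C_mul_T, ← zpow_mul, neg_mul_neg, zpow_add, Units.val_mul]
  rw [RingHom.id_apply]
  have := inclSq_den_ne_zero X Y Z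
  field_simp

theorem stabCoef_eq_zero {Z : XiTilde n} (h : ∀ q p, 2 ≤ q → coef X Y Z q p = 0) :
    stabCoef X Y Z = 0 := by
  rw [stabCoef, num_eq_zero h, map_zero, mul_zero]

/-- The stabilization of a product. -/
def stab : XiTilde n →₀ Qv[T;T⁻¹] := by
  classical
  exact Finsupp.onFinset (supp X Y) (stabCoef X Y) fun Z hZ => by
    by_contra h
    exact hZ (stabCoef_eq_zero X Y fun q p _ => by rw [coef_eq_zero_of_notMem_supp h]; rfl)

theorem stab_apply (Z : XiTilde n) : stab X Y Z = stabCoef X Y Z := rfl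

theorem total_eq_of_mem_support {Z : XiTilde n} (h : Z ∈ (stab X Y).support) :
    X.total = Z.total ∧ Y.total = Z.total := by
  by_contra hc
  rw [not_and_or] at hc
  exact Finsupp.mem_support_iff.1 h
    (stabCoef_eq_zero X Y fun q p hq => coef_eq_zero_of_total_ne hc hq p)

theorem isStabilization_stab (h : X.co = Y.ro) : IsStabilization X Y (stab X Y) := by
  classical
  obtain ⟨pX, hX⟩ := X.exists_shift_mem_bound
  obtain ⟨pY, hY⟩ := Y.exists_shift_mem_bound
  choose pZ hZ using fun Z : XiTilde n => Z.exists_shift_mem_bound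
  have ht := XiTilde.total_eq_of_co_eq_ro h
  refine ⟨pX + pY + ∑ Z ∈ (stab X Y).support, pZ Z, fun p hp =>
    ⟨(X.total + n * p).toNat, hX p (by omega), ht ▸ hY p (by omega), fun Z hZs => ?_, ?_⟩⟩
  · rw [(total_eq_of_mem_support X Y hZs).1]
    have := Finset.single_le_sum (f := pZ) (fun _ _ => Nat.zero_le _) hZs
    exact hZ Z p (by omega)
  · rintro ⟨W, hW⟩
    obtain ⟨Z, rfl⟩ : ∃ Z : XiTilde n, Z.shift p = W := ⟨W.shift (-p), W.shift_neg_shift p⟩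
    have hXp := hX p (by omega)
    have hYp : Y.shift p ∈ Xi n (X.total + n * p).toNat := ht ▸ hY p (by omega)
    have hZp := evalAt_stabCoef X Y (den_mul_structurePoly hXp hYp hW)
    have hL : incl ((MS.br ⟨X.shift p, hXp⟩ * MS.br ⟨Y.shift p, hYp⟩ :
        MS n (X.total + n * p).toNat) ⟨Z.shift p, hW⟩) =
          evalAt p (stab X Y Z) * incl (LaurentPolynomial.T (-(Z.shift p).dr)) := by
      rw [MS.br_mul_br_apply, map_mul, incl_sq, incl_T, incl_T, stab_apply, hZp, mul_right_comm,
        ← Units.val_mul, ← zpow_add]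
      congr 3
      simp only [XiTilde.dr_shift, expo, expoSlope]
      ring_nf
    rw [hL]
    by_cases hZs : Z ∈ (stab X Y).support
    · rw [Finset.sum_eq_single (⟨Z, hZs⟩ : (stab X Y).support), MS.br_apply_self]
      · rintro ⟨Z', hZ'⟩ _ hne
        rw [MS.br_apply_of_ne, map_zero, mul_zero]
        refine fun he => hne (Subtype.ext ?_)
        exact (XiTilde.shift_injective p (congrArg Subtype.val he)).symm
      · simp
    · rw [Finsupp.notMem_support_iff.1 hZs, Finset.sum_eq_zero]
      · simp [evalAt]
      · rintro ⟨Z', hZ'⟩ _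
        rw [MS.br_apply_of_ne, map_zero, mul_zero]
        refine fun he => hZs ?_
        rwa [XiTilde.shift_injective p (congrArg Subtype.val he)]

/-- Shifts of distinct elements stay distinct, so for large `p` each value `evalAt p (G Z)` is
determined; a Laurent polynomial in `v'` is determined by its values at `v ^ (-p)` for large `p`. -/
theorem stabilization_unique {G G' : XiTilde n →₀ Qv[T;T⁻¹]} (hG : IsStabilization X Y G)
    (hG' : IsStabilization X Y G') : G = G' := by
  classical
  obtain ⟨p₁, h1⟩ := hG
  obtain ⟨p₂, h2⟩ := hG'
  have key : ∀ (G : XiTilde n →₀ Qv[T;T⁻¹]) (p m : ℕ)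
      (hZ : ∀ Z ∈ G.support, Z.shift p ∈ Xi n m) (Z : XiTilde n) (hZm : Z.shift p ∈ Xi n m),
      ∑ Z' : G.support, evalAt p (G Z'.1) *
        incl (MS.br ⟨Z'.1.shift p, hZ Z'.1 Z'.2⟩ ⟨Z.shift p, hZm⟩) =
          evalAt p (G Z) * incl (LaurentPolynomial.T (-(Z.shift p).dr)) := by
    intro G p m hZ Z hZm
    by_cases hZs : Z ∈ G.support
    · rw [Finset.sum_eq_single (⟨Z, hZs⟩ : G.support), MS.br_apply_self]
      · rintro ⟨Z', hZ'⟩ _ hne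
        rw [MS.br_apply_of_ne, map_zero, mul_zero]
        refine fun he => hne (Subtype.ext ?_)
        exact (XiTilde.shift_injective p (congrArg Subtype.val he)).symm
      · simp
    · rw [Finsupp.notMem_support_iff.1 hZs, Finset.sum_eq_zero]
      · simp [evalAt]
      · rintro ⟨Z', hZ'⟩ _
        rw [MS.br_apply_of_ne, map_zero, mul_zero]
        refine fun he => hZs ?_
        rwa [XiTilde.shift_injective p (congrArg Subtype.val he)]
  refine Finsupp.ext fun Z => ?_
  by_cases hZs : Z ∈ G.support ∨ Z ∈ G'.support
  · obtain ⟨pZ, hZ⟩ := Z.exists_shift_mem_bound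
    refine sub_eq_zero.1 (eq_zero_of_evalAt (p₁ + p₂ + pZ) fun p hp => ?_)
    obtain ⟨m, hX, hY, hZ1, H1⟩ := h1 p (by omega)
    obtain ⟨m', hX', hY', hZ2, H2⟩ := h2 p (by omega)
    obtain rfl : m = m' := by
      have e1 := XiTilde.total_eq_of_mem hX
      have e2 := XiTilde.total_eq_of_mem hX'
      omega
    have hZm : Z.shift p ∈ Xi n m := hZs.elim (hZ1 Z) (hZ2 Z)
    have e1 := H1 ⟨Z.shift p, hZm⟩
    have e2 := H2 ⟨Z.shift p, hZm⟩
    rw [key G p m hZ1 Z hZm] at e1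
    rw [key G' p m hZ2 Z hZm] at e2
    have e3 := e1.symm.trans e2
    rw [incl_T] at e3
    have e4 := mul_right_cancel₀ (Units.ne_zero _) e3
    rw [evalAt, evalAt] at e4
    rw [evalAt, map_sub, e4, sub_self]
  · rw [not_or, Finsupp.notMem_support_iff, Finsupp.notMem_support_iff] at hZs
    rw [hZs.1, hZs.2]

/-- The coordinates of the stable product. -/
def stableCoef : XiTilde n →₀ Aring := by
  classical
  exact Finsupp.onFinset (supp X Y)
    (fun Z => LaurentPolynomial.T (expo X Y Z) * sq (sCoef X Y Z)) fun Z hZ => by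
      by_contra h
      exact hZ (by rw [sCoef_eq_zero_of_notMem_supp h, map_zero, mul_zero])

theorem stableCoef_apply (Z : XiTilde n) :
    stableCoef X Y Z = LaurentPolynomial.T (expo X Y Z) * sq (sCoef X Y Z) := rfl

theorem isStableProduct_stableCoef (h : X.co = Y.ro) : IsStableProduct X Y (stableCoef X Y) := by
  refine ⟨stab X Y, isStabilization_stab X Y h, fun Z => ?_⟩
  rw [stab_apply, evalAt_stabCoef X Y (den_mul_sCoef X Y Z), stableCoef_apply, map_mul, incl_T,
    incl_sq]
  simp

theorem stableProduct_unique {c c' : XiTilde n →₀ Aring} (hc : IsStableProduct X Y c)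
    (hc' : IsStableProduct X Y c') : c = c' := by
  obtain ⟨G, hG, h⟩ := hc
  obtain ⟨G', hG', h'⟩ := hc'
  obtain rfl := stabilization_unique X Y hG hG'
  exact Finsupp.ext fun Z => incl_injective ((h Z).trans (h' Z).symm)

theorem existsUnique_stableProduct (h : X.co = Y.ro) : ∃! c, IsStableProduct X Y c :=
  ⟨_, isStableProduct_stableCoef X Y h, fun _ hc =>
    stableProduct_unique X Y hc (isStableProduct_stableCoef X Y h)⟩

/-- The case `X.co ≠ Y.ro` is included: the generic coefficients vanish there, as no middle flag can
have both dimension vectors. -/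
theorem stableProduct_eq : stableProduct X Y = stableCoef X Y := by
  by_cases h : X.co = Y.ro
  · have h' : X.co = Y.ro ∧ ∃ c, IsStableProduct X Y c :=
      ⟨h, _, isStableProduct_stableCoef X Y h⟩
    rw [stableProduct, dif_pos h']
    exact stableProduct_unique X Y h'.2.choose_spec (isStableProduct_stableCoef X Y h)
  · rw [stableProduct, dif_neg fun h' => h h'.1]
    refine Finsupp.ext fun Z => ?_
    rw [stableCoef_apply, sCoef_eq_zero (N := 0) fun q _ hq =>
      coef_eq_zero_of_co_ne h hq.two_le 0, map_zero, mul_zero]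
    rfl

end Stabilization

/-! ### The algebra `K` and the homomorphism to the Schur algebra -/

namespace K

open Fam

variable {n : ℕ}

theorem br_mul_br_eq_sum (X Y : XiTilde n) : br X * br Y =
    ∑ Z ∈ supp X Y, (LaurentPolynomial.T (expo X Y Z) * sq (sCoef X Y Z) : Aring) • br Z := by
  rw [br_mul_br, stableProduct_eq]
  have h : (stableCoef X Y).support ⊆ supp X Y := Finsupp.support_onFinset_subset
  have h1 := Finsupp.sum_of_support_subset (stableCoef X Y) h
    (fun Z a => Finsupp.single Z a) fun Z _ => Finsupp.single_zero Z
  refine ((Finsupp.sum_single _).symm.trans h1).trans (Finset.sum_congr rfl fun Z _ => ?_)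
  refine Eq.trans ?_ (Finsupp.smul_single_one Z _).symm
  rfl

theorem induction_on {P : K n → Prop} (x : K n) (h0 : P 0) (hadd : ∀ x y, P x → P y → P (x + y))
    (hbr : ∀ (a : Aring) X, P (a • br X)) : P x := by
  refine Finsupp.induction_linear (motive := P) x h0 hadd fun X a => ?_
  have := hbr a X
  rwa [show a • br X = Finsupp.single X a from Finsupp.smul_single_one X a] at this

/-- The exponents telescope, their sum being independent of the intermediate `Z`, and
`sum_sCoef_mul_sCoef` remains. -/
theorem br_mul_assoc (X Y W : XiTilde n) : br X * br Y * br W = br X * (br Y * br W) := by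
  classical
  rw [br_mul_br_eq_sum X Y, br_mul_br_eq_sum Y W, Finset.sum_mul, Finset.mul_sum]
  simp only [smul_mul_assoc, mul_smul_comm, br_mul_br, stableProduct_eq]
  refine Finsupp.ext fun U => ?_
  have e : ∀ (s : Finset (XiTilde n)) (f : XiTilde n → Aring) (g : XiTilde n → XiTilde n →₀ Aring),
      (∑ Z ∈ s, f Z • (g Z : K n) : XiTilde n →₀ Aring) U = ∑ Z ∈ s, f Z * g Z U := fun s f g => by
    refine (Finsupp.finsetSum_apply s (fun Z => f Z • g Z) U).trans ?_
    rfl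
  refine (e _ _ _).trans (Eq.trans ?_ (e _ _ _).symm)
  simp only [stableCoef_apply]
  have h1 : ∀ Z, (LaurentPolynomial.T (expo X Y Z) * sq (sCoef X Y Z) : Aring) *
      (LaurentPolynomial.T (expo Z W U) * sq (sCoef Z W U)) =
      LaurentPolynomial.T (U.dr - X.dr - Y.dr - W.dr) * sq (sCoef X Y Z * sCoef Z W U) := fun Z => by
    rw [map_mul, mul_mul_mul_comm, ← LaurentPolynomial.T_add, expo, expo]
    congr 2
    ring
  have h2 : ∀ Z, (LaurentPolynomial.T (expo Y W Z) * sq (sCoef Y W Z) : Aring) *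
      (LaurentPolynomial.T (expo X Z U) * sq (sCoef X Z U)) =
      LaurentPolynomial.T (U.dr - X.dr - Y.dr - W.dr) * sq (sCoef Y W Z * sCoef X Z U) := fun Z => by
    rw [map_mul, mul_mul_mul_comm, ← LaurentPolynomial.T_add, expo, expo]
    congr 2
    ring
  simp only [h1, h2]
  rw [← Finset.mul_sum, ← Finset.mul_sum, ← map_sum, ← map_sum, sum_sCoef_mul_sCoef]

protected theorem mul_assoc (x y z : K n) : x * y * z = x * (y * z) := by
  induction x using induction_on with
  | h0 => simp only [zero_mul]
  | hadd x x' h h' => simp only [add_mul, h, h']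
  | hbr a X =>
    induction y using induction_on with
    | h0 => simp only [zero_mul, mul_zero]
    | hadd x x' h h' => simp only [add_mul, mul_add, h, h']
    | hbr b Y =>
      induction z using induction_on with
      | h0 => simp only [mul_zero]
      | hadd x x' h h' => simp only [mul_add, h, h']
      | hbr c Z => simp only [smul_mul_assoc, mul_smul_comm, br_mul_assoc]

open Classical in
/-- The image of a basis element in the Schur algebra. -/
def brImage (d : ℕ) (X : XiTilde n) : MS n d := if h : X ∈ Xi n d then MS.br ⟨X, h⟩ else 0

/-- Compare the values at `W ∈ Xi n d`. If `X` and `Y` lie in `Xi n d`, this is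
`toLaurent_structurePoly`; otherwise the left side is zero and `sCoef X Y W` vanishes by
`coef_eq_zero_of_not_mem`. -/
theorem brImage_mul (d : ℕ) (X Y : XiTilde n) : brImage d X * brImage d Y =
    ∑ Z ∈ supp X Y, (LaurentPolynomial.T (expo X Y Z) * sq (sCoef X Y Z) : Aring) •
      brImage d Z := by
  classical
  funext ⟨W, hW⟩
  have hsum : (∑ Z ∈ supp X Y, (LaurentPolynomial.T (expo X Y Z) * sq (sCoef X Y Z) : Aring) •
      brImage d Z : MS n d) ⟨W, hW⟩ =
        LaurentPolynomial.T (-X.dr - Y.dr) * sq (sCoef X Y W) := by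
    refine (Finset.sum_apply _ _ _).trans ?_
    have h1 : ∀ Z, Z ≠ W → ((LaurentPolynomial.T (expo X Y Z) * sq (sCoef X Y Z) : Aring) •
        brImage d Z : MS n d) ⟨W, hW⟩ = 0 := fun Z hZ => by
      rw [MS.smul_apply, brImage]
      split_ifs with h
      · rw [MS.br_apply_of_ne fun h' => hZ (congrArg Subtype.val h').symm, mul_zero]
      · exact mul_zero _
    have h2 : ((LaurentPolynomial.T (expo X Y W) * sq (sCoef X Y W) : Aring) •
        brImage d W : MS n d) ⟨W, hW⟩ =
          LaurentPolynomial.T (-X.dr - Y.dr) * sq (sCoef X Y W) := by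
      rw [MS.smul_apply, brImage, dif_pos hW, MS.br_apply_self, mul_right_comm,
        ← LaurentPolynomial.T_add, expo]
      congr 2
      ring
    by_cases hs : W ∈ supp X Y
    · exact (Finset.sum_eq_single_of_mem W hs fun Z _ hZ => h1 Z hZ).trans h2
    · rw [sCoef_eq_zero_of_notMem_supp hs, map_zero, mul_zero]
      exact Finset.sum_eq_zero fun Z hZ => h1 Z fun h => hs (h ▸ hZ)
  refine Eq.trans ?_ hsum.symm
  by_cases hX : X ∈ Xi n d
  · by_cases hY : Y ∈ Xi n d
    · rw [brImage, brImage, dif_pos hX, dif_pos hY, MS.br_mul_br_apply, toLaurent_structurePoly]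
    · rw [brImage, brImage, dif_neg hY, mul_zero, MS.zero_apply,
        sCoef_eq_zero (N := 0) fun q _ hq => ?_, map_zero, mul_zero]
      exact coef_eq_zero_of_not_mem (p := 0) (m := d) hq
        (Or.inr (by rwa [Int.natCast_zero, XiTilde.shift_zero]))
        (by rwa [Int.natCast_zero, XiTilde.shift_zero])
  · rw [brImage, dif_neg hX, zero_mul, MS.zero_apply,
      sCoef_eq_zero (N := 0) fun q _ hq => ?_, map_zero, mul_zero]
    exact coef_eq_zero_of_not_mem (p := 0) (m := d) hq
      (Or.inl (by rwa [Int.natCast_zero, XiTilde.shift_zero]))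
      (by rwa [Int.natCast_zero, XiTilde.shift_zero])

/-- The linear map from `K` to the Schur algebra. -/
def toMSLinear (n d : ℕ) : K n →ₗ[Aring] MS n d :=
  Finsupp.linearCombination Aring (M := MS n d) (brImage d)

theorem toMSLinear_br (d : ℕ) (X : XiTilde n) : toMSLinear n d (br X) = brImage d X :=
  (Finsupp.linearCombination_single Aring (1 : Aring) X).trans (one_smul _ _)

theorem toMSLinear_mul (d : ℕ) (x y : K n) :
    toMSLinear n d (x * y) = toMSLinear n d x * toMSLinear n d y := by
  induction x using induction_on with
  | h0 => simp only [zero_mul, map_zero]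
  | hadd x x' h h' => simp only [add_mul, map_add, h, h']
  | hbr a X =>
    induction y using induction_on with
    | h0 => simp only [mul_zero, map_zero]
    | hadd x x' h h' => simp only [mul_add, map_add, h, h']
    | hbr b Y =>
      simp only [smul_mul_assoc, mul_smul_comm, map_smul, br_mul_br_eq_sum, map_sum,
        toMSLinear_br, brImage_mul]

/-- The homomorphism from `K` to the Schur algebra. -/
def toMS (n d : ℕ) : K n →ₙₐ[Aring] MS n d where
  toFun := toMSLinear n d
  map_smul' := map_smul _
  map_zero' := map_zero _
  map_add' := map_add _
  map_mul' := toMSLinear_mul d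

theorem toMS_surjective (n d : ℕ) : Function.Surjective (toMS n d) := by
  classical
  intro g
  -- The power of `T` undoes the normalization of the basis elements.
  refine ⟨∑ X : Xi n d, (g X * LaurentPolynomial.T X.1.dr : Aring) • br X.1, ?_⟩
  change toMSLinear n d _ = g
  simp only [map_sum, map_smul, toMSLinear_br]
  funext Z
  refine (Finset.sum_apply _ _ _).trans ?_
  have h : ∀ X : Xi n d, brImage d X.1 = MS.br X := fun X => dif_pos X.2
  simp only [h, MS.smul_apply]
  rw [Finset.sum_eq_single Z, MS.br_apply_self, mul_assoc, ← LaurentPolynomial.T_add]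
  · simp
  · intro X _ hX
    rw [MS.br_apply_of_ne hX.symm, mul_zero]
  · simp

end K

/-- A quotient of the associative algebra `K n` is associative. -/
protected theorem MS.mul_assoc {n d : ℕ} (x y z : MS n d) : x * y * z = x * (y * z) := by
  obtain ⟨x, rfl⟩ := K.toMS_surjective n d x
  obtain ⟨y, rfl⟩ := K.toMS_surjective n d y
  obtain ⟨z, rfl⟩ := K.toMS_surjective n d z
  rw [← map_mul, ← map_mul, ← map_mul, ← map_mul, K.mul_assoc]

end Mirabolic

end

open Mirabolic in
open Classical in
theorem proposition5p2p5 (n d : ℕ) (hn : 0 < n) (hd : 0 < d) :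
    -- the structure polynomials and the stabilized products are well defined
    (∀ (m : ℕ), 0 < m → ∀ X Y Z : Xi n m, ∃! P : Polynomial ℤ, IsStructurePoly X Y Z P) ∧
    (∀ X Y : XiTilde n, X.co = Y.ro → ∃! c : XiTilde n →₀ Aring, IsStableProduct X Y c) ∧
    -- both products are associative
    (∀ x y z : MS n d, x * y * z = x * (y * z)) ∧
    (∀ x y z : K n, x * y * z = x * (y * z)) ∧
    -- the linear map is a surjective algebra homomorphism
    ∃ η : K n →ₙₐ[Aring] MS n d,
      (∀ X : XiTilde n, η (K.br X) = if h : X ∈ Xi n d then MS.br ⟨X, h⟩ else 0) ∧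
      Function.Surjective η :=
  ⟨fun _ _ => existsUnique_structurePoly, existsUnique_stableProduct, MS.mul_assoc, K.mul_assoc,
    K.toMS n d, K.toMSLinear_br d, K.toMS_surjective n d⟩
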